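/- Let $h_1,h_2,\rho_1,\rho_2,g>0$. Let $\eta\in C^1(\mathbb R^2)$ with $-h_1<\inf\eta$ and $\sup\eta<h_2$, and set $$\Omega_1=\{(x,y,z): -h_1<z<\eta(x,y)\},\qquad \Omega_2=\{(x,y,z): \eta(x,y)<z<h_2\}.$$ Let $\boldsymbol u_i=(u_i,v_i,w_i)\in C^1(\overline{\Omega_i};\mathbb R^3)$ and $P_i\in C^1(\overline{\Omega_i})$, $i=1,2$, be a steady internal wave, that is, $$\rho_i(\boldsymbol u_i\cdot\nabla)\boldsymbol u_i=-\nabla P_i+\rho_i(0,0,-g),\qquad \nabla\cdot\boldsymbol u_i=0\quad\text{in }\Omega_i,$$ $$u_i\eta_x+v_i\eta_y=w_i\ (i=1,2)\ \text{ and }\ P_1=P_2\quad\text{on } z=\eta(x,y),$$ $$w_1=0\ \text{ on } z=-h_1,\qquad w_2=0\ \text{ on } z=h_2.$$ Assume that $\boldsymbol u_1$ and $\boldsymbol u_2$ are bounded, and that the vorticities $\boldsymbol\omega_i=\nabla\times\boldsymbol u_i$ are constant in $\Omega_i$, nonzero, and parallel to each other. Then, after a suitable rotation of the coordinate axes about the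 $z$-axis, $\boldsymbol\omega_i=(0,\beta_i,0)$ for constants $\beta_1,\beta_2$, and at least one of the following holds: (a) the wave is two dimensional: in each layer $\boldsymbol u_i=(\tilde u_i(x,z),V_i,\tilde w_i(x,z))$ with a constant $V_i$, and $P_i=\tilde P_i(x,z)$, while $\eta=\eta(x)$ does not depend on $y$; (b) the wave is a trivially three-dimensional shear flow: $\boldsymbol u_i=(\beta_i z+k_i,0,0)$ for constants $k_i$, $i=1,2$, and $\eta=H(y)$ for some $H\in C^1(\mathbb R;(-h_1,h_2))$. If $\rho_1\neq\rho_2$, then (a) holds. -/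

import Mathlib

/-!
Steady three-dimensional internal waves between rigid walls: two superposed layers of
incompressible, inviscid fluid of constant densities, separated by the graph of `η`.
A point of space is `(x, y, z) : ℝ × ℝ × ℝ`, with `z` the vertical coordinate.
-/

namespace InternalWave

/-- Velocity components `u, v, w` and pressure `P` of one layer. Only the values on the closure of
the layer are meaningful. -/
structure Fluid where
  u : ℝ × ℝ × ℝ → ℝ
  v : ℝ × ℝ × ℝ → ℝ
  w : ℝ × ℝ × ℝ → ℝ
  P : ℝ × ℝ × ℝ → ℝ

/-- The data of a two-layer configuration: the walls are `z = -h₁` and `z = h₂`, the densities are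
`ρ₁` (lower layer) and `ρ₂` (upper layer), `g` is the gravitational acceleration, `η` the interface
and `F₁`, `F₂` the motions of the lower and upper fluid. -/
structure Config where
  h₁ : ℝ
  h₂ : ℝ
  ρ₁ : ℝ
  ρ₂ : ℝ
  g : ℝ
  η : ℝ × ℝ → ℝ
  F₁ : Fluid
  F₂ : Fluid

/-- `∂f/∂x` -/
noncomputable def dx (f : ℝ × ℝ × ℝ → ℝ) (p : ℝ × ℝ × ℝ) : ℝ := fderiv ℝ f p (1, 0, 0)

/-- `∂f/∂y` -/
noncomputable def dy (f : ℝ × ℝ × ℝ → ℝ) (p : ℝ × ℝ × ℝ) : ℝ := fderiv ℝ f p (0, 1, 0)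

/-- `∂f/∂z` -/
noncomputable def dz (f : ℝ × ℝ × ℝ → ℝ) (p : ℝ × ℝ × ℝ) : ℝ := fderiv ℝ f p (0, 0, 1)

/-- The vorticity `∇ × (u, v, w)`. -/
noncomputable def Fluid.vorticity (F : Fluid) (p : ℝ × ℝ × ℝ) : ℝ × ℝ × ℝ :=
  (dy F.w p - dz F.v p, dz F.u p - dx F.w p, dx F.v p - dy F.u p)

/-- All fields are of class `C¹` up to the boundary of `Ω`. -/
structure Fluid.IsC1On (F : Fluid) (Ω : Set (ℝ × ℝ × ℝ)) : Prop where
  u : ContDiffOn ℝ 1 F.u (closure Ω)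
  v : ContDiffOn ℝ 1 F.v (closure Ω)
  w : ContDiffOn ℝ 1 F.w (closure Ω)
  P : ContDiffOn ℝ 1 F.P (closure Ω)

/-- The steady incompressible Euler equations with density `ρ` and gravity `(0, 0, -g)` in the
open set `Ω`. -/
structure Fluid.SolvesEuler (F : Fluid) (ρ g : ℝ) (Ω : Set (ℝ × ℝ × ℝ)) : Prop where
  momentum_x : ∀ p ∈ Ω,
    ρ * (F.u p * dx F.u p + F.v p * dy F.u p + F.w p * dz F.u p) = - dx F.P p
  momentum_y : ∀ p ∈ Ω,
    ρ * (F.u p * dx F.v p + F.v p * dy F.v p + F.w p * dz F.v p) = - dy F.P p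
  momentum_z : ∀ p ∈ Ω,
    ρ * (F.u p * dx F.w p + F.v p * dy F.w p + F.w p * dz F.w p) = - dz F.P p - ρ * g
  incompressible : ∀ p ∈ Ω, dx F.u p + dy F.v p + dz F.w p = 0

/-- The velocity is uniformly bounded on `Ω`. -/
def Fluid.BoundedVelocityOn (F : Fluid) (Ω : Set (ℝ × ℝ × ℝ)) : Prop :=
  ∃ M : ℝ, ∀ p ∈ Ω, |F.u p| ≤ M ∧ |F.v p| ≤ M ∧ |F.w p| ≤ M

/-- The lower layer `-h₁ < z < η(x, y)`. -/
def Config.lower (C : Config) : Set (ℝ × ℝ × ℝ) :=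
  {p | -C.h₁ < p.2.2 ∧ p.2.2 < C.η (p.1, p.2.1)}

/-- The upper layer `η(x, y) < z < h₂`. -/
def Config.upper (C : Config) : Set (ℝ × ℝ × ℝ) :=
  {p | C.η (p.1, p.2.1) < p.2.2 ∧ p.2.2 < C.h₂}

/-- Classical solutions of the steady internal wave problem. -/
structure Config.IsSteadyWave (C : Config) : Prop where
  h₁_pos : 0 < C.h₁
  h₂_pos : 0 < C.h₂
  ρ₁_pos : 0 < C.ρ₁
  ρ₂_pos : 0 < C.ρ₂
  g_pos : 0 < C.g
  η_C1 : ContDiff ℝ 1 C.η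
  /-- `-h₁ < inf η` -/
  separated_below : ∃ a : ℝ, -C.h₁ < a ∧ ∀ q, a ≤ C.η q
  /-- `sup η < h₂` -/
  separated_above : ∃ b : ℝ, b < C.h₂ ∧ ∀ q, C.η q ≤ b
  C1_lower : C.F₁.IsC1On C.lower
  C1_upper : C.F₂.IsC1On C.upper
  euler_lower : C.F₁.SolvesEuler C.ρ₁ C.g C.lower
  euler_upper : C.F₂.SolvesEuler C.ρ₂ C.g C.upper
  kinematic_lower : ∀ x y : ℝ,
    C.F₁.u (x, y, C.η (x, y)) * fderiv ℝ C.η (x, y) (1, 0)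
      + C.F₁.v (x, y, C.η (x, y)) * fderiv ℝ C.η (x, y) (0, 1) = C.F₁.w (x, y, C.η (x, y))
  kinematic_upper : ∀ x y : ℝ,
    C.F₂.u (x, y, C.η (x, y)) * fderiv ℝ C.η (x, y) (1, 0)
      + C.F₂.v (x, y, C.η (x, y)) * fderiv ℝ C.η (x, y) (0, 1) = C.F₂.w (x, y, C.η (x, y))
  dynamic : ∀ x y : ℝ, C.F₁.P (x, y, C.η (x, y)) = C.F₂.P (x, y, C.η (x, y))
  bed : ∀ x y : ℝ, C.F₁.w (x, y, -C.h₁) = 0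
  lid : ∀ x y : ℝ, C.F₂.w (x, y, C.h₂) = 0

/-- Rotation of `ℝ³` by the angle `θ` about the vertical axis. -/
noncomputable def rotZ (θ : ℝ) (p : ℝ × ℝ × ℝ) : ℝ × ℝ × ℝ :=
  (Real.cos θ * p.1 - Real.sin θ * p.2.1, Real.sin θ * p.1 + Real.cos θ * p.2.1, p.2.2)

/-- The same motion, written in the horizontal axes obtained by turning the given ones by `θ`:
the point with new coordinates `p` has old coordinates `rotZ θ p`, and a vector with old components
`a` has new components `rotZ (-θ) a`. -/
noncomputable def Fluid.inAxes (F : Fluid) (θ : ℝ) : Fluid where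
  u p := (rotZ (-θ) (F.u (rotZ θ p), F.v (rotZ θ p), F.w (rotZ θ p))).1
  v p := (rotZ (-θ) (F.u (rotZ θ p), F.v (rotZ θ p), F.w (rotZ θ p))).2.1
  w p := (rotZ (-θ) (F.u (rotZ θ p), F.v (rotZ θ p), F.w (rotZ θ p))).2.2
  P p := F.P (rotZ θ p)

/-- The same configuration, written in the horizontal axes turned by `θ`. -/
noncomputable def Config.inAxes (C : Config) (θ : ℝ) : Config where
  h₁ := C.h₁
  h₂ := C.h₂
  ρ₁ := C.ρ₁
  ρ₂ := C.ρ₂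
  g := C.g
  η q := C.η (Real.cos θ * q.1 - Real.sin θ * q.2, Real.sin θ * q.1 + Real.cos θ * q.2)
  F₁ := C.F₁.inAxes θ
  F₂ := C.F₂.inAxes θ

/-- On `S`, the motion is `(ũ(x, z), V, w̃(x, z))` with pressure `P̃(x, z)`, `V` being a constant. -/
def Fluid.IsPlanarOn (F : Fluid) (S : Set (ℝ × ℝ × ℝ)) : Prop :=
  ∃ (U W Q : ℝ × ℝ → ℝ) (V : ℝ), ∀ p ∈ S,
    F.u p = U (p.1, p.2.2) ∧ F.v p = V ∧ F.w p = W (p.1, p.2.2) ∧ F.P p = Q (p.1, p.2.2)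

/-- The wave is two dimensional in the `xz`-plane: nothing depends on `y`, and the transverse
velocity is constant in each layer. -/
def Config.IsTwoDimensional (C : Config) : Prop :=
  C.F₁.IsPlanarOn (closure C.lower) ∧ C.F₂.IsPlanarOn (closure C.upper) ∧
    ∃ N : ℝ → ℝ, ∀ x y : ℝ, C.η (x, y) = N x

/-- On `S`, the velocity is `(β z + k, 0, 0)` for some constant `k`. -/
def Fluid.IsShearOn (F : Fluid) (β : ℝ) (S : Set (ℝ × ℝ × ℝ)) : Prop :=
  ∃ k : ℝ, ∀ p ∈ S, F.u p = β * p.2.2 + k ∧ F.v p = 0 ∧ F.w p = 0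

/-- Trivially three-dimensional shear flows: `(uᵢ, vᵢ, wᵢ) = (βᵢ z + kᵢ, 0, 0)` and `η = H(y)`. -/
def Config.IsTrivialShear (C : Config) (β₁ β₂ : ℝ) : Prop :=
  C.F₁.IsShearOn β₁ (closure C.lower) ∧ C.F₂.IsShearOn β₂ (closure C.upper) ∧
    ∃ H : ℝ → ℝ, ContDiff ℝ 1 H ∧ (∀ y : ℝ, -C.h₁ < H y ∧ H y < C.h₂) ∧
      ∀ x y : ℝ, C.η (x, y) = H y

end InternalWave

open Set Filter Topology MeasureTheory

/-! The Bernoulli function H = P/ρ + gz + |u|²/2 satisfies ∇H = u × ω. The circulation of a bounded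
velocity around a horizontal square of side R is O(R), while a vertical vorticity c would make it
cR². So ω is horizontal, and after a rotation ω = (0, β, 0) and ∇H = (-βw, 0, βu). Symmetry of the
second derivatives of H gives u_y = w_y = 0 and u_x + w_z = 0. Hence v is a constant V, f = (u - βz)
- iw is holomorphic in ζ = x + iz, and Ψ = H/β is a stream function. The pressure also depends on ζ
alone, so only η can still depend on y.

Where η(x, ·) is not constant, the interface sweeps out an open set of the plane, the `overlap`.
Both motions are defined there and, by the dynamic condition, have the same pressure. Applying ∂/∂ζ
to the equality of the pressure gradients yields ρ₁(u₁ + iw₁)f₁'' = ρ₂(u₂ + iw₂)f₂''. A holomorphic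
ratio between two velocities with constant vorticity must be constant (`factor_eq_const`). So either
both f are affine, hence constant by boundedness, and the wave is a shear flow; or ρ₁ = ρ₂ and f₁ =
±f₂ on the overlap (`affine_or_proportional`). In the second case f₁ and ±f₂ glue to one holomorphic
function over all columns where η depends on y. If these are all the columns, its imaginary part is
bounded and vanishes on both walls of a strip. A Liouville argument then makes it constant: a shear
flow again.

It remains to exclude a mixture of flat columns (η independent of y) and non-flat ones. With y read
as time, the kinematic condition says that z = η(·, y) is a material curve of a steady planar flow,
and the value g of Ψ on the curve is carried by its particles. Normalize g = 0 on a flat column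
bounding a gap of non-flat ones. Since g_x = -Vη_y, the derivative of ∫ g² dy in x is an integral of
Ψ over a bounded range of heights. So g is square integrable in y on every column, uniformly over
bounded parts of the gap, and a particle with g ≠ 0 cannot stay in a bounded region
(`Front.not_forall_mem_Icc`). In a bounded gap particles are trapped, so g = 0. In an infinite gap
the flow is close to a uniform shear far away, and Ψ or -Ψ is convex in z there. A trailing particle
on a higher level is then faster and would overtake those ahead of it, which is impossible on a
graph (`ShearedFront.overtake`); so again g = 0. But g = 0 over the gap makes Ψ constant on an open
set, contradicting β ≠ 0. -/

namespace InternalWave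

/-! ### Scalar analysis and ordinary differential equations. -/

/-- Barbalat's lemma. -/
theorem tendsto_zero_of_uniformContinuousOn_deriv {F F' : ℝ → ℝ} {a l : ℝ}
    (hF : ∀ y, HasDerivAt F (F' y) y) (hlim : Tendsto F atTop (𝓝 l))
    (huc : UniformContinuousOn F' (Ici a)) : Tendsto F' atTop (𝓝 0) := by
  rw [Metric.tendsto_atTop]
  intro ε hε
  obtain ⟨δ, hδ, h⟩ := Metric.uniformContinuousOn_iff.1 huc (ε / 2) (by positivity)
  -- Beyond `N` the slope of `F` over a step δ/2 is at most (εδ/8)/(δ/2) = ε/4, and `F'` varies by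
  -- less than ε/2 on that step.
  obtain ⟨N, hN⟩ := Metric.tendsto_atTop.1 hlim (ε * δ / 16) (by positivity)
  refine ⟨max N a, fun y hy => ?_⟩
  have hyN : N ≤ y := (le_max_left _ _).trans hy
  have hya : a ≤ y := (le_max_right _ _).trans hy
  obtain ⟨c, hc, hc'⟩ := exists_hasDerivAt_eq_slope F F' (show y < y + δ / 2 by linarith)
    (fun t _ => (hF t).continuousAt.continuousWithinAt) (fun t _ => hF t)
  have h1 := hN y hyN
  have h2 := hN (y + δ / 2) (by linarith)
  have h3 := h y hya c (by simp only [mem_Ici]; linarith [hc.1])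
    (by rw [Real.dist_eq, abs_lt]; constructor <;> linarith [hc.1, hc.2])
  rw [Real.dist_eq] at h1 h2 h3 ⊢
  have h4 : |F' c| ≤ ε / 4 := by
    rw [hc', add_sub_cancel_left, abs_div, abs_of_pos (show 0 < δ / 2 by positivity),
      div_le_iff₀ (by positivity)]
    rw [abs_lt] at h1 h2
    rw [abs_le]; constructor <;> nlinarith
  rw [sub_zero]
  have := abs_sub_abs_le_abs_sub (F' y) (F' c)
  linarith

/-- Differentiation under an interval integral, for continuous integrand and derivative. -/
theorem hasDerivAt_integral_param {F F' : ℝ → ℝ → ℝ} (hF : Continuous (Function.uncurry F))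
    (hF' : Continuous (Function.uncurry F')) (h : ∀ x t, HasDerivAt (fun x => F x t) (F' x t) x)
    (a b x₀ : ℝ) :
    HasDerivAt (fun x => ∫ t in a..b, F x t) (∫ t in a..b, F' x₀ t) x₀ := by
  have hK : IsCompact (Icc (x₀ - 1) (x₀ + 1) ×ˢ uIcc a b) := isCompact_Icc.prod isCompact_uIcc
  obtain ⟨C, hC⟩ := hK.exists_bound_of_continuousOn hF'.continuousOn
  have hs (x : ℝ) : Continuous (F x) := hF.comp (by fun_prop : Continuous fun t => (x, t))
  have hs' (x : ℝ) : Continuous (F' x) := hF'.comp (by fun_prop : Continuous fun t => (x, t))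
  refine (intervalIntegral.hasDerivAt_integral_of_dominated_loc_of_deriv_le
    (s := Icc (x₀ - 1) (x₀ + 1)) (bound := fun _ => C)
    (Icc_mem_nhds (by linarith) (by linarith))
    (Eventually.of_forall fun x => (hs x).aestronglyMeasurable)
    ((hs x₀).intervalIntegrable _ _) (hs' x₀).aestronglyMeasurable ?_
    intervalIntegrable_const (Eventually.of_forall fun t _ x _ => h x t)).2
  exact Eventually.of_forall fun t ht x hx => hC (x, t) ⟨hx, uIoc_subset_uIcc ht⟩

/-- A `C¹` function is Lipschitz in its first variable, uniformly on compact sets. -/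
theorem exists_lipschitzOnWith_Icc {b : ℝ × ℝ → ℝ} (hb : ContDiff ℝ 1 b) (x₁ x₂ y₁ y₂ : ℝ) :
    ∃ K : NNReal, ∀ y ∈ Icc y₁ y₂, LipschitzOnWith K (fun x => b (x, y)) (Icc x₁ x₂) := by
  obtain ⟨K, hK⟩ := ((isCompact_Icc.prod isCompact_Icc).exists_bound_of_continuousOn
    (hb.continuous_fderiv one_ne_zero).continuousOn : ∃ K, ∀ p ∈ Icc x₁ x₂ ×ˢ Icc y₁ y₂, _)
  refine ⟨K.toNNReal, fun y hy => ?_⟩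
  have hlip : LipschitzOnWith K.toNNReal b (Icc x₁ x₂ ×ˢ Icc y₁ y₂) :=
    Convex.lipschitzOnWith_of_nnnorm_fderiv_le
      (fun p _ => (hb.differentiable one_ne_zero) p)
      (fun p hp => by
        rw [← NNReal.coe_le_coe, Real.coe_toNNReal']
        exact (hK p hp).trans (le_max_left _ _))
      ((convex_Icc _ _).prod (convex_Icc _ _))
  intro p hp q hq
  have := hlip (x := (p, y)) ⟨hp, hy⟩ (y := (q, y)) ⟨hq, hy⟩
  simpa [Prod.edist_eq] using this

/-- Uniqueness for scalar time-dependent equations with a `C¹` right-hand side. -/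
theorem eqOn_of_hasDerivAt_of_contDiff {b : ℝ × ℝ → ℝ} (hb : ContDiff ℝ 1 b) {ξ ζ : ℝ → ℝ}
    {y₁ y₂ y₀ : ℝ} (hy₀ : y₀ ∈ Ioo y₁ y₂)
    (hξc : ContinuousOn ξ (Icc y₁ y₂)) (hξ : ∀ y ∈ Ioo y₁ y₂, HasDerivAt ξ (b (ξ y, y)) y)
    (hζc : ContinuousOn ζ (Icc y₁ y₂)) (hζ : ∀ y ∈ Ioo y₁ y₂, HasDerivAt ζ (b (ζ y, y)) y)
    (h₀ : ξ y₀ = ζ y₀) : EqOn ξ ζ (Icc y₁ y₂) := by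
  obtain ⟨A, hA⟩ := isCompact_Icc.exists_bound_of_continuousOn hξc
  obtain ⟨B, hB⟩ := isCompact_Icc.exists_bound_of_continuousOn hζc
  obtain ⟨K, hK⟩ := exists_lipschitzOnWith_Icc hb (-max A B) (max A B) y₁ y₂
  refine ODE_solution_unique_of_mem_Icc (v := fun y x => b (x, y))
    (s := fun _ => Icc (-max A B) (max A B)) (K := K)
    (fun t ht => hK t (Ioo_subset_Icc_self ht)) hy₀ hξc hξ (fun t ht => ?_) hζc hζ
    (fun t ht => ?_) h₀
  · have := hA t (Ioo_subset_Icc_self ht)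
    rw [Real.norm_eq_abs] at this
    exact abs_le.1 (this.trans (le_max_left _ _))
  · have := hB t (Ioo_subset_Icc_self ht)
    rw [Real.norm_eq_abs] at this
    exact abs_le.1 (this.trans (le_max_right _ _))

/-- Existence on a symmetric interval for a bounded `C¹` right-hand side. -/
theorem exists_solution_Icc {b : ℝ × ℝ → ℝ} (hb : ContDiff ℝ 1 b) {M : ℝ} (hM : ∀ q, |b q| ≤ M)
    (x₀ y₀ T : ℝ) (hT : 0 < T) :
    ∃ ξ : ℝ → ℝ, ξ y₀ = x₀ ∧ ContinuousOn ξ (Icc (y₀ - T) (y₀ + T)) ∧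
      ∀ y ∈ Ioo (y₀ - T) (y₀ + T), HasDerivAt ξ (b (ξ y, y)) y := by
  have hM0 : 0 ≤ M := (abs_nonneg _).trans (hM 0)
  -- At speed at most `M` a solution moves by at most `M * T`, so a Lipschitz constant on this range
  -- is enough.
  obtain ⟨K, hK⟩ := exists_lipschitzOnWith_Icc hb (x₀ - M * T) (x₀ + M * T) (y₀ - T) (y₀ + T)
  have hPL : IsPicardLindelof (fun y x => b (x, y))
      (⟨y₀, by constructor <;> linarith⟩ : Icc (y₀ - T) (y₀ + T)) x₀ (M * T).toNNReal 0
      M.toNNReal K := by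
    refine ⟨fun t ht => ?_, fun x _ => ?_, fun t _ x _ => ?_, ?_⟩
    · rw [Real.closedBall_eq_Icc, Real.coe_toNNReal _ (by positivity)]; exact hK t ht
    · exact (hb.continuous.comp (by fun_prop : Continuous fun t : ℝ => (x, t))).continuousOn
    · rw [Real.coe_toNNReal _ hM0]; exact hM _
    · rw [Real.coe_toNNReal _ hM0, Real.coe_toNNReal _ (by positivity)]
      simp
  obtain ⟨ξ, h0, h⟩ := hPL.exists_eq_forall_mem_Icc_hasDerivWithinAt₀
  exact ⟨ξ, h0, fun y hy => (h y hy).continuousWithinAt,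
    fun y hy => (h y (Ioo_subset_Icc_self hy)).hasDerivAt (Icc_mem_nhds hy.1 hy.2)⟩

/-- Global existence for a bounded `C¹` right-hand side. -/
theorem exists_solution {b : ℝ × ℝ → ℝ} (hb : ContDiff ℝ 1 b) {M : ℝ} (hM : ∀ q, |b q| ≤ M)
    (x₀ y₀ : ℝ) : ∃ ξ : ℝ → ℝ, ξ y₀ = x₀ ∧ ∀ y, HasDerivAt ξ (b (ξ y, y)) y := by
  choose ξ h0 hc hd using fun n : ℕ =>
    exists_solution_Icc hb hM x₀ y₀ (n + 1 : ℝ) (by positivity)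
  have key (n m : ℕ) (hnm : n ≤ m) :
      EqOn (ξ m) (ξ n) (Icc (y₀ - (n + 1 : ℝ)) (y₀ + (n + 1 : ℝ))) := by
    have hnm' : (n : ℝ) ≤ m := by exact_mod_cast hnm
    have hn : (0 : ℝ) ≤ n := n.cast_nonneg
    refine eqOn_of_hasDerivAt_of_contDiff hb (y₀ := y₀) (by constructor <;> linarith)
      ((hc m).mono (Icc_subset_Icc (by linarith) (by linarith)))
      (fun y hy => hd m y ⟨by linarith [hy.1], by linarith [hy.2]⟩) (hc n) (hd n) ?_
    rw [h0, h0]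
  -- The interval of half-length `N y + 1` contains `y` in its interior, and by `key` any other such
  -- interval gives the same value.
  set N : ℝ → ℕ := fun y => ⌈|y - y₀|⌉₊
  have hN (y : ℝ) : |y - y₀| ≤ N y := Nat.le_ceil _
  have hglue (y : ℝ) (n : ℕ) (hy : |y - y₀| ≤ n + 1) : ξ (N y) y = ξ n y := by
    rcases le_total (N y) n with h | h
    · refine (key _ _ h ?_).symm
      have := abs_le.1 (hN y)
      constructor <;> linarith
    · refine key _ _ h ?_
      have := abs_le.1 hy
      constructor <;> linarith
  refine ⟨fun y => ξ (N y) y, h0 _, fun y => ?_⟩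
  have hlt : |y - y₀| < N y + 1 := by linarith [hN y]
  have hy : y ∈ Ioo (y₀ - (N y + 1 : ℝ)) (y₀ + (N y + 1 : ℝ)) := by
    have := abs_lt.1 hlt
    constructor <;> linarith
  refine (hd (N y) y hy).congr_of_eventuallyEq ?_
  filter_upwards [Ioo_mem_nhds hy.1 hy.2] with t ht
  refine hglue t _ (abs_le.2 ⟨?_, ?_⟩)
  · linarith [ht.1]
  · linarith [ht.2]


/-! ### Fronts carried by a planar flow and their particle paths. -/

theorem hasDerivAt_along {φ : ℝ × ℝ → ℝ} (hφ : ContDiff ℝ 1 φ) {ξ : ℝ → ℝ} {ξ' y : ℝ}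
    (h : HasDerivAt ξ ξ' y) :
    HasDerivAt (fun t => φ (ξ t, t))
      (ξ' * fderiv ℝ φ (ξ y, y) (1, 0) + fderiv ℝ φ (ξ y, y) (0, 1)) y := by
  have h1 := HasFDerivAt.comp_hasDerivAt (f := fun t => (ξ t, t)) y
    ((hφ.differentiable one_ne_zero) (ξ y, y)).hasFDerivAt (h.prodMk (hasDerivAt_id' y))
  have h2 : ((ξ', 1) : ℝ × ℝ) = ξ' • ((1, 0) : ℝ × ℝ) + (0, 1) := by ext <;> simp
  rw [h2, map_add, map_smul, smul_eq_mul] at h1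
  exact h1

theorem hasDerivAt_fst {φ : ℝ × ℝ → ℝ} (hφ : ContDiff ℝ 1 φ) (x y : ℝ) :
    HasDerivAt (fun t => φ (t, y)) (fderiv ℝ φ (x, y) (1, 0)) x :=
  ((hφ.differentiable one_ne_zero) (x, y)).hasFDerivAt.comp_hasDerivAt x
    ((hasDerivAt_id x).prodMk (hasDerivAt_const x y))

theorem hasDerivAt_snd {φ : ℝ × ℝ → ℝ} (hφ : ContDiff ℝ 1 φ) (x y : ℝ) :
    HasDerivAt (fun t => φ (x, t)) (fderiv ℝ φ (x, y) (0, 1)) y :=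
  ((hφ.differentiable one_ne_zero) (x, y)).hasFDerivAt.comp_hasDerivAt y
    ((hasDerivAt_const y x).prodMk (hasDerivAt_id y))

theorem continuous_fderiv_apply {φ : ℝ × ℝ → ℝ} (hφ : ContDiff ℝ 1 φ) (v : ℝ × ℝ) :
    Continuous fun q => fderiv ℝ φ q v :=
  (hφ.continuous_fderiv one_ne_zero).clm_apply continuous_const

/-- A curve `z = η(·, y)` of the plane, carried by a flow as `y` grows: `b` is the horizontal
velocity at the curve and `g` the value of the stream function there. -/
structure Front (V M lo hi : ℝ) (η b g : ℝ × ℝ → ℝ) : Prop where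
  V_ne : V ≠ 0
  η_C1 : ContDiff ℝ 1 η
  b_C1 : ContDiff ℝ 1 b
  g_C1 : ContDiff ℝ 1 g
  η_mem : ∀ q, η q ∈ Icc lo hi
  b_le : ∀ q, |b q| ≤ M
  climb_le : ∀ q, |b q * fderiv ℝ η q (1, 0) + V * fderiv ℝ η q (0, 1)| ≤ M
  g_x : ∀ q, fderiv ℝ g q (1, 0) = -V * fderiv ℝ η q (0, 1)
  g_y : ∀ q, fderiv ℝ g q (0, 1) = b q * fderiv ℝ η q (0, 1)

/-- Particle paths on the front, parametrized by `y`. -/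
def IsPath (V : ℝ) (b : ℝ × ℝ → ℝ) (ξ : ℝ → ℝ) : Prop := ∀ y, HasDerivAt ξ (b (ξ y, y) / V) y

namespace Front

variable {V M lo hi : ℝ} {η b g : ℝ × ℝ → ℝ}

theorem exists_path (F : Front V M lo hi η b g) (x₀ y₀ : ℝ) :
    ∃ ξ, ξ y₀ = x₀ ∧ IsPath V b ξ :=
  exists_solution (b := fun q => b q / V) (F.b_C1.div_const V) (M := M / |V|)
    (fun q => by rw [abs_div]; have := F.b_le q; gcongr) x₀ y₀

theorem continuous_path {ξ : ℝ → ℝ} (hξ : IsPath V b ξ) : Continuous ξ :=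
  continuous_iff_continuousAt.2 fun y => (hξ y).continuousAt

theorem path_unique (F : Front V M lo hi η b g) {ξ ζ : ℝ → ℝ} (hξ : IsPath V b ξ)
    (hζ : IsPath V b ζ) {y₀ : ℝ} (h : ξ y₀ = ζ y₀) (y : ℝ) : ξ y = ζ y := by
  have hb : ContDiff ℝ 1 fun q => b q / V := F.b_C1.div_const V
  refine eqOn_of_hasDerivAt_of_contDiff hb (y₁ := min y y₀ - 1) (y₂ := max y y₀ + 1) (y₀ := y₀)
    ⟨?_, ?_⟩ (continuous_path hξ).continuousOn (fun t _ => hξ t)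
    (continuous_path hζ).continuousOn (fun t _ => hζ t) h ⟨?_, ?_⟩
  · linarith [min_le_right y y₀]
  · linarith [le_max_right y y₀]
  · linarith [min_le_left y y₀]
  · linarith [le_max_left y y₀]

theorem path_lt (F : Front V M lo hi η b g) {ξ ζ : ℝ → ℝ} (hξ : IsPath V b ξ)
    (hζ : IsPath V b ζ) {y₀ : ℝ} (h : ξ y₀ < ζ y₀) (y : ℝ) : ξ y < ζ y := by
  by_contra hy
  push Not at hy
  have hc : Continuous fun t => ξ t - ζ t := (continuous_path hξ).sub (continuous_path hζ)
  obtain ⟨t, -, ht⟩ := intermediate_value_uIcc (a := y₀) (b := y) hc.continuousOn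
    (show (0 : ℝ) ∈ _ from mem_uIcc.2 (Or.inl ⟨by linarith, by linarith⟩))
  have := F.path_unique hξ hζ (sub_eq_zero.1 ht) y₀
  linarith

theorem path_le (F : Front V M lo hi η b g) {ξ ζ : ℝ → ℝ} (hξ : IsPath V b ξ)
    (hζ : IsPath V b ζ) {y₀ : ℝ} (h : ξ y₀ ≤ ζ y₀) (y : ℝ) : ξ y ≤ ζ y := by
  rcases h.lt_or_eq with h | h
  · exact (F.path_lt hξ hζ h y).le
  · exact (F.path_unique hξ hζ h y).le

/-- Along ξ' = b/V the terms (b/V)g_x = -bη_y and g_y = bη_y cancel: particles keep their level of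
the stream function. -/
theorem g_path (F : Front V M lo hi η b g) {ξ : ℝ → ℝ} (hξ : IsPath V b ξ) (y y' : ℝ) :
    g (ξ y, y) = g (ξ y', y') := by
  have h (t : ℝ) : HasDerivAt (fun t => g (ξ t, t)) 0 t := by
    have := hasDerivAt_along F.g_C1 (hξ t)
    have hV := F.V_ne
    rw [F.g_x, F.g_y] at this
    convert this using 1
    field_simp
    ring
  exact is_const_of_deriv_eq_zero (fun t => (h t).differentiableAt) (fun t => (h t).deriv) y y'

theorem lipschitz_path (F : Front V M lo hi η b g) {ξ : ℝ → ℝ} (hξ : IsPath V b ξ) :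
    LipschitzWith (M / |V|).toNNReal ξ := by
  refine lipschitzWith_of_nnnorm_deriv_le (fun y => (hξ y).differentiableAt) fun y => ?_
  rw [← NNReal.coe_le_coe, Real.coe_toNNReal', (hξ y).deriv, coe_nnnorm, Real.norm_eq_abs, abs_div]
  refine le_max_of_le_left ?_
  have := F.b_le (ξ y, y)
  gcongr

theorem lipschitz_height (F : Front V M lo hi η b g) {ξ : ℝ → ℝ} (hξ : IsPath V b ξ) :
    LipschitzWith (M / |V|).toNNReal fun y => η (ξ y, y) := by
  have h (y : ℝ) := hasDerivAt_along F.η_C1 (hξ y)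
  refine lipschitzWith_of_nnnorm_deriv_le (fun y => (h y).differentiableAt) fun y => ?_
  rw [← NNReal.coe_le_coe, Real.coe_toNNReal', (h y).deriv, coe_nnnorm, Real.norm_eq_abs]
  refine le_max_of_le_left ?_
  have hV := F.V_ne
  have h1 : b (ξ y, y) / V * fderiv ℝ η (ξ y, y) (1, 0) + fderiv ℝ η (ξ y, y) (0, 1)
      = (b (ξ y, y) * fderiv ℝ η (ξ y, y) (1, 0) + V * fderiv ℝ η (ξ y, y) (0, 1)) / V := by
    field_simp
  rw [h1, abs_div]
  have := F.climb_le (ξ y, y)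
  gcongr

/-- A column on which `g` never takes the level of a path is a barrier for that path. -/
theorem path_gt (F : Front V M lo hi η b g) {ξ : ℝ → ℝ} (hξ : IsPath V b ξ) {x₁ y₀ : ℝ}
    (hx₁ : ∀ y, g (x₁, y) ≠ g (ξ y₀, y₀)) (h : x₁ < ξ y₀) (y : ℝ) : x₁ < ξ y := by
  by_contra hy
  push Not at hy
  obtain ⟨t, -, ht⟩ := intermediate_value_uIcc (a := y₀) (b := y)
    (continuous_path hξ).continuousOn
    (show x₁ ∈ _ from mem_uIcc.2 (Or.inr ⟨by linarith, by linarith⟩))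
  exact hx₁ t (by rw [← ht, F.g_path hξ t y₀])

theorem path_lt_of_ne (F : Front V M lo hi η b g) {ξ : ℝ → ℝ} (hξ : IsPath V b ξ) {x₂ y₀ : ℝ}
    (hx₂ : ∀ y, g (x₂, y) ≠ g (ξ y₀, y₀)) (h : ξ y₀ < x₂) (y : ℝ) : ξ y < x₂ := by
  by_contra hy
  push Not at hy
  obtain ⟨t, -, ht⟩ := intermediate_value_uIcc (a := y₀) (b := y)
    (continuous_path hξ).continuousOn
    (show x₂ ∈ _ from mem_uIcc.2 (Or.inl ⟨by linarith, by linarith⟩))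
  exact hx₂ t (by rw [← ht, F.g_path hξ t y₀])

/-- If the stream function vanishes on the front over `x₁`, then it is square integrable in `y` on
the front over every `x`. -/
theorem integral_sq_le (F : Front V M lo hi η b g) {x₁ X : ℝ} {Ψ : ℝ × ℝ → ℝ}
    (hΨ : ContinuousOn Ψ (Icc x₁ X ×ˢ Icc lo hi))
    (hg : ∀ x ∈ Icc x₁ X, ∀ y, g (x, y) = Ψ (x, η (x, y))) (hg₁ : ∀ y, g (x₁, y) = 0) :
    ∃ C, 0 ≤ C ∧ ∀ x ∈ Icc x₁ X, ∀ y₁ y₂, ∫ y in y₁..y₂, g (x, y) ^ 2 ≤ C := by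
  obtain ⟨K, hK⟩ := (isCompact_Icc.prod isCompact_Icc).exists_bound_of_continuousOn hΨ
  have hη := F.η_mem
  have hgc := F.g_C1.continuous
  have hηc := continuous_fderiv_apply F.η_C1 (0, 1)
  set C₀ := 2 * |V| * (max K 0 * (hi - lo)) with hC₀
  have hlohi : lo ≤ hi := (hη 0).1.trans (hη 0).2
  have hC₀n : 0 ≤ C₀ := by
    have : 0 ≤ hi - lo := by linarith
    positivity
  refine ⟨C₀ * |X - x₁|, by positivity, fun x hx y₁ y₂ => ?_⟩
  -- Since g_x = -Vη_y, the derivative of ∫ g² dy in x is -2V ∫ Ψ(x, η)η_y dy. The substitution z =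
  -- η(x, y) turns it into an integral of Ψ over heights in [lo, hi], bounded independently of `y₁`
  -- and `y₂`.
  have hd (t : ℝ) : HasDerivAt (fun x => ∫ y in y₁..y₂, g (x, y) ^ 2)
      (∫ y in y₁..y₂, 2 * g (t, y) * fderiv ℝ g (t, y) (1, 0)) t := by
    refine hasDerivAt_integral_param (F := fun x y => g (x, y) ^ 2)
      (F' := fun x y => 2 * g (x, y) * fderiv ℝ g (x, y) (1, 0)) (by fun_prop) ?_ ?_ y₁ y₂ t
    · exact (continuous_const.mul hgc).mul (continuous_fderiv_apply F.g_C1 (1, 0))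
    · intro x y
      have := (hasDerivAt_fst F.g_C1 x y).fun_pow 2
      simpa using this
  have hbd (t : ℝ) (ht : t ∈ Icc x₁ X) :
      ‖∫ y in y₁..y₂, 2 * g (t, y) * fderiv ℝ g (t, y) (1, 0)‖ ≤ C₀ := by
    have h1 : ∫ y in y₁..y₂, 2 * g (t, y) * fderiv ℝ g (t, y) (1, 0)
        = (-2 * V) * ∫ z in η (t, y₁)..η (t, y₂), Ψ (t, z) := by
      rw [← intervalIntegral.integral_comp_mul_deriv'' (f := fun y => η (t, y))
        (f' := fun y => fderiv ℝ η (t, y) (0, 1)) (g := fun z => Ψ (t, z)),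
        ← intervalIntegral.integral_const_mul]
      · refine intervalIntegral.integral_congr fun y _ => ?_
        simp only [Function.comp, F.g_x, hg t ht y]
        ring
      · exact (F.η_C1.continuous.comp (by fun_prop : Continuous fun y : ℝ => (t, y))).continuousOn
      · exact fun y _ => (hasDerivAt_snd F.η_C1 t y).hasDerivWithinAt
      · exact (hηc.comp (by fun_prop : Continuous fun y : ℝ => (t, y))).continuousOn
      · refine hΨ.comp (by fun_prop) ?_
        rintro z ⟨y, -, rfl⟩
        exact ⟨ht, hη _⟩
    rw [h1, norm_mul, hC₀]
    have h2 : ‖∫ z in η (t, y₁)..η (t, y₂), Ψ (t, z)‖ ≤ max K 0 * |η (t, y₂) - η (t, y₁)| := by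
      refine intervalIntegral.norm_integral_le_of_norm_le_const fun z hz => ?_
      refine (hK (t, z) ⟨ht, ?_⟩).trans (le_max_left _ _)
      exact uIcc_subset_Icc (hη _) (hη _) (uIoc_subset_uIcc hz)
    have h3 : |η (t, y₂) - η (t, y₁)| ≤ hi - lo := by
      obtain ⟨h5, h6⟩ := hη (t, y₁)
      obtain ⟨h7, h8⟩ := hη (t, y₂)
      rw [abs_le]; constructor <;> linarith
    have h4 : ‖-2 * V‖ = 2 * |V| := by rw [norm_mul]; simp
    rw [h4]
    refine mul_le_mul_of_nonneg_left (h2.trans ?_) (by positivity)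
    gcongr
  have := (convex_Icc x₁ X).norm_image_sub_le_of_norm_hasDerivWithin_le
    (fun t _ => (hd t).hasDerivWithinAt) hbd ⟨le_rfl, hx.1.trans hx.2⟩ hx
  simp only [hg₁] at this
  have h5 := (le_abs_self _).trans this
  simp only [ne_eq, OfNat.ofNat_ne_zero, not_false_eq_true, zero_pow,
    intervalIntegral.integral_zero, sub_zero] at h5
  refine h5.trans (mul_le_mul_of_nonneg_left ?_ hC₀n)
  rw [Real.norm_eq_abs, abs_of_nonneg (by linarith [hx.1]), abs_of_nonneg (by linarith [hx.1, hx.2])]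
  linarith [hx.2]

/-- A positive lower bound for |g| on a column would contradict square integrability in y. -/
theorem exists_abs_lt (F : Front V M lo hi η b g) {x₁ X : ℝ} {Ψ : ℝ × ℝ → ℝ}
    (hΨ : ContinuousOn Ψ (Icc x₁ X ×ˢ Icc lo hi))
    (hg : ∀ x ∈ Icc x₁ X, ∀ y, g (x, y) = Ψ (x, η (x, y))) (hg₁ : ∀ y, g (x₁, y) = 0)
    {x : ℝ} (hx : x ∈ Icc x₁ X) {ε : ℝ} (hε : 0 < ε) : ∃ y, |g (x, y)| < ε := by
  obtain ⟨C, hC0, hC⟩ := F.integral_sq_le hΨ hg hg₁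
  by_contra! h
  have h1 := hC x hx 0 ((C + 1) / ε ^ 2)
  have h2 : ∫ y in (0 : ℝ)..((C + 1) / ε ^ 2), ε ^ 2 ≤ ∫ y in (0 : ℝ)..((C + 1) / ε ^ 2), g (x, y) ^ 2 := by
    refine intervalIntegral.integral_mono_on (by positivity) (by simp) ?_ fun y _ => ?_
    · exact Continuous.intervalIntegrable (by have := F.g_C1.continuous; fun_prop) _ _
    · rw [← sq_abs (g _)]; have := h y; gcongr
  rw [intervalIntegral.integral_const, smul_eq_mul, sub_zero, div_mul_cancel₀ _ (by positivity)] at h2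
  linarith

/-- The primitive of `η` in `x`, differentiated along a path. -/
theorem hasDerivAt_area (F : Front V M lo hi η b g) {x₁ : ℝ} (hg₁ : ∀ y, g (x₁, y) = 0)
    {ξ : ℝ → ℝ} (hξ : IsPath V b ξ) (y : ℝ) :
    HasDerivAt (fun t => ∫ x in x₁..ξ t, η (x, t))
      ((b (ξ y, y) * η (ξ y, y) - g (ξ y, y)) / V) y := by
  have hηc := F.η_C1.continuous
  have hV := F.V_ne
  set E : ℝ → ℝ → ℝ := fun x t => ∫ s in x₁..x, η (s, t)
  have h1 (x t : ℝ) : HasDerivAt (fun x => E x t) (η (x, t)) x := by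
    refine intervalIntegral.integral_hasDerivAt_right ?_ ?_ ?_
    · exact Continuous.intervalIntegrable (by fun_prop) _ _
    · exact Continuous.stronglyMeasurableAtFilter (by fun_prop) _ _
    · exact Continuous.continuousAt (by fun_prop)
  have h2 (x t : ℝ) : HasDerivAt (fun t => E x t) (-(g (x, t) / V)) t := by
    have := hasDerivAt_integral_param (F := fun t s => η (s, t))
      (F' := fun t s => fderiv ℝ η (s, t) (0, 1)) (by fun_prop)
      ((continuous_fderiv_apply F.η_C1 (0, 1)).comp
        (by fun_prop : Continuous fun p : ℝ × ℝ => (p.2, p.1)))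
      (fun t s => hasDerivAt_snd F.η_C1 s t) x₁ x t
    convert this using 1
    -- As g_x = -Vη_y and `g` vanishes over `x₁`, the integral of η_y in x is -g/V.
    have h3 : ∫ s in x₁..x, fderiv ℝ g (s, t) (1, 0) = g (x, t) - g (x₁, t) :=
      intervalIntegral.integral_eq_sub_of_hasDerivAt (fun s _ => hasDerivAt_fst F.g_C1 s t)
        (Continuous.intervalIntegrable ((continuous_fderiv_apply F.g_C1 (1, 0)).comp
          (by fun_prop : Continuous fun s : ℝ => (s, t))) _ _)
    simp only [F.g_x, hg₁, sub_zero, intervalIntegral.integral_const_mul] at h3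
    rw [← h3]
    field_simp
  have hs := (hasStrictFDerivAt_uncurry_coprod (𝕜 := ℝ) (u := (ξ y, y)) (f := E)
    (f₁ := fun x t => ContinuousLinearMap.toSpanSingleton ℝ (η (x, t)))
    (f₂ := fun x t => ContinuousLinearMap.toSpanSingleton ℝ (-(g (x, t) / V)))
    (Eventually.of_forall fun v => (h1 v.1 v.2).hasFDerivAt)
    (Eventually.of_forall fun v => (h2 v.1 v.2).hasFDerivAt)
    (by
      refine Continuous.continuousAt ?_
      exact (ContinuousLinearMap.toSpanSingletonCLE (𝕜 := ℝ) (E := ℝ)).continuous.comp hηc)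
    (by
      have hgc := F.g_C1.continuous
      refine Continuous.continuousAt ?_
      exact (ContinuousLinearMap.toSpanSingletonCLE (𝕜 := ℝ) (E := ℝ)).continuous.comp
        (by fun_prop : Continuous fun p : ℝ × ℝ => -(g p / V)))).hasFDerivAt
  have := HasFDerivAt.comp_hasDerivAt (f := fun t => (ξ t, t)) y hs
    ((hξ y).prodMk (hasDerivAt_id' y))
  refine HasDerivAt.congr_deriv this ?_
  change b (ξ y, y) / V * η (ξ y, y) + 1 * (-(g (ξ y, y) / V)) = _
  ring

end Front

/-! ### Escape of particle paths from bounded regions. -/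

/-- A continuous function going from `0` to `c ≠ 0` passes through `c / 2` and stays beyond that
value afterwards. -/
theorem exists_last_half {φ : ℝ → ℝ} (hφ : Continuous φ) {x₁ s : ℝ} (hs : x₁ < s)
    (h₁ : φ x₁ = 0) (hc : φ s ≠ 0) :
    ∃ r, x₁ < r ∧ r < s ∧ φ r = φ s / 2 ∧ ∀ x ∈ Icc r s, (φ s / 2) ^ 2 ≤ φ x ^ 2 := by
  set f : ℝ → ℝ := fun x => φ x / φ s with hf
  have hfc : Continuous f := hφ.div_const _
  -- The point sought is the last one at which φ is at most half of its final value, in units of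
  -- φ(s).
  have hcomp : IsCompact (Icc x₁ s ∩ f ⁻¹' Iic (1 / 2)) :=
    isCompact_Icc.inter_right (isClosed_Iic.preimage hfc)
  obtain ⟨r, ⟨hr, hr'⟩, hmax⟩ := hcomp.exists_isGreatest ⟨x₁, ⟨le_rfl, hs.le⟩, by simp [hf, h₁]⟩
  have hfs : f s = 1 := by simp [hf, hc]
  have hr' : f r ≤ 1 / 2 := hr'
  have hrs : r < s := by
    rcases hr.2.lt_or_eq with h | h
    · exact h
    · rw [h, hfs] at hr'; norm_num at hr'
  have hfr : f r = 1 / 2 := by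
    by_contra hne
    have hlt : f r < 1 / 2 := lt_of_le_of_ne hr' hne
    obtain ⟨t, ht, ht'⟩ := intermediate_value_Icc hrs.le hfc.continuousOn
      (show (1 / 2 : ℝ) ∈ _ from ⟨hlt.le, by rw [hfs]; norm_num⟩)
    have h1 : t ≤ r := hmax ⟨⟨hr.1.trans ht.1, ht.2⟩, ht'.le⟩
    have h2 : t = r := le_antisymm h1 ht.1
    rw [h2] at ht'
    exact hne ht'
  refine ⟨r, ?_, hrs, ?_, fun x hx => ?_⟩
  · rcases hr.1.lt_or_eq with h | h
    · exact h
    · rw [← h] at hfr; simp [hf, h₁] at hfr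
  · rw [hf] at hfr; field_simp at hfr; linarith
  · have h1 : 1 / 2 ≤ f x := by
      rcases hx.1.lt_or_eq with h | h
      · by_contra hlt
        push Not at hlt
        have : x ≤ r := hmax ⟨⟨hr.1.trans hx.1, hx.2⟩, hlt.le⟩
        linarith
      · rw [← h, hfr]
    have h2 : φ x = f x * φ s := by simp only [hf]; field_simp
    rw [h2]
    have h3 : (1 / 2 : ℝ) ^ 2 ≤ f x ^ 2 := by gcongr
    nlinarith [sq_nonneg (φ s)]

namespace Front

variable {V M lo hi : ℝ} {η b g : ℝ × ℝ → ℝ}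

/-- Along a path that stays in a bounded region, the velocity is a uniformly continuous function of
the parameter. -/
theorem uniformContinuousOn_velocity (F : Front V M lo hi η b g) {x₁ X : ℝ} {U : ℝ × ℝ → ℝ}
    (hU : ContinuousOn U (Icc x₁ X ×ˢ Icc lo hi))
    (hb : ∀ x ∈ Icc x₁ X, ∀ y, b (x, y) = U (x, η (x, y)))
    {ξ : ℝ → ℝ} (hξ : IsPath V b ξ) (hmem : ∀ y, 0 ≤ y → ξ y ∈ Icc x₁ X) :
    UniformContinuousOn (fun y => b (ξ y, y)) (Ici 0) := by
  have huc := (isCompact_Icc.prod isCompact_Icc).uniformContinuousOn_of_continuous hU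
  have h2 : UniformContinuousOn (fun y => (ξ y, η (ξ y, y))) (Ici 0) :=
    ((F.lipschitz_path hξ).uniformContinuous.prodMk
      (F.lipschitz_height hξ).uniformContinuous).uniformContinuousOn
  have h3 := huc.comp h2 (fun y hy => ⟨hmem y hy, F.η_mem _⟩)
  exact h3.congr fun y hy => (hb _ (hmem y hy) y).symm

theorem uniformContinuousOn_sub {f k : ℝ → ℝ} {s : Set ℝ} (hf : UniformContinuousOn f s)
    (hk : UniformContinuousOn k s) : UniformContinuousOn (fun y => f y - k y) s := by
  rw [uniformContinuousOn_iff_restrict] at *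
  exact hf.sub hk

theorem uniformContinuousOn_bounded_mul {f k : ℝ → ℝ} {s : Set ℝ} {A B : ℝ}
    (hf : UniformContinuousOn f s) (hk : UniformContinuousOn k s) (hA : ∀ y ∈ s, |f y| ≤ A)
    (hB : ∀ y ∈ s, |k y| ≤ B) : UniformContinuousOn (fun y => f y * k y) s := by
  rw [Metric.uniformContinuousOn_iff] at *
  intro ε hε
  obtain ⟨δ₁, h₁, H₁⟩ := hf (ε / (2 * (|B| + 1))) (by positivity)
  obtain ⟨δ₂, h₂, H₂⟩ := hk (ε / (2 * (|A| + 1))) (by positivity)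
  refine ⟨min δ₁ δ₂, lt_min h₁ h₂, fun x hx y hy hxy => ?_⟩
  have a1 := H₁ x hx y hy (hxy.trans_le (min_le_left _ _))
  have a2 := H₂ x hx y hy (hxy.trans_le (min_le_right _ _))
  rw [Real.dist_eq] at *
  have e : f x * k x - f y * k y = (f x - f y) * k x + f y * (k x - k y) := by ring
  rw [e]
  refine (abs_add_le _ _).trans_lt ?_
  rw [abs_mul, abs_mul]
  have b1 : |f x - f y| * |k x| ≤ ε / (2 * (|B| + 1)) * |B| := by
    have := (hB x hx).trans (le_abs_self B)
    gcongr
  have b2 : |f y| * |k x - k y| ≤ |A| * (ε / (2 * (|A| + 1))) := by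
    have := (hA y hy).trans (le_abs_self A)
    gcongr
  have b3 : ε / (2 * (|B| + 1)) * |B| < ε / 2 := by
    rw [div_mul_eq_mul_div, div_lt_div_iff₀ (by positivity) (by positivity)]
    nlinarith [abs_nonneg B]
  have b4 : |A| * (ε / (2 * (|A| + 1))) < ε / 2 := by
    rw [mul_div_assoc', div_lt_div_iff₀ (by positivity) (by positivity)]
    nlinarith [abs_nonneg A]
  linarith

/-- Two paths at different levels of the stream function that stay in a bounded region over which
the front is square integrable approach each other. -/
theorem tendsto_sub_path_zero (F : Front V M lo hi η b g) {x₁ X : ℝ} {Ψ : ℝ × ℝ → ℝ}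
    (hΨ : ContinuousOn Ψ (Icc x₁ X ×ˢ Icc lo hi))
    (hg : ∀ x ∈ Icc x₁ X, ∀ y, g (x, y) = Ψ (x, η (x, y))) (hg₁ : ∀ y, g (x₁, y) = 0)
    {ξ ζ : ℝ → ℝ} (hξ : IsPath V b ξ) (hζ : IsPath V b ζ) (hlt : ∀ y, ζ y < ξ y)
    (hξm : ∀ y, 0 ≤ y → ξ y ∈ Icc x₁ X) (hζm : ∀ y, 0 ≤ y → ζ y ∈ Icc x₁ X)
    {k : ℝ} (hk : 0 < k) (hband : ∀ x ∈ Icc (ζ 0) (ξ 0), k ≤ g (x, 0) ^ 2) :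
    Tendsto (fun y => ξ y - ζ y) atTop (𝓝 0) := by
  have hgc := F.g_C1.continuous
  have hcD : Continuous fun y => ξ y - ζ y := (continuous_path hξ).sub (continuous_path hζ)
  have hx₁X : x₁ ≤ X := (hξm 0 le_rfl).1.trans (hξm 0 le_rfl).2
  obtain ⟨C, hC0, hC⟩ := F.integral_sq_le hΨ hg hg₁
  -- A point between the two paths lies on a third path, which starts between them at y = 0 and
  -- keeps its level; so the initial bound on g² persists.
  have hband' (y x : ℝ) (hx : x ∈ Icc (ζ y) (ξ y)) : k ≤ g (x, y) ^ 2 := by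
    obtain ⟨κ, hκ, hκp⟩ := F.exists_path x y
    have h1 : ζ 0 ≤ κ 0 := F.path_le hζ hκp (y₀ := y) (by rw [hκ]; exact hx.1) 0
    have h2 : κ 0 ≤ ξ 0 := F.path_le hκp hξ (y₀ := y) (by rw [hκ]; exact hx.2) 0
    have h3 := F.g_path hκp y 0
    rw [hκ] at h3
    rw [h3]
    exact hband _ ⟨h1, h2⟩
  have hq (y : ℝ) (hy : 0 ≤ y) : k * (ξ y - ζ y) ≤ ∫ x in x₁..X, g (x, y) ^ 2 := by
    have hci : ∀ p q : ℝ, IntervalIntegrable (fun x => g (x, y) ^ 2) volume p q := fun p q =>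
      Continuous.intervalIntegrable (by fun_prop) _ _
    calc k * (ξ y - ζ y) = ∫ x in ζ y..ξ y, k := by
            rw [intervalIntegral.integral_const, smul_eq_mul, mul_comm]
      _ ≤ ∫ x in ζ y..ξ y, g (x, y) ^ 2 :=
            intervalIntegral.integral_mono_on (hlt y).le (by simp) (hci _ _) (hband' y)
      _ ≤ ∫ x in x₁..X, g (x, y) ^ 2 :=
            intervalIntegral.integral_mono_interval (hζm y hy).1 (hlt y).le (hξm y hy).2
              (Eventually.of_forall fun x => sq_nonneg _) (hci _ _)
  -- By Fubini the time integral of the gap is controlled by ∫∫ g², which is bounded uniformly in T.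
  -- The gap is Lipschitz in y, so Barbalat's lemma sends it to zero.
  have hint (T : ℝ) (hT : 0 ≤ T) : ∫ y in (0 : ℝ)..T, (ξ y - ζ y) ≤ C * (X - x₁) / k := by
    rw [le_div_iff₀ hk, ← intervalIntegral.integral_mul_const]
    have e1 : ∫ y in (0 : ℝ)..T, (ξ y - ζ y) * k ≤ ∫ y in (0 : ℝ)..T, ∫ x in x₁..X, g (x, y) ^ 2 := by
      refine intervalIntegral.integral_mono_on hT (Continuous.intervalIntegrable (by fun_prop) _ _)
        ?_ fun y hy => by rw [mul_comm]; exact hq y hy.1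
      refine Continuous.intervalIntegrable ?_ _ _
      exact intervalIntegral.continuous_parametric_intervalIntegral_of_continuous'
        (f := fun y x => g (x, y) ^ 2) (by fun_prop) _ _
    have e2 : ∫ y in (0 : ℝ)..T, ∫ x in x₁..X, g (x, y) ^ 2
        = ∫ x in x₁..X, ∫ y in (0 : ℝ)..T, g (x, y) ^ 2 := by
      refine intervalIntegral_intervalIntegral_swap (F := fun y x => g (x, y) ^ 2) ?_
      refine (ContinuousOn.integrableOn_compact (isCompact_uIcc.prod isCompact_uIcc) ?_).mono_set
        (prod_mono uIoc_subset_uIcc uIoc_subset_uIcc)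
      exact Continuous.continuousOn (by fun_prop)
    have e3 : ∫ x in x₁..X, ∫ y in (0 : ℝ)..T, g (x, y) ^ 2 ≤ ∫ x in x₁..X, C := by
      refine intervalIntegral.integral_mono_on hx₁X ?_ (by simp) fun x hx => hC x hx 0 T
      refine Continuous.intervalIntegrable ?_ _ _
      exact intervalIntegral.continuous_parametric_intervalIntegral_of_continuous'
        (f := fun x y => g (x, y) ^ 2) (by fun_prop) _ _
    rw [intervalIntegral.integral_const, smul_eq_mul, mul_comm] at e3
    linarith
  have hA (T : ℝ) : HasDerivAt (fun T => ∫ y in (0 : ℝ)..T, (ξ y - ζ y)) (ξ T - ζ T) T :=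
    intervalIntegral.integral_hasDerivAt_right (hcD.intervalIntegrable _ _)
      (hcD.stronglyMeasurableAtFilter _ _) hcD.continuousAt
  have hmono : Monotone fun T => ∫ y in (0 : ℝ)..T, (ξ y - ζ y) :=
    monotone_of_deriv_nonneg (fun T => (hA T).differentiableAt)
      fun T => by rw [(hA T).deriv]; linarith [hlt T]
  have hbdd : BddAbove (range fun T => ∫ y in (0 : ℝ)..T, (ξ y - ζ y)) := by
    refine ⟨C * (X - x₁) / k, ?_⟩
    rintro _ ⟨T, rfl⟩
    exact (hmono (le_max_left T 0)).trans (hint _ (le_max_right _ _))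
  refine tendsto_zero_of_uniformContinuousOn_deriv (a := 0) hA (tendsto_atTop_ciSup hmono hbdd) ?_
  exact ((F.lipschitz_path hξ).uniformContinuous.sub
    (F.lipschitz_path hζ).uniformContinuous).uniformContinuousOn

/-- A path on which the stream function does not vanish leaves every bounded region. -/
theorem not_forall_mem_Icc (F : Front V M lo hi η b g) {x₁ X : ℝ} {U Ψ : ℝ × ℝ → ℝ}
    (hU : ContinuousOn U (Icc x₁ X ×ˢ Icc lo hi)) (hΨ : ContinuousOn Ψ (Icc x₁ X ×ˢ Icc lo hi))
    (hb : ∀ x ∈ Icc x₁ X, ∀ y, b (x, y) = U (x, η (x, y)))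
    (hg : ∀ x ∈ Icc x₁ X, ∀ y, g (x, y) = Ψ (x, η (x, y))) (hg₁ : ∀ y, g (x₁, y) = 0)
    {ξ : ℝ → ℝ} (hξ : IsPath V b ξ) (hc : g (ξ 0, 0) ≠ 0) :
    ¬ ∀ y, 0 ≤ y → ξ y ∈ Icc x₁ X := by
  intro hmem
  have hV := F.V_ne
  set c := g (ξ 0, 0) with hcdef
  have hs : x₁ < ξ 0 := by
    rcases (hmem 0 le_rfl).1.lt_or_eq with h | h
    · exact h
    · exact absurd (by rw [hcdef, ← h, hg₁]) hc
  -- A companion path on the level c/2, starting at `r`, is compared with ξ; between them |g| ≥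
  -- |c|/2.
  obtain ⟨r, hr1, hr2, hgr, hband⟩ := exists_last_half (φ := fun x => g (x, 0))
    (F.g_C1.continuous.comp (by fun_prop)) hs (hg₁ 0) hc
  simp only [← hcdef] at hgr hband
  obtain ⟨ζ, hζ0, hζ⟩ := F.exists_path r 0
  have hlt (y : ℝ) : ζ y < ξ y := F.path_lt hζ hξ (y₀ := 0) (by rw [hζ0]; exact hr2) y
  have hζ1 (y : ℝ) : x₁ < ζ y := by
    refine F.path_gt hζ (y₀ := 0) (fun y => ?_) (by rw [hζ0]; exact hr1) y
    rw [hg₁, hζ0, hgr]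
    exact (div_ne_zero hc two_ne_zero).symm
  have hζm (y : ℝ) (hy : 0 ≤ y) : ζ y ∈ Icc x₁ X :=
    ⟨(hζ1 y).le, (hlt y).le.trans (hmem y hy).2⟩
  have hD := F.tendsto_sub_path_zero hΨ hg hg₁ hξ hζ hlt hmem hζm (k := (c / 2) ^ 2)
    (by positivity) (by rw [hζ0]; exact hband)
  have hucξ := F.uniformContinuousOn_velocity hU hb hξ hmem
  have hucζ := F.uniformContinuousOn_velocity hU hb hζ hζm
  -- Barbalat's lemma applies to the gap itself: its derivative is uniformly continuous, so the two
  -- velocities approach each other.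
  have hD' : Tendsto (fun y => b (ξ y, y) - b (ζ y, y)) atTop (𝓝 0) := by
    have h := tendsto_zero_of_uniformContinuousOn_deriv (a := 0)
      (F := fun y => V * (ξ y - ζ y)) (F' := fun y => b (ξ y, y) - b (ζ y, y)) (l := V * 0)
      (fun y => ?_) (hD.const_mul V) (uniformContinuousOn_sub hucξ hucζ)
    · exact h
    · refine (((hξ y).fun_sub (hζ y)).const_mul V).congr_deriv ?_
      field_simp
  have hηb (q : ℝ × ℝ) : |η q| ≤ |lo| + |hi| := by
    obtain ⟨h1, h2⟩ := F.η_mem q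
    rw [abs_le]
    constructor <;> linarith [neg_abs_le lo, le_abs_self hi, abs_nonneg lo, abs_nonneg hi]
  have hgξ (y : ℝ) : g (ξ y, y) = c := F.g_path hξ y 0
  have hgζ (y : ℝ) : g (ζ y, y) = c / 2 := by rw [F.g_path hζ y 0, hζ0, hgr]
  -- This is V times the signed area under the front between the two paths. It vanishes in the limit
  -- with the gap, yet its derivative contains the constant -c/2 coming from the difference of
  -- levels.
  set N : ℝ → ℝ := fun y => V * ((∫ x in x₁..ξ y, η (x, y)) - ∫ x in x₁..ζ y, η (x, y)) with hN
  have hNd (y : ℝ) : HasDerivAt N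
      (b (ξ y, y) * η (ξ y, y) - b (ζ y, y) * η (ζ y, y) - c / 2) y := by
    refine (((F.hasDerivAt_area hg₁ hξ y).fun_sub
      (F.hasDerivAt_area hg₁ hζ y)).const_mul V).congr_deriv ?_
    rw [hgξ, hgζ]
    field_simp
    ring
  have hηc := F.η_C1.continuous
  have hN0 : Tendsto N atTop (𝓝 0) := by
    refine squeeze_zero_norm (a := fun y => |V| * ((|lo| + |hi|) * (ξ y - ζ y))) (fun y => ?_) ?_
    · rw [hN]
      simp only
      rw [intervalIntegral.integral_interval_sub_left
        (Continuous.intervalIntegrable (by fun_prop) _ _)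
        (Continuous.intervalIntegrable (by fun_prop) _ _), norm_mul, Real.norm_eq_abs V]
      refine mul_le_mul_of_nonneg_left ?_ (abs_nonneg _)
      refine (intervalIntegral.norm_integral_le_of_norm_le_const fun x _ => hηb (x, y)).trans ?_
      rw [abs_of_pos (sub_pos.2 (hlt y))]
    · have := (hD.const_mul (|lo| + |hi|)).const_mul |V|
      simpa using this
  have hN' := tendsto_zero_of_uniformContinuousOn_deriv (a := 0) hNd hN0 (by
    have h1 := uniformContinuousOn_bounded_mul hucξ
      (F.lipschitz_height hξ).uniformContinuous.uniformContinuousOn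
      (fun y _ => F.b_le _) (fun y _ => hηb _)
    have h2 := uniformContinuousOn_bounded_mul hucζ
      (F.lipschitz_height hζ).uniformContinuous.uniformContinuousOn
      (fun y _ => F.b_le _) (fun y _ => hηb _)
    exact uniformContinuousOn_sub (uniformContinuousOn_sub h1 h2)
      uniformContinuous_const.uniformContinuousOn)
  -- Replacing b(ζ) by b(ξ) in the limit of `hN'` leaves b(ξ)(η(ξ) - η(ζ)) → c/2 ≠ 0. As η is
  -- bounded, |b(ξ)| stays away from zero, which drives the path out of the region.
  have hprod : Tendsto (fun y => b (ξ y, y) * (η (ξ y, y) - η (ζ y, y))) atTop (𝓝 (c / 2)) := by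
    have h1 : Tendsto (fun y => (b (ξ y, y) - b (ζ y, y)) * η (ζ y, y)) atTop (𝓝 0) := by
      refine squeeze_zero_norm (a := fun y => |b (ξ y, y) - b (ζ y, y)| * (|lo| + |hi|))
        (fun y => ?_) ?_
      · rw [norm_mul, Real.norm_eq_abs, Real.norm_eq_abs]
        have := hηb (ζ y, y)
        gcongr
      · have := (hD'.abs).mul_const (|lo| + |hi|)
        simpa using this
    have h2 := (hN'.sub h1).add_const (c / 2)
    rw [sub_zero, zero_add] at h2
    refine h2.congr fun y => ?_
    ring
  have hev : ∀ᶠ y in atTop, |c| / 4 < |b (ξ y, y)| * (|lo| + |hi| + (|lo| + |hi|)) := by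
    have h1 := hprod.abs
    have h2 : |c| / 4 < |c / 2| := by
      rw [abs_div, abs_two]
      have := abs_pos.2 hc
      linarith
    filter_upwards [h1.eventually (lt_mem_nhds h2)] with y hy
    rw [abs_mul] at hy
    refine hy.trans_le ?_
    refine mul_le_mul_of_nonneg_left ?_ (abs_nonneg _)
    exact (abs_sub _ _).trans (add_le_add (hηb _) (hηb _))
  obtain ⟨Y, hY⟩ := eventually_atTop.1 hev
  set L := |lo| + |hi| + (|lo| + |hi|) with hL
  have hLn : 0 ≤ L := by positivity
  have hcpos := abs_pos.2 hc
  have hLpos : 0 < L := by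
    rcases hLn.lt_or_eq with h | h
    · exact h
    · have := hY Y le_rfl
      rw [← h, mul_zero] at this
      linarith
  set Y' := max Y 0
  -- At speed at least |c|/(4L|V|), a time `T` covers the distance |X| + |x₁| + 1, more than the
  -- region allows.
  set T := (|X| + |x₁| + 1) * |V| * (4 * L) / |c| with hT
  have hVpos := abs_pos.2 hV
  have hTpos : 0 < T := by positivity
  obtain ⟨t, ht, ht'⟩ := exists_hasDerivAt_eq_slope ξ (fun y => b (ξ y, y) / V)
    (show Y' < Y' + T by linarith) (continuous_path hξ).continuousOn (fun t _ => hξ t)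
  have h1 := hY t ((le_max_left Y 0).trans ht.1.le)
  have h2 := hmem Y' (le_max_right _ _)
  have h3 := hmem (Y' + T) (by have : 0 ≤ Y' := le_max_right _ _; linarith)
  have h4 : |ξ (Y' + T) - ξ Y'| ≤ |X| + |x₁| := by
    rw [abs_le]
    constructor <;> linarith [h2.1, h2.2, h3.1, h3.2, neg_abs_le x₁, le_abs_self X,
      le_abs_self x₁, neg_abs_le X]
  rw [add_sub_cancel_left, div_eq_div_iff hV hTpos.ne'] at ht'
  have h5 : |b (ξ t, t)| * T = |ξ (Y' + T) - ξ Y'| * |V| := by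
    rw [← abs_of_pos hTpos, ← abs_mul, ← abs_mul, abs_of_pos hTpos, ht']
  have h6 : |b (ξ t, t)| * T ≤ (|X| + |x₁|) * |V| := by rw [h5]; gcongr
  have h7 : (|X| + |x₁| + 1) * |V| ≤ |b (ξ t, t)| * T := by
    rw [hT, mul_div_assoc', le_div_iff₀ hcpos]
    have : (|X| + |x₁| + 1) * |V| * |c| ≤ (|X| + |x₁| + 1) * |V| * (4 * (|b (ξ t, t)| * L)) := by
      gcongr
      linarith
    linarith
  linarith

end Front

/-! ### Symmetries of a front and the final direction of motion. -/

theorem fderiv_comp_linear {φ : ℝ × ℝ → ℝ} (hφ : ContDiff ℝ 1 φ) (R : ℝ × ℝ →L[ℝ] ℝ × ℝ)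
    (q v : ℝ × ℝ) : fderiv ℝ (fun p => φ (R p)) q v = fderiv ℝ φ (R q) (R v) := by
  have h := HasFDerivAt.comp q (g := φ) (f := R)
    ((hφ.differentiable one_ne_zero) (R q)).hasFDerivAt R.hasFDerivAt
  have h2 : (fun p => φ (R p)) = φ ∘ R := rfl
  rw [h2, h.fderiv]
  rfl

/-- The reflection `(x, y) ↦ (x, -y)`. -/
noncomputable def flipY : ℝ × ℝ →L[ℝ] ℝ × ℝ :=
  (ContinuousLinearMap.fst ℝ ℝ ℝ).prod (-ContinuousLinearMap.snd ℝ ℝ ℝ)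

@[simp] theorem flipY_apply (x y : ℝ) : flipY (x, y) = (x, -y) := rfl

theorem neg_basis_snd : ((0, -1) : ℝ × ℝ) = -(0, 1) := by ext <;> simp

namespace Front

variable {V M lo hi : ℝ} {η b g : ℝ × ℝ → ℝ}

/-- Reversing time transfers statements about large y to y → -∞. -/
theorem reverse (F : Front V M lo hi η b g) :
    Front (-V) M lo hi (fun q => η (flipY q)) (fun q => b (flipY q)) (fun q => g (flipY q)) where
  V_ne := neg_ne_zero.2 F.V_ne
  η_C1 := F.η_C1.comp flipY.contDiff
  b_C1 := F.b_C1.comp flipY.contDiff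
  g_C1 := F.g_C1.comp flipY.contDiff
  η_mem q := F.η_mem _
  b_le q := F.b_le _
  climb_le q := by
    rw [fderiv_comp_linear F.η_C1, fderiv_comp_linear F.η_C1]
    simp only [flipY_apply, neg_zero, neg_basis_snd, map_neg, neg_mul_neg]
    exact F.climb_le _
  g_x q := by
    rw [fderiv_comp_linear F.η_C1, fderiv_comp_linear F.g_C1]
    simp only [flipY_apply, neg_zero, neg_basis_snd, map_neg, F.g_x]
    ring
  g_y q := by
    rw [fderiv_comp_linear F.η_C1, fderiv_comp_linear F.g_C1]
    simp only [flipY_apply, neg_basis_snd, map_neg, F.g_y]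
    ring

/-- This change of sign reduces a negative far shear to a positive one. -/
theorem negate (F : Front V M lo hi η b g) :
    Front (-V) M lo hi η (fun q => -b q) (fun q => -g q) where
  V_ne := neg_ne_zero.2 F.V_ne
  η_C1 := F.η_C1
  b_C1 := F.b_C1.neg
  g_C1 := F.g_C1.neg
  η_mem := F.η_mem
  b_le q := by rw [abs_neg]; exact F.b_le q
  climb_le q := by
    rw [← abs_neg]
    convert F.climb_le q using 2
    ring
  g_x q := by
    rw [fderiv_fun_neg]
    simp [F.g_x]
  g_y q := by
    rw [fderiv_fun_neg]
    simp [F.g_y]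

theorem reverse_path {ξ : ℝ → ℝ} (hξ : IsPath V b ξ) :
    IsPath (-V) (fun q => b (flipY q)) (fun y => ξ (-y)) := by
  intro y
  have := HasDerivAt.scomp y (hξ (-y)) (hasDerivAt_neg y)
  refine HasDerivAt.congr_deriv this ?_
  simp only [flipY_apply, smul_eq_mul]
  rw [div_neg]; ring

/-- A path that is unbounded for positive `y` and does not stop beyond `X'` eventually moves to the
right. -/
theorem exists_forall_pos (F : Front V M lo hi η b g) {ξ : ℝ → ℝ} (hξ : IsPath V b ξ) {X' : ℝ}
    (hne : ∀ y, X' ≤ ξ y → b (ξ y, y) ≠ 0) (hunb : ∀ A, ∃ y, 0 ≤ y ∧ A < ξ y) :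
    ∃ y₂, 0 ≤ y₂ ∧ ∀ y, y₂ ≤ y → 0 < b (ξ y, y) / V ∧ X' ≤ ξ y := by
  have hV := F.V_ne
  have hcξ := continuous_path hξ
  have hcv : Continuous fun y => b (ξ y, y) / V := by
    have := F.b_C1.continuous
    fun_prop
  obtain ⟨y₁, hy₁, hA⟩ := hunb (max X' (ξ 0))
  have hcomp : IsCompact (Icc 0 y₁ ∩ ξ ⁻¹' Iic (max X' (ξ 0))) :=
    isCompact_Icc.inter_right (isClosed_Iic.preimage hcξ)
  obtain ⟨t₀, ⟨ht₀, ht₀'⟩, hmax⟩ := hcomp.exists_isGreatest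
    ⟨0, ⟨le_rfl, hy₁⟩, le_max_right X' (ξ 0)⟩
  have ht₀' : ξ t₀ ≤ max X' (ξ 0) := ht₀'
  have hlt : t₀ < y₁ := by
    rcases ht₀.2.lt_or_eq with h | h
    · exact h
    · rw [h] at ht₀'; linarith
  -- After the last time `t₀` at or below the threshold the path rises to ξ(y₁), so at some later
  -- time it moves right and is already beyond `X'`.
  obtain ⟨c, hc, hc'⟩ := exists_hasDerivAt_eq_slope ξ (fun y => b (ξ y, y) / V) hlt
    hcξ.continuousOn (fun t _ => hξ t)
  have hcpos : 0 < b (ξ c, c) / V := by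
    rw [hc']; exact div_pos (by linarith) (by linarith)
  have hcX : X' < ξ c := by
    by_contra hle
    push Not at hle
    have : c ≤ t₀ := hmax ⟨⟨ht₀.1.trans hc.1.le, hc.2.le⟩, hle.trans (le_max_left _ _)⟩
    linarith [hc.1]
  -- At a first time where the velocity ceases to be positive it would vanish by continuity. Until
  -- then the path has only moved right, so it would be at rest beyond `X'`, which is excluded.
  have hpos : ∀ y, c ≤ y → 0 < b (ξ y, y) / V := by
    intro Y hY
    by_contra hle
    push Not at hle
    have hcomp2 : IsCompact (Icc c Y ∩ (fun y => b (ξ y, y) / V) ⁻¹' Iic 0) :=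
      isCompact_Icc.inter_right (isClosed_Iic.preimage hcv)
    obtain ⟨y₃, ⟨hy₃, hy₃'⟩, hmin⟩ := hcomp2.exists_isLeast ⟨Y, ⟨hY, le_rfl⟩, hle⟩
    have hy₃' : b (ξ y₃, y₃) / V ≤ 0 := hy₃'
    have hpos' : ∀ y ∈ Ico c y₃, 0 < b (ξ y, y) / V := fun y hy => by
      by_contra h
      push Not at h
      have : y₃ ≤ y := hmin ⟨⟨hy.1, hy.2.le.trans hy₃.2⟩, h⟩
      linarith [hy.2]
    have hcy₃ : c < y₃ := by
      rcases hy₃.1.lt_or_eq with h | h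
      · exact h
      · rw [← h] at hy₃'; linarith
    have hmono : MonotoneOn ξ (Icc c y₃) := by
      refine monotoneOn_of_deriv_nonneg (convex_Icc _ _) hcξ.continuousOn
        (fun t _ => (hξ t).differentiableAt.differentiableWithinAt) fun t ht => ?_
      rw [interior_Icc] at ht
      rw [(hξ t).deriv]
      exact (hpos' t ⟨ht.1.le, ht.2⟩).le
    have hX₃ : X' ≤ ξ y₃ := hcX.le.trans (hmono ⟨le_rfl, hcy₃.le⟩ ⟨hcy₃.le, le_rfl⟩ hcy₃.le)
    have hge : 0 ≤ b (ξ y₃, y₃) / V := by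
      have hcl : y₃ ∈ closure (Ico c y₃) := by
        rw [closure_Ico hcy₃.ne]; exact ⟨hcy₃.le, le_rfl⟩
      exact closure_minimal (fun y hy => (hpos' y hy).le) (isClosed_Ici.preimage hcv) hcl
    have h0 : b (ξ y₃, y₃) / V = 0 := le_antisymm hy₃' hge
    rcases div_eq_zero_iff.1 h0 with h | h
    · exact hne y₃ hX₃ h
    · exact hV h
  refine ⟨c, ht₀.1.trans hc.1.le, fun y hy => ⟨hpos y hy, ?_⟩⟩
  have hmono : MonotoneOn ξ (Icc c y) := by
    refine monotoneOn_of_deriv_nonneg (convex_Icc _ _) hcξ.continuousOn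
      (fun t _ => (hξ t).differentiableAt.differentiableWithinAt) fun t ht => ?_
    rw [interior_Icc] at ht
    rw [(hξ t).deriv]
    exact (hpos t ht.1.le).le
  exact hcX.le.trans (hmono ⟨le_rfl, hy⟩ ⟨hy, le_rfl⟩ hy)

end Front

/-! ### Fronts over a half-line in a flow sheared far away. -/

/-- A front over a half-line whose underlying planar flow `(U, -∂ₓΨ)`, with stream function `Ψ`, is
sheared in one direction far away. -/
structure ShearedFront (x₁ X κ V M lo hi : ℝ) (η b g U Ψ : ℝ × ℝ → ℝ) : Prop
    extends Front V M lo hi η b g where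
  U_cont : ContinuousOn U (Ici x₁ ×ˢ Icc lo hi)
  Ψ_cont : ContinuousOn Ψ (Ici x₁ ×ˢ Icc lo hi)
  b_eq : ∀ x, x₁ ≤ x → ∀ y, b (x, y) = U (x, η (x, y))
  g_eq : ∀ x, x₁ ≤ x → ∀ y, g (x, y) = Ψ (x, η (x, y))
  g_zero : ∀ y, g (x₁, y) = 0
  κ_pos : 0 < κ
  X_gt : x₁ < X
  Ψ_deriv : ∀ x, X ≤ x → ∀ z ∈ Icc lo hi, HasDerivAt (fun z => Ψ (x, z)) (U (x, z)) z
  shear : ∀ x, X ≤ x → ∀ z ∈ Icc lo hi, ∀ z' ∈ Icc lo hi, z ≤ z' →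
    κ * (z' - z) ≤ U (x, z') - U (x, z)

namespace ShearedFront

open Front

variable {x₁ X κ V M lo hi : ℝ} {η b g U Ψ : ℝ × ℝ → ℝ}

theorem reverse (S : ShearedFront x₁ X κ V M lo hi η b g U Ψ) :
    ShearedFront x₁ X κ (-V) M lo hi (fun q => η (flipY q)) (fun q => b (flipY q))
      (fun q => g (flipY q)) U Ψ where
  toFront := S.toFront.reverse
  U_cont := S.U_cont
  Ψ_cont := S.Ψ_cont
  b_eq x hx y := S.b_eq x hx (-y)
  g_eq x hx y := S.g_eq x hx (-y)
  g_zero y := S.g_zero (-y)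
  κ_pos := S.κ_pos
  X_gt := S.X_gt
  Ψ_deriv := S.Ψ_deriv
  shear := S.shear

/-- Beyond `X` the derivative U of Ψ in z is increasing; this is the tangent line inequality for the
convex function Ψ(x, ·). -/
theorem convex (S : ShearedFront x₁ X κ V M lo hi η b g U Ψ) {x : ℝ} (hx : X ≤ x) {z z' : ℝ}
    (hz : z ∈ Icc lo hi) (hz' : z' ∈ Icc lo hi) :
    Ψ (x, z) + U (x, z) * (z' - z) ≤ Ψ (x, z') := by
  have hκ := S.κ_pos
  rcases lt_trichotomy z z' with h | h | h
  · have hsub : Icc z z' ⊆ Icc lo hi := Icc_subset_Icc hz.1 hz'.2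
    obtain ⟨c, hc, hc'⟩ := exists_hasDerivAt_eq_slope (fun z => Ψ (x, z)) (fun z => U (x, z)) h
      (fun t ht => (S.Ψ_deriv x hx t (hsub ht)).continuousAt.continuousWithinAt)
      (fun t ht => S.Ψ_deriv x hx t (hsub (Ioo_subset_Icc_self ht)))
    have h1 := S.shear x hx z hz c (hsub (Ioo_subset_Icc_self hc)) hc.1.le
    rw [eq_div_iff (by linarith)] at hc'
    have h2 : 0 ≤ κ * (c - z) := mul_nonneg hκ.le (by linarith [hc.1])
    nlinarith
  · rw [h]; simp
  · have hsub : Icc z' z ⊆ Icc lo hi := Icc_subset_Icc hz'.1 hz.2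
    obtain ⟨c, hc, hc'⟩ := exists_hasDerivAt_eq_slope (fun z => Ψ (x, z)) (fun z => U (x, z)) h
      (fun t ht => (S.Ψ_deriv x hx t (hsub ht)).continuousAt.continuousWithinAt)
      (fun t ht => S.Ψ_deriv x hx t (hsub (Ioo_subset_Icc_self ht)))
    have h1 := S.shear x hx c (hsub (Ioo_subset_Icc_self hc)) z hz hc.2.le
    rw [eq_div_iff (by linarith)] at hc'
    have h2 : 0 ≤ κ * (z - c) := mul_nonneg hκ.le (by linarith [hc.2])
    nlinarith

theorem unbounded (S : ShearedFront x₁ X κ V M lo hi η b g U Ψ) {ξ : ℝ → ℝ} (hξ : IsPath V b ξ)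
    (h₁ : x₁ < ξ 0) (hc : g (ξ 0, 0) ≠ 0) (A : ℝ) : ∃ y, 0 ≤ y ∧ A < ξ y := by
  by_contra! h
  have hsub : Icc x₁ A ×ˢ Icc lo hi ⊆ Ici x₁ ×ˢ Icc lo hi :=
    prod_mono Icc_subset_Ici_self subset_rfl
  refine S.not_forall_mem_Icc (x₁ := x₁) (X := A) (S.U_cont.mono hsub) (S.Ψ_cont.mono hsub)
    (fun x hx => S.b_eq x hx.1) (fun x hx => S.g_eq x hx.1) S.g_zero hξ hc fun y hy =>
    ⟨(S.path_gt hξ (y₀ := 0) (fun y => ?_) h₁ y).le, h y hy⟩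
  rw [S.g_zero]
  exact hc.symm

theorem unbounded_neg (S : ShearedFront x₁ X κ V M lo hi η b g U Ψ) {ξ : ℝ → ℝ}
    (hξ : IsPath V b ξ) (h₁ : x₁ < ξ 0) (hc : g (ξ 0, 0) ≠ 0) (A : ℝ) :
    ∃ y, y ≤ 0 ∧ A < ξ y := by
  obtain ⟨y, hy, h⟩ := S.reverse.unbounded (Front.reverse_path hξ) (by simpa using h₁)
    (by simpa using hc) A
  exact ⟨-y, by linarith, h⟩

/-- At a rest point U = Ψ_z = 0, so by convexity Ψ is minimal there among all heights of the column.
-/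
theorem le_of_rest (S : ShearedFront x₁ X κ V M lo hi η b g U Ψ) {x y : ℝ} (hx : X ≤ x)
    (h : b (x, y) = 0) (y' : ℝ) : g (x, y) ≤ g (x, y') := by
  have hx₁ : x₁ ≤ x := S.X_gt.le.trans hx
  have := S.convex hx (S.η_mem (x, y)) (S.η_mem (x, y'))
  rw [← S.b_eq x hx₁, ← S.g_eq x hx₁, ← S.g_eq x hx₁, h] at this
  linarith

/-- The minimum over a column is at most 0, because |g| takes arbitrarily small values on it. -/
theorem nonpos_of_rest (S : ShearedFront x₁ X κ V M lo hi η b g U Ψ) {x y : ℝ} (hx : X ≤ x)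
    (h : b (x, y) = 0) : g (x, y) ≤ 0 := by
  have hx₁ : x₁ ≤ x := S.X_gt.le.trans hx
  have hsub : Icc x₁ x ×ˢ Icc lo hi ⊆ Ici x₁ ×ˢ Icc lo hi :=
    prod_mono Icc_subset_Ici_self subset_rfl
  refine le_of_forall_pos_lt_add fun ε hε => ?_
  obtain ⟨y', hy'⟩ := S.exists_abs_lt (S.Ψ_cont.mono hsub) (fun x hx => S.g_eq x hx.1) S.g_zero
    (x := x) ⟨hx₁, le_rfl⟩ hε
  have := S.le_of_rest hx h y'
  linarith [(abs_lt.1 hy').2]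

/-- Compare the two particles when each passes the same far abscissa. Convexity gives Δ ≤ b(η - η')
for the one on the higher level, so it passes at least Δ/M higher, and the shear makes it faster by
at least δ = κΔ/M. Starting behind, it must overtake the other, whereas paths never cross. -/
theorem overtake_of_pos (S : ShearedFront x₁ X κ V M lo hi η b g U Ψ) (hV : 0 < V) {r s : ℝ}
    (hr : x₁ < r) (hrs : r < s) (hgr : g (r, 0) ≠ 0) (hgs : g (s, 0) ≠ 0)
    (hlt : g (s, 0) < g (r, 0)) : False := by
  obtain ⟨ξ, hξ0, hξ⟩ := S.exists_path r 0
  obtain ⟨ζ, hζ0, hζ⟩ := S.exists_path s 0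
  subst hξ0 hζ0
  have hord := S.path_lt hξ hζ hrs
  have hgξ (y : ℝ) := S.g_path hξ y 0
  have hgζ (y : ℝ) := S.g_path hζ y 0
  have hunξ := S.unbounded hξ hr hgr
  have hunζ := S.unbounded hζ (hr.trans hrs) hgs
  have hcξ := continuous_path hξ
  have hcζ := continuous_path hζ
  -- The path ζ reaches every abscissa beyond ζ(0), on a lower level; a rest point of ξ there would
  -- minimize `g` over the column.
  have hne : ∀ y, max X (ζ 0) ≤ ξ y → b (ξ y, y) ≠ 0 := by
    intro y hy hrest
    obtain ⟨y₁, hy₁, h₁⟩ := hunζ (ξ y)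
    obtain ⟨y', -, hy'⟩ := intermediate_value_Icc hy₁ hcζ.continuousOn
      (show ξ y ∈ _ from ⟨(le_max_right _ _).trans hy, h₁.le⟩)
    have := S.le_of_rest ((le_max_left _ _).trans hy) hrest y'
    rw [hgξ, ← hy', hgζ] at this
    linarith
  obtain ⟨y₂, hy₂0, hy₂⟩ := S.exists_forall_pos hξ hne hunξ
  have hpos (y : ℝ) (hy : y₂ ≤ y) : 0 < b (ξ y, y) := by
    have := (hy₂ y hy).1
    rwa [div_pos_iff_of_pos_right hV] at this
  have hM : 0 < M := (hpos y₂ le_rfl).trans_le ((le_abs_self _).trans (S.b_le _))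
  set Δ := g (ξ 0, 0) - g (ζ 0, 0) with hΔ
  have hΔpos : 0 < Δ := by linarith
  have hκ := S.κ_pos
  set δ := κ * Δ / M with hδ
  have hδpos : 0 < δ := by positivity
  have key (y t : ℝ) (ht : y₂ ≤ t) (hyt : ξ t = ζ y) : b (ζ y, y) ≤ b (ξ t, t) - δ := by
    have hX : X ≤ ξ t := (le_max_left _ _).trans (hy₂ t ht).2
    have hx₁ : x₁ ≤ ξ t := S.X_gt.le.trans hX
    have h1 := S.convex hX (S.η_mem (ξ t, t)) (S.η_mem (ξ t, y))
    rw [← S.b_eq _ hx₁, ← S.g_eq _ hx₁, ← S.g_eq _ hx₁, hgξ, hyt, hgζ, ← hyt] at h1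
    have hb := hpos t ht
    have hbM : b (ξ t, t) ≤ M := (le_abs_self _).trans (S.b_le _)
    have h2 : Δ ≤ b (ξ t, t) * (η (ξ t, t) - η (ξ t, y)) := by rw [hΔ]; linarith
    have h3 : 0 < η (ξ t, t) - η (ξ t, y) := by
      by_contra h
      push Not at h
      nlinarith
    have h4 := S.shear _ hX _ (S.η_mem (ξ t, y)) _ (S.η_mem (ξ t, t)) (by linarith)
    rw [← S.b_eq _ hx₁, ← S.b_eq _ hx₁] at h4
    rw [← hyt]
    have h5 : Δ ≤ M * (η (ξ t, t) - η (ξ t, y)) := h2.trans (by gcongr)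
    have h6 : δ ≤ κ * (η (ξ t, t) - η (ξ t, y)) := by
      rw [hδ, div_le_iff₀ hM]
      nlinarith
    linarith
  -- At time τ the trailing particle reaches the place where the leading one was at time y₂.
  obtain ⟨τ, hτ, hτζ⟩ : ∃ τ, y₂ ≤ τ ∧ ξ τ = ζ y₂ := by
    obtain ⟨K, hK⟩ := (isCompact_Icc (a := (0 : ℝ)) (b := y₂)).exists_bound_of_continuousOn
      hcξ.continuousOn
    obtain ⟨y, hy, hy'⟩ := hunξ (max K (ζ y₂))
    have hyy₂ : y₂ ≤ y := by
      by_contra h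
      push Not at h
      have := (le_abs_self _).trans (hK y ⟨hy, h.le⟩)
      linarith [le_max_left K (ζ y₂)]
    obtain ⟨τ, hτ, hτ'⟩ := intermediate_value_Icc hyy₂ hcξ.continuousOn
      (show ζ y₂ ∈ _ from ⟨(hord y₂).le, (le_max_right _ _).trans hy'.le⟩)
    exact ⟨τ, hτ.1, hτ'⟩
  have hδM : δ ≤ 2 * M := by
    have h1 := key y₂ τ hτ hτζ
    have h2 := (le_abs_self _).trans (S.b_le (ξ τ, τ))
    have h3 := (neg_le_of_abs_le (S.b_le (ζ y₂, y₂)))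
    linarith
  -- Slowing the clock of ξ by the factor 1 - ε costs at most εM = δ/2 of speed, less than its
  -- advantage δ. So ξ(τ + (1 - ε)t) stays at or ahead of ζ(y₂ + t), and at t = T = (τ - y₂)/ε the
  -- two clocks agree.
  set ε := δ / (2 * M) with hε
  have hεpos : 0 < ε := by positivity
  have hε1 : ε ≤ 1 := by rw [hε, div_le_one (by positivity)]; exact hδM
  set T := (τ - y₂) / ε with hT
  have hT0 : 0 ≤ T := div_nonneg (by linarith) hεpos.le
  have hcmp := image_le_of_deriv_right_lt_deriv_boundary' (a := 0) (b := T)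
    (f := fun t => ζ (y₂ + t)) (f' := fun t => b (ζ (y₂ + t), y₂ + t) / V)
    (B := fun t => ξ (τ + (1 - ε) * t))
    (B' := fun t => (1 - ε) * (b (ξ (τ + (1 - ε) * t), τ + (1 - ε) * t) / V))
    (hcζ.comp (by fun_prop)).continuousOn
    (fun t _ => by
      have := (hζ (y₂ + t)).scomp t ((hasDerivAt_id t).const_add y₂)
      simpa [Function.comp_def] using this.hasDerivWithinAt)
    (by simp [hτζ]) (hcξ.comp (by fun_prop)).continuousOn
    (fun t _ => by
      have := (hξ (τ + (1 - ε) * t)).scomp t (((hasDerivAt_id t).const_mul (1 - ε)).const_add τ)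
      simpa [Function.comp_def] using this.hasDerivWithinAt)
    (fun t ht hEq => by
      have ht' : y₂ ≤ τ + (1 - ε) * t := by
        have : 0 ≤ (1 - ε) * t := mul_nonneg (by linarith) ht.1
        linarith
      have h1 := key (y₂ + t) (τ + (1 - ε) * t) ht' hEq.symm
      have hbM : b (ξ (τ + (1 - ε) * t), τ + (1 - ε) * t) ≤ M := (le_abs_self _).trans (S.b_le _)
      have h2 : ε * b (ξ (τ + (1 - ε) * t), τ + (1 - ε) * t) ≤ δ / 2 := by
        calc ε * b (ξ (τ + (1 - ε) * t), τ + (1 - ε) * t) ≤ ε * M := by gcongr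
          _ = δ / 2 := by rw [hε]; field_simp
      rw [mul_div_assoc', div_lt_div_iff_of_pos_right hV]
      linarith)
    (right_mem_Icc.2 hT0)
  have hTeq : τ + (1 - ε) * T = y₂ + T := by
    rw [hT]; field_simp; ring
  simp only [hTeq] at hcmp
  exact absurd (hord (y₂ + T)) (not_lt.2 hcmp)

theorem overtake (S : ShearedFront x₁ X κ V M lo hi η b g U Ψ) {r s : ℝ}
    (hr : x₁ < r) (hrs : r < s) (hgr : g (r, 0) ≠ 0) (hgs : g (s, 0) ≠ 0)
    (hlt : g (s, 0) < g (r, 0)) : False := by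
  rcases S.V_ne.lt_or_gt with h | h
  · exact S.reverse.overtake_of_pos (neg_pos.2 h) hr hrs (by simpa using hgr) (by simpa using hgs)
      (by simpa using hlt)
  · exact S.overtake_of_pos h hr hrs hgr hgs hlt

/-- A particle on a positive level is unbounded and cannot rest beyond `X`, so it finally moves to
the right there. -/
theorem exists_forall_gt (S : ShearedFront x₁ X κ V M lo hi η b g U Ψ) {ξ : ℝ → ℝ}
    (hξ : IsPath V b ξ) (h₁ : x₁ < ξ 0) (hc : 0 < g (ξ 0, 0)) :
    ∃ y₂, 0 ≤ y₂ ∧ ∀ y, y₂ ≤ y → X ≤ ξ y := by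
  obtain ⟨y₂, h0, h⟩ := S.exists_forall_pos hξ (X' := X) (fun y hy hrest => by
    have := S.nonpos_of_rest hy hrest
    rw [S.g_path hξ y 0] at this
    linarith) (S.unbounded hξ h₁ hc.ne')
  exact ⟨y₂, h0, fun y hy => (h y hy).2⟩

/-- If every later level were positive, a particle started very far away would still be unbounded in
both time directions, hence would turn around at a rest point, necessarily left of `X`. The
slower-placed path from `s₀`, always to its left, is left of `X` only during a bounded time, too
short for the distant particle to arrive. -/
theorem exists_nonpos (S : ShearedFront x₁ X κ V M lo hi η b g U Ψ) {s₀ : ℝ} (hs₀ : x₁ < s₀)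
    (hg₀ : 0 < g (s₀, 0)) : ∃ s, s₀ < s ∧ g (s, 0) ≤ 0 := by
  by_contra! hall
  obtain ⟨ζ, hζ0, hζ⟩ := S.exists_path s₀ 0
  subst hζ0
  obtain ⟨y₂, hy₂0, hy₂⟩ := S.exists_forall_gt hζ hs₀ hg₀
  obtain ⟨y₁, hy₁0, hy₁⟩ := S.reverse.exists_forall_gt (Front.reverse_path hζ)
    (by simpa using hs₀) (by simpa using hg₀)
  set L := M / |V| with hL
  have hM : 0 ≤ M := (abs_nonneg _).trans (S.b_le 0)
  have hL0 : 0 ≤ L := by positivity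
  -- `L` bounds the speed of paths, so a path starting at `s` is still beyond `X` whenever |y| ≤ y₁
  -- + y₂.
  set s := |ζ 0| + |X| + L * (y₁ + y₂) + 1 with hs
  have hLy : 0 ≤ L * (y₁ + y₂) := by positivity
  have hsζ : ζ 0 < s := by
    rw [hs]; linarith [le_abs_self (ζ 0), abs_nonneg X]
  obtain ⟨ξ, hξ0, hξ⟩ := S.exists_path s 0
  have hgs := hall s hsζ
  have hx₁s : x₁ < ξ 0 := by rw [hξ0]; exact hs₀.trans hsζ
  have hgξ0 : 0 < g (ξ 0, 0) := by rw [hξ0]; exact hgs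
  obtain ⟨t₂, ht₂, h₂⟩ := S.unbounded hξ hx₁s hgξ0.ne' s
  obtain ⟨t₁, ht₁, h₁⟩ := S.unbounded_neg hξ hx₁s hgξ0.ne' s
  obtain ⟨t, ht, hmin⟩ := (isCompact_Icc (a := t₁) (b := t₂)).exists_isMinOn
    ⟨0, ht₁, ht₂⟩ (continuous_path hξ).continuousOn
  have hts : ξ t ≤ s := by
    have : ξ t ≤ ξ 0 := hmin ⟨ht₁, ht₂⟩
    rwa [hξ0] at this
  have ht1 : t₁ < t := by
    rcases ht.1.lt_or_eq with h | h
    · exact h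
    · rw [h] at h₁; linarith
  have ht2 : t < t₂ := by
    rcases ht.2.lt_or_eq with h | h
    · exact h
    · rw [← h] at h₂; linarith
  have hder : b (ξ t, t) / V = 0 :=
    (hmin.isLocalMin (Icc_mem_nhds ht1 ht2)).hasDerivAt_eq_zero (hξ t)
  have hrest : b (ξ t, t) = 0 := by
    rcases div_eq_zero_iff.1 hder with h | h
    · exact h
    · exact absurd h S.V_ne
  have hX : ξ t < X := by
    by_contra h
    push Not at h
    have := S.nonpos_of_rest h hrest
    rw [S.g_path hξ t 0] at this
    linarith
  have hζX : ζ t < X := (S.path_lt hζ hξ (y₀ := 0) (by rw [hξ0]; exact hsζ) t).trans hX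
  have hty₂ : t < y₂ := by
    by_contra h
    push Not at h
    linarith [hy₂ t h]
  have hty₁ : -y₁ < t := by
    by_contra h
    push Not at h
    have := hy₁ (-t) (by linarith)
    rw [neg_neg] at this
    linarith
  have hlip := (S.lipschitz_path hξ).dist_le_mul t 0
  rw [Real.dist_eq, Real.dist_eq, sub_zero, Real.coe_toNNReal _ hL0, hξ0] at hlip
  have habs : |t| ≤ y₁ + y₂ := by rw [abs_le]; constructor <;> linarith
  have h3 : L * |t| ≤ L * (y₁ + y₂) := by gcongr
  have h4 := (abs_le.1 hlip).1
  rw [hs] at h4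
  linarith [le_abs_self X, abs_nonneg (ζ 0)]

/-- The stream function vanishes on a sheared front. -/
theorem g_eq_zero (S : ShearedFront x₁ X κ V M lo hi η b g U Ψ) {x : ℝ} (hx : x₁ ≤ x) (y : ℝ) :
    g (x, y) = 0 := by
  have hc : Continuous fun x => g (x, (0 : ℝ)) := S.g_C1.continuous.comp (by fun_prop)
  -- A negative level has half of it, a higher level, somewhere behind: the forbidden order.
  have hnn : ∀ s, x₁ < s → 0 ≤ g (s, 0) := by
    intro s hs
    by_contra! hneg
    obtain ⟨r, hr1, hr2, hgr, -⟩ := exists_last_half hc hs (S.g_zero 0) hneg.ne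
    exact S.overtake hr1 hr2 (by rw [hgr]; intro h; linarith) hneg.ne (by rw [hgr]; linarith)
  -- A positive level is followed by a nonpositive one, hence by half of itself: again a lower level
  -- ahead.
  have hzero : ∀ s, x₁ < s → g (s, 0) = 0 := by
    intro s₀ hs₀
    by_contra hne
    have hpos : 0 < g (s₀, 0) := lt_of_le_of_ne (hnn s₀ hs₀) (Ne.symm hne)
    obtain ⟨s, hs, hgs⟩ := S.exists_nonpos hs₀ hpos
    obtain ⟨t, ht, ht'⟩ := intermediate_value_Icc' hs.le hc.continuousOn
      (show g (s₀, 0) / 2 ∈ _ from ⟨by linarith, by linarith⟩)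
    have ht' : g (t, 0) = g (s₀, 0) / 2 := ht'
    have hst : s₀ < t := by
      rcases ht.1.lt_or_eq with h | h
      · exact h
      · rw [← h] at ht'; linarith
    exact S.overtake hs₀ hst hne (by rw [ht']; intro h; linarith) (by rw [ht']; linarith)
  by_contra hne
  have hx' : x₁ < x := by
    rcases hx.lt_or_eq with h | h
    · exact h
    · rw [← h] at hne; exact absurd (S.g_zero y) hne
  obtain ⟨ξ, hξy, hξ⟩ := S.exists_path x y
  have h1 : x₁ < ξ 0 := S.path_gt hξ (y₀ := y)
    (fun t => by rw [S.g_zero, hξy]; exact Ne.symm hne) (by rw [hξy]; exact hx') 0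
  have h2 := S.g_path hξ y 0
  rw [hξy, hzero _ h1] at h2
  exact hne h2

end ShearedFront

/-- The stream function vanishes on a front over a bounded interval if it is constant at the ends
and vanishes at the left one. -/
theorem Front.g_eq_zero_of_Icc {V M lo hi x₁ x₂ c₂ : ℝ} {η b g U Ψ : ℝ × ℝ → ℝ}
    (F : Front V M lo hi η b g)
    (hU : ContinuousOn U (Icc x₁ x₂ ×ˢ Icc lo hi)) (hΨ : ContinuousOn Ψ (Icc x₁ x₂ ×ˢ Icc lo hi))
    (hb : ∀ x ∈ Icc x₁ x₂, ∀ y, b (x, y) = U (x, η (x, y)))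
    (hg : ∀ x ∈ Icc x₁ x₂, ∀ y, g (x, y) = Ψ (x, η (x, y))) (hg₁ : ∀ y, g (x₁, y) = 0)
    (hg₂ : ∀ y, g (x₂, y) = c₂) {x : ℝ} (hx : x ∈ Icc x₁ x₂) (y : ℝ) : g (x, y) = 0 := by
  -- A level other than 0 and c₂ can cross neither end column, so its path would be confined to a
  -- bounded region.
  have hmain : ∀ s ∈ Icc x₁ x₂, g (s, y) = 0 ∨ g (s, y) = c₂ := by
    intro s hs
    by_contra! hne
    obtain ⟨ξ, hξ0, hξ⟩ := F.exists_path s y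
    have h1 : x₁ < s := lt_of_le_of_ne hs.1 (fun h => hne.1 (by rw [← h]; exact hg₁ y))
    have h2 : s < x₂ := lt_of_le_of_ne hs.2 (fun h => hne.2 (by rw [h]; exact hg₂ y))
    have h3 := F.path_gt hξ (x₁ := x₁) (y₀ := y)
      (fun t => by rw [hg₁, hξ0]; exact hne.1.symm) (by rw [hξ0]; exact h1)
    have h4 := F.path_lt_of_ne hξ (x₂ := x₂) (y₀ := y)
      (fun t => by rw [hg₂, hξ0]; exact hne.2.symm) (by rw [hξ0]; exact h2)
    refine F.not_forall_mem_Icc hU hΨ hb hg hg₁ hξ ?_ fun t _ => ⟨(h3 t).le, (h4 t).le⟩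
    rw [F.g_path hξ 0 y, hξ0]
    exact hne.1
  have hc : Continuous fun x => g (x, y) := F.g_C1.continuous.comp (by fun_prop)
  by_contra hne
  have hx₁ : x₁ < x := lt_of_le_of_ne hx.1 (fun h => hne (by rw [← h]; exact hg₁ y))
  obtain ⟨r, hr1, hr2, hgr, -⟩ := exists_last_half hc hx₁ (hg₁ y) hne
  rcases hmain x hx with h | h
  · exact hne h
  · rcases hmain r ⟨hr1.le, hr2.le.trans hx.2⟩ with h' | h'
    · rw [h'] at hgr; exact hne (by linarith)
    · rw [h', ← h] at hgr; exact hne (by linarith)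


/-! ### Holomorphic functions on strips, real on the walls. -/

open Complex in
theorem re_cosh (w : ℂ) : (Complex.cosh w).re = Real.cosh w.re * Real.cos w.im := by
  conv_lhs => rw [← re_add_im w, Complex.cosh_add, cosh_mul_I, sinh_mul_I]
  rw [← ofReal_cosh, ← ofReal_sinh, ← ofReal_cos, ← ofReal_sin]
  simp [cos_ofReal_re]

open Complex in
/-- A holomorphic function on a rectangle whose imaginary part vanishes on the horizontal sides has
small imaginary part halfway between the vertical sides, if the rectangle is long. One-sided
version. -/
theorem im_le_of_rectangle {f : ℂ → ℂ} {c L a b M : ℝ} (hL : 0 < L) (hab : a < b) (hM : 0 ≤ M)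
    (hf : DiffContOnCl ℂ f (Ioo (c - L) (c + L) ×ℂ Ioo a b))
    (hbd : ∀ ζ ∈ Icc (c - L) (c + L) ×ℂ Icc a b, (f ζ).im ≤ M)
    (hwall : ∀ ζ ∈ Icc (c - L) (c + L) ×ℂ {a, b}, (f ζ).im = 0) {z : ℝ} (hz : z ∈ Icc a b) :
    (f (c + z * I)).im ≤ 2 * M / Real.cosh (L / (b - a)) := by
  set h := b - a with hh
  have hh0 : 0 < h := by linarith
  -- The barrier A cosh((x - c)/h) cos((z - (a + b)/2)/h) is harmonic and nonnegative on the walls.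
  -- The cosine is at least 1/2 on the strip, so this `A` makes the barrier at least `M` on the
  -- vertical sides. Taking an exponential reduces the comparison to the maximum modulus principle.
  set A := 2 * M / Real.cosh (L / h) with hA
  have hch := Real.cosh_pos (L / h)
  have hA0 : 0 ≤ A := by positivity
  set p : ℂ := c + ((a + b) / 2 : ℝ) * I with hp
  set Φ : ℂ → ℂ := fun ζ => exp (-I * f ζ - A * Complex.cosh ((ζ - p) / h)) with hΦ
  have hΦn (ζ : ℂ) : ‖Φ ζ‖ = Real.exp ((f ζ).im
      - A * (Real.cosh ((ζ.re - c) / h) * Real.cos ((ζ.im - (a + b) / 2) / h))) := by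
    rw [hΦ]
    simp only
    rw [norm_exp]
    congr 1
    have h1 : ((ζ - p) / h).re = (ζ.re - c) / h := by rw [div_ofReal_re]; simp [hp]
    have h2 : ((ζ - p) / h).im = (ζ.im - (a + b) / 2) / h := by rw [div_ofReal_im]; simp [hp]
    rw [sub_re, re_ofReal_mul, re_cosh, h1, h2]
    simp
  have hcos {t : ℝ} (ht : t ∈ Icc a b) : 1 / 2 ≤ Real.cos ((t - (a + b) / 2) / h) := by
    have h1 : |(t - (a + b) / 2) / h| ≤ 1 / 2 := by
      rw [abs_div, abs_of_pos hh0, div_le_iff₀ hh0, abs_le]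
      constructor <;> linarith [ht.1, ht.2]
    have h2 := Real.one_sub_sq_div_two_le_cos (x := (t - (a + b) / 2) / h)
    have h3 : ((t - (a + b) / 2) / h) ^ 2 ≤ (1 / 2) ^ 2 := sq_le_sq' (by linarith [(abs_le.1 h1).1])
      (abs_le.1 h1).2
    linarith
  have hmax : ‖Φ (c + z * I)‖ ≤ 1 := by
    refine norm_le_of_forall_mem_frontier_norm_le
      ((Metric.isBounded_Ioo _ _).reProdIm (Metric.isBounded_Ioo _ _) :
        Bornology.IsBounded (Ioo (c - L) (c + L) ×ℂ Ioo a b)) ?_ ?_ ?_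
    · rw [hΦ]
      have h1 : Differentiable ℂ fun ζ : ℂ => (A : ℂ) * Complex.cosh ((ζ - p) / h) := by fun_prop
      exact differentiable_exp.comp_diffContOnCl ((hf.const_smul (-I)).sub h1.diffContOnCl)
    · intro ζ hζ
      rw [frontier_reProdIm, closure_Ioo (by linarith), frontier_Ioo hab,
        closure_Ioo hab.ne, frontier_Ioo (show c - L < c + L by linarith)] at hζ
      rw [hΦn, Real.exp_le_one_iff]
      rcases hζ with hζ | hζ
      · have him : ζ.im ∈ Icc a b := by
          rcases hζ.2 with h1 | h1
          · exact ⟨h1.symm.le, h1.le.trans hab.le⟩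
          · have h1 : ζ.im = b := h1
            exact ⟨hab.le.trans h1.symm.le, h1.le⟩
        rw [hwall ζ hζ]
        have := hcos him
        have h2 := Real.cosh_pos ((ζ.re - c) / h)
        have : 0 ≤ A * (Real.cosh ((ζ.re - c) / h) * Real.cos ((ζ.im - (a + b) / 2) / h)) := by
          positivity
        linarith
      · have hre : Real.cosh ((ζ.re - c) / h) = Real.cosh (L / h) := by
          rcases hζ.1 with h1 | h1
          · have h1 : ζ.re = c - L := h1
            rw [h1, show (c - L - c) / h = -(L / h) by ring, Real.cosh_neg]
          · have h1 : ζ.re = c + L := h1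
            rw [h1, add_sub_cancel_left]
        have hmem : ζ ∈ Icc (c - L) (c + L) ×ℂ Icc a b := by
          refine ⟨?_, hζ.2⟩
          rcases hζ.1 with h1 | h1
          · have h1 : ζ.re = c - L := h1
            exact ⟨h1.symm.le, by rw [h1]; linarith⟩
          · have h1 : ζ.re = c + L := h1
            exact ⟨by rw [h1]; linarith, h1.le⟩
        have h3 := hbd ζ hmem
        have h4 := hcos hζ.2
        rw [hre]
        have h5 : A * (Real.cosh (L / h) * Real.cos ((ζ.im - (a + b) / 2) / h))
            = 2 * M * Real.cos ((ζ.im - (a + b) / 2) / h) := by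
          rw [hA]; field_simp
        rw [h5]
        nlinarith
    · rw [closure_reProdIm, closure_Ioo (by linarith), closure_Ioo hab.ne]
      refine ⟨?_, ?_⟩
      · simp only [mem_preimage, add_re, ofReal_re, mul_re, I_re, mul_zero, ofReal_im, I_im,
          mul_one, sub_self, add_zero, mem_Icc]
        constructor <;> linarith
      · simpa using hz
  rw [hΦn, Real.exp_le_one_iff] at hmax
  simp only [add_re, ofReal_re, mul_re, I_re, mul_zero, ofReal_im, I_im, mul_one, sub_self,
    add_zero, zero_div, Real.cosh_zero, one_mul, add_im, mul_im, zero_add] at hmax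
  have h6 : A * Real.cos ((z - (a + b) / 2) / h) ≤ A * 1 := by
    gcongr
    exact Real.cos_le_one _
  linarith

open Complex in
theorem abs_im_le_of_rectangle {f : ℂ → ℂ} {c L a b M : ℝ} (hL : 0 < L) (hab : a < b) (hM : 0 ≤ M)
    (hf : DiffContOnCl ℂ f (Ioo (c - L) (c + L) ×ℂ Ioo a b))
    (hbd : ∀ ζ ∈ Icc (c - L) (c + L) ×ℂ Icc a b, |(f ζ).im| ≤ M)
    (hwall : ∀ ζ ∈ Icc (c - L) (c + L) ×ℂ {a, b}, (f ζ).im = 0) {z : ℝ} (hz : z ∈ Icc a b) :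
    |(f (c + z * I)).im| ≤ 2 * M / Real.cosh (L / (b - a)) := by
  refine abs_le.2 ⟨?_, im_le_of_rectangle hL hab hM hf
    (fun ζ hζ => (le_abs_self _).trans (hbd ζ hζ)) hwall hz⟩
  have := im_le_of_rectangle (f := fun ζ => -f ζ) hL hab hM hf.neg
    (fun ζ hζ => by rw [neg_im]; exact (neg_le_abs _).trans (hbd ζ hζ))
    (fun ζ hζ => by rw [neg_im, hwall ζ hζ, neg_zero]) hz
  rw [neg_im] at this
  linarith

theorem le_cosh (t : ℝ) : t / 2 ≤ Real.cosh t := by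
  rw [Real.cosh_eq]
  linarith [Real.add_one_le_exp t, Real.exp_pos (-t)]

open Complex in
/-- The derivative of a holomorphic function is controlled by its imaginary part. -/
theorem norm_deriv_le_of_abs_im_le {f : ℂ → ℂ} {p : ℂ} {r ε : ℝ} (hr : 0 < r) (hε : 0 < ε)
    (hf : DifferentiableOn ℂ f (Metric.ball p r)) (him : ∀ ζ ∈ Metric.ball p r, |(f ζ).im| ≤ ε) :
    ‖deriv f p‖ ≤ 8 * ε / r := by
  -- Re k = Im f(p + w) - Im f(p) ≤ 2ε. Borel–Carathéodory gives |k| ≤ 4ε at radius r/2, and the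
  -- Cauchy estimate then gives 4ε/(r/2).
  set k : ℂ → ℂ := fun w => -I * (f (p + w) - f p) with hk
  have hmaps : MapsTo (fun w => p + w) (Metric.ball 0 r) (Metric.ball p r) := fun w hw => by
    simpa [mem_ball_iff_norm] using hw
  have hp : p ∈ Metric.ball p r := Metric.mem_ball_self hr
  have hkd : DifferentiableOn ℂ k (Metric.ball 0 r) := by
    refine DifferentiableOn.const_mul (DifferentiableOn.sub_const ?_ _) _
    exact hf.comp (by fun_prop) hmaps
  have hbc : ∀ w ∈ Metric.sphere (0 : ℂ) (r / 2), ‖k w‖ ≤ 4 * ε := by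
    intro w hw
    have hw' : ‖w‖ = r / 2 := by simpa using hw
    have := borelCaratheodory_zero (f := k) (M := 2 * ε) (R := r) (z := w) (by positivity) hkd
      (fun v hv => ?_) hr (by rw [mem_ball_zero_iff, hw']; linarith) (by simp [hk])
    · rw [hw'] at this
      refine this.trans (le_of_eq ?_)
      field_simp
      ring
    · have h1 := him _ (hmaps hv)
      have h2 := him _ hp
      rw [abs_le] at h1 h2
      simp only [hk, mem_ofPred_eq, neg_mul, neg_re, mul_re, I_re, I_im, zero_mul, one_mul, sub_im]
      linarith [h1.2, h2.1]
  have hcl : DiffContOnCl ℂ k (Metric.ball 0 (r / 2)) := by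
    refine DifferentiableOn.diffContOnCl (hkd.mono ?_)
    refine Metric.closure_ball_subset_closedBall.trans (Metric.closedBall_subset_ball (by linarith))
  have hd := norm_deriv_le_of_forall_mem_sphere_norm_le (by positivity : 0 < r / 2) hcl hbc
  have hfd : HasDerivAt f (deriv f p) p :=
    (hf.differentiableAt (Metric.isOpen_ball.mem_nhds hp)).hasDerivAt
  have hkd0 : HasDerivAt k (-I * deriv f p) 0 := by
    have h1 : HasDerivAt (fun w => f (p + w)) (deriv f p) 0 := by
      have : HasDerivAt f (deriv f p) (p + 0) := by simpa using hfd
      exact this.comp_const_add p 0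
    exact (h1.sub_const _).const_mul _
  rw [hkd0.deriv, norm_mul, norm_neg, norm_I, one_mul] at hd
  refine hd.trans (le_of_eq ?_)
  field_simp
  ring

open Complex in
/-- A bounded holomorphic function on a half-strip with vanishing imaginary part on the walls has
small derivative far away, uniformly away from the walls. -/
theorem exists_norm_deriv_le_of_half_strip {a b lo hi M ε : ℝ} (hlo : a < lo)
    (hlohi : lo ≤ hi) (hhi : hi < b) (hε : 0 < ε) (hM : 0 ≤ M) :
    ∃ L : ℝ, 0 < L ∧ ∀ (f : ℂ → ℂ) (x₁ : ℝ), DifferentiableOn ℂ f (Ioi x₁ ×ℂ Ioo a b) →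
      ContinuousOn f (Ioi x₁ ×ℂ Icc a b) → (∀ ζ ∈ Ioi x₁ ×ℂ Icc a b, |(f ζ).im| ≤ M) →
      (∀ ζ ∈ Ioi x₁ ×ℂ {a, b}, (f ζ).im = 0) →
      ∀ x : ℝ, x₁ + L ≤ x → ∀ z ∈ Icc lo hi, ‖deriv f (x + z * I)‖ ≤ ε := by
  have hab : a < b := by linarith
  set r := min (lo - a) (b - hi) with hr
  have hr0 : 0 < r := lt_min (by linarith) (by linarith)
  set δ := ε * r / 8 with hδ
  have hδ0 : 0 < δ := by positivity
  -- A rectangle centred at x of half-length (x - x₁)/2, together with cosh t ≥ t/2, gives |Im f| ≤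
  -- δ beyond the first two terms. The term `r` leaves room for the disc of the derivative estimate.
  refine ⟨1 + 2 * (b - a) * (4 * M / δ) + r + 1, ?_, fun f x₁ hd hc hbd hwall => ?_⟩
  · have hq : 0 ≤ 2 * (b - a) * (4 * M / δ) := mul_nonneg (by linarith) (by positivity)
    linarith
  have him (x z : ℝ) (hx : x₁ + 1 + 2 * (b - a) * (4 * M / δ) < x) (hz : z ∈ Icc a b) :
      |(f (x + z * I)).im| ≤ δ := by
    have hq : 0 ≤ 2 * (b - a) * (4 * M / δ) :=
      mul_nonneg (by linarith) (by positivity)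
    set L := (x - x₁) / 2 with hL
    have hL0 : 0 < L := by rw [hL]; linarith
    have hsub : Icc (x - L) (x + L) ⊆ Ioi x₁ := fun t ht => by
      have : x - L ≤ t := ht.1
      rw [hL] at this
      simp only [mem_Ioi]
      linarith
    have hsub2 : ({a, b} : Set ℝ) ⊆ Icc a b := by
      intro t ht
      rcases ht with rfl | ht
      · exact ⟨le_rfl, hab.le⟩
      · rw [mem_singleton_iff] at ht
        rw [ht]; exact ⟨hab.le, le_rfl⟩
    have h1 := abs_im_le_of_rectangle (f := f) (c := x) hL0 hab hM
      ⟨hd.mono fun ζ hζ => ⟨hsub (Ioo_subset_Icc_self hζ.1), hζ.2⟩, by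
        rw [closure_reProdIm, closure_Ioo (by linarith), closure_Ioo hab.ne]
        exact hc.mono fun ζ hζ => ⟨hsub hζ.1, hζ.2⟩⟩
      (fun ζ hζ => hbd ζ ⟨hsub hζ.1, hζ.2⟩) (fun ζ hζ => hwall ζ ⟨hsub hζ.1, hζ.2⟩) hz
    refine h1.trans ?_
    rw [div_le_iff₀ (Real.cosh_pos _)]
    have h2 := le_cosh (L / (b - a))
    have hba : 0 < b - a := by linarith
    have h3 : 4 * M / δ ≤ L / (b - a) := by
      rw [le_div_iff₀ hba, hL]
      linarith
    rw [div_le_iff₀ hδ0] at h3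
    nlinarith
  intro x hx z hz
  · have hball (ζ : ℂ) (hζ : ζ ∈ Metric.ball ((x : ℂ) + z * I) r) :
        x₁ + 1 + 2 * (b - a) * (4 * M / δ) < ζ.re ∧ ζ.im ∈ Ioo a b := by
      rw [mem_ball_iff_norm] at hζ
      have h1 := (abs_re_le_norm _).trans_lt hζ
      have h2 := (abs_im_le_norm _).trans_lt hζ
      simp only [sub_re, add_re, ofReal_re, mul_re, I_re, mul_zero, ofReal_im, I_im, mul_one,
        sub_self, add_zero, sub_im, add_im, mul_im, zero_add] at h1 h2
      rw [abs_lt] at h1 h2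
      refine ⟨by linarith [h1.1], ?_, ?_⟩
      · linarith [h2.1, min_le_left (lo - a) (b - hi), hz.1]
      · linarith [h2.2, min_le_right (lo - a) (b - hi), hz.2]
    have hq : 0 ≤ 2 * (b - a) * (4 * M / δ) := mul_nonneg (by linarith) (by positivity)
    have := norm_deriv_le_of_abs_im_le (f := f) (p := (x : ℂ) + z * I) hr0 hδ0
      (hd.mono fun ζ hζ => ⟨by
        simp only [mem_preimage, mem_Ioi]; linarith [(hball ζ hζ).1], (hball ζ hζ).2⟩)
      (fun ζ hζ => by
        have := him ζ.re ζ.im (hball ζ hζ).1 (Ioo_subset_Icc_self (hball ζ hζ).2)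
        rwa [re_add_im] at this)
    refine this.trans (le_of_eq ?_)
    rw [hδ]; field_simp

open Complex in
/-- A bounded holomorphic function on a strip with vanishing imaginary part on the walls has zero
derivative. -/
theorem deriv_eq_zero_of_strip {f : ℂ → ℂ} {a b M : ℝ}
    (hd : DifferentiableOn ℂ f (univ ×ℂ Ioo a b)) (hc : ContinuousOn f (univ ×ℂ Icc a b))
    (hbd : ∀ ζ ∈ univ ×ℂ Icc a b, |(f ζ).im| ≤ M)
    (hwall : ∀ ζ ∈ univ ×ℂ {a, b}, (f ζ).im = 0) {ζ : ℂ} (hζ : ζ.im ∈ Ioo a b) :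
    deriv f ζ = 0 := by
  have hM : 0 ≤ M := (abs_nonneg _).trans (hbd ζ ⟨trivial, Ioo_subset_Icc_self hζ⟩)
  by_contra hne
  have hpos : 0 < ‖deriv f ζ‖ / 2 := by positivity
  obtain ⟨L, hL, h⟩ := exists_norm_deriv_le_of_half_strip hζ.1 le_rfl hζ.2 hpos hM
  -- On a full strip the half-strip may begin `L` to the left of any given point, for every
  -- accuracy.
  have := h f (ζ.re - L) (hd.mono fun w hw => ⟨trivial, hw.2⟩)
    (hc.mono fun w hw => ⟨trivial, hw.2⟩) (fun w hw => hbd w ⟨trivial, hw.2⟩)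
    (fun w hw => hwall w ⟨trivial, hw.2⟩) ζ.re (by linarith) ζ.im ⟨le_rfl, le_rfl⟩
  rw [re_add_im] at this
  linarith


/-! ### Geometry of a layer. -/

/-- The region between two graphs over the horizontal plane. -/
def slab (lo hi : ℝ × ℝ → ℝ) : Set (ℝ × ℝ × ℝ) :=
  {p | lo (p.1, p.2.1) < p.2.2 ∧ p.2.2 < hi (p.1, p.2.1)}

/-- Two continuous graphs separated by the horizontal plane `z = z₀`. -/
structure Separated (lo hi : ℝ × ℝ → ℝ) (z₀ : ℝ) : Prop where
  lo_cont : Continuous lo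
  hi_cont : Continuous hi
  lo_lt : ∀ q, lo q < z₀
  lt_hi : ∀ q, z₀ < hi q

namespace Separated

variable {lo hi : ℝ × ℝ → ℝ} {z₀ : ℝ}

theorem isOpen (S : Separated lo hi z₀) : IsOpen (slab lo hi) := by
  have h1 := S.lo_cont
  have h2 := S.hi_cont
  have e1 : IsOpen {p : ℝ × ℝ × ℝ | lo (p.1, p.2.1) < p.2.2} :=
    isOpen_lt (by fun_prop) (by fun_prop)
  have e2 : IsOpen {p : ℝ × ℝ × ℝ | p.2.2 < hi (p.1, p.2.1)} :=
    isOpen_lt (by fun_prop) (by fun_prop)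
  exact e1.inter e2

theorem mem_plane (S : Separated lo hi z₀) (x y : ℝ) : (x, y, z₀) ∈ slab lo hi :=
  ⟨S.lo_lt _, S.lt_hi _⟩

theorem le_of_mem_closure (S : Separated lo hi z₀) {p : ℝ × ℝ × ℝ}
    (hp : p ∈ closure (slab lo hi)) : lo (p.1, p.2.1) ≤ p.2.2 ∧ p.2.2 ≤ hi (p.1, p.2.1) := by
  have h1 := S.lo_cont
  have h2 := S.hi_cont
  have e1 : IsClosed {p : ℝ × ℝ × ℝ | lo (p.1, p.2.1) ≤ p.2.2} :=
    isClosed_le (by fun_prop) (by fun_prop)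
  have e2 : IsClosed {p : ℝ × ℝ × ℝ | p.2.2 ≤ hi (p.1, p.2.1)} :=
    isClosed_le (by fun_prop) (by fun_prop)
  have hsub : slab lo hi ⊆ {p : ℝ × ℝ × ℝ | lo (p.1, p.2.1) ≤ p.2.2} ∩
      {p : ℝ × ℝ × ℝ | p.2.2 ≤ hi (p.1, p.2.1)} := fun q hq => ⟨hq.1.le, hq.2.le⟩
  exact closure_minimal hsub (e1.inter e2) hp

/-- A vertical move towards the plane z = z₀ enters the open layer at once, so boundary values are
limits along vertical segments. -/
theorem approach_mem (S : Separated lo hi z₀) {x y z s : ℝ} (h : lo (x, y) ≤ z ∧ z ≤ hi (x, y))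
    (hs : 0 < s) (hs1 : s ≤ 1) : (x, y, z + s * (z₀ - z)) ∈ slab lo hi := by
  have h1 := S.lo_lt (x, y)
  have h2 := S.lt_hi (x, y)
  constructor
  · show lo (x, y) < z + s * (z₀ - z)
    nlinarith
  · show z + s * (z₀ - z) < hi (x, y)
    nlinarith

theorem tendsto_approach (x y z z₀ : ℝ) :
    Tendsto (fun s : ℝ => ((x, y, z + s * (z₀ - z)) : ℝ × ℝ × ℝ)) (𝓝[>] 0) (𝓝 (x, y, z)) := by
  have : Continuous fun s : ℝ => ((x, y, z + s * (z₀ - z)) : ℝ × ℝ × ℝ) := by fun_prop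
  have h := this.tendsto 0
  simp only [zero_mul, add_zero] at h
  exact h.mono_left nhdsWithin_le_nhds

theorem mem_closure_iff (S : Separated lo hi z₀) {x y z : ℝ} :
    (x, y, z) ∈ closure (slab lo hi) ↔ lo (x, y) ≤ z ∧ z ≤ hi (x, y) := by
  refine ⟨fun h => S.le_of_mem_closure h, fun h => ?_⟩
  refine mem_closure_of_tendsto (tendsto_approach x y z z₀) ?_
  filter_upwards [Ioc_mem_nhdsGT (zero_lt_one' ℝ)] with s hs
  exact S.approach_mem h hs.1 hs.2

theorem tendsto_approach_within (S : Separated lo hi z₀) {x y z : ℝ}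
    (h : (x, y, z) ∈ closure (slab lo hi)) :
    Tendsto (fun s : ℝ => ((x, y, z + s * (z₀ - z)) : ℝ × ℝ × ℝ)) (𝓝[>] 0)
      (𝓝[slab lo hi] (x, y, z)) := by
  refine tendsto_nhdsWithin_iff.2 ⟨tendsto_approach x y z z₀, ?_⟩
  filter_upwards [Ioc_mem_nhdsGT (zero_lt_one' ℝ)] with s hs
  exact S.approach_mem (S.mem_closure_iff.1 h) hs.1 hs.2

/-- Two functions continuous up to the boundary which agree at heights inside the layers above two
points of the plane also agree on the boundary. -/
theorem eq_of_eqOn_slab (S : Separated lo hi z₀) {f : ℝ × ℝ × ℝ → ℝ}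
    (hf : ContinuousOn f (closure (slab lo hi)))
    (heq : ∀ x y y' z, (x, y, z) ∈ slab lo hi → (x, y', z) ∈ slab lo hi → f (x, y, z) = f (x, y', z))
    {x y y' z : ℝ} (h : (x, y, z) ∈ closure (slab lo hi)) (h' : (x, y', z) ∈ closure (slab lo hi)) :
    f (x, y, z) = f (x, y', z) := by
  have h1 := ((hf _ h).mono subset_closure).tendsto.comp (S.tendsto_approach_within h)
  have h2 := ((hf _ h').mono subset_closure).tendsto.comp (S.tendsto_approach_within h')
  refine tendsto_nhds_unique h1 (h2.congr' ?_)
  filter_upwards [Ioc_mem_nhdsGT (zero_lt_one' ℝ)] with s hs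
  exact (heq _ _ _ _ (S.approach_mem (S.mem_closure_iff.1 h) hs.1 hs.2)
    (S.approach_mem (S.mem_closure_iff.1 h') hs.1 hs.2)).symm

/-- A function with vanishing gradient is constant. -/
theorem eq_of_fderiv_eq_zero (S : Separated lo hi z₀) {f : ℝ × ℝ × ℝ → ℝ}
    (hf : ∀ p ∈ slab lo hi, HasFDerivAt f (0 : ℝ × ℝ × ℝ →L[ℝ] ℝ) p) {p : ℝ × ℝ × ℝ}
    (hp : p ∈ slab lo hi) : f p = f (0, 0, z₀) := by
  have key {a b : ℝ × ℝ × ℝ} (h : segment ℝ a b ⊆ slab lo hi) : f b = f a := by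
    have := (convex_segment a b).norm_image_sub_le_of_norm_hasFDerivWithin_le (f := f) (C := 0)
      (fun x hx => (hf x (h hx)).hasFDerivWithinAt) (by simp) (left_mem_segment ℝ a b)
      (right_mem_segment ℝ a b)
    rw [zero_mul, norm_le_zero_iff, sub_eq_zero] at this
    exact this
  obtain ⟨x, y, z⟩ := p
  have h1 : f (x, y, z₀) = f (0, 0, z₀) := by
    refine key ?_
    rintro q ⟨s, t, hs, ht, hst, rfl⟩
    have : s • ((0, 0, z₀) : ℝ × ℝ × ℝ) + t • (x, y, z₀) = (t * x, t * y, z₀) := by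
      simp only [Prod.smul_mk, smul_eq_mul, mul_zero, Prod.mk_add_mk, zero_add, ← add_mul, hst,
        one_mul]
    rw [this]
    exact S.mem_plane _ _
  rw [← h1]
  refine key ?_
  rintro q ⟨s, t, hs, ht, hst, rfl⟩
  have : s • ((x, y, z₀) : ℝ × ℝ × ℝ) + t • (x, y, z) = (x, y, s * z₀ + t * z) := by
    simp only [Prod.smul_mk, smul_eq_mul, Prod.mk_add_mk, ← add_mul, hst, one_mul]
  rw [this]
  have h1 := S.lo_lt (x, y)
  have h2 := S.lt_hi (x, y)
  have h3 : lo (x, y) < z := hp.1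
  have h4 : z < hi (x, y) := hp.2
  constructor
  · exact convex_Ioi (lo (x, y)) h1 h3 hs ht hst
  · exact convex_Iio (hi (x, y)) h2 h4 hs ht hst

end Separated

/-! ### The Bernoulli function of a layer. -/

/-- A linear functional on `ℝ³` with given coefficients. -/
noncomputable def covector (a b c : ℝ) : ℝ × ℝ × ℝ →L[ℝ] ℝ :=
  a • ContinuousLinearMap.fst ℝ ℝ (ℝ × ℝ) +
    (b • ContinuousLinearMap.fst ℝ ℝ ℝ + c • ContinuousLinearMap.snd ℝ ℝ ℝ).comp
      (ContinuousLinearMap.snd ℝ ℝ (ℝ × ℝ))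

theorem covector_apply (a b c : ℝ) (h : ℝ × ℝ × ℝ) :
    covector a b c h = a * h.1 + (b * h.2.1 + c * h.2.2) := by
  simp [covector]

theorem eq_covector (L : ℝ × ℝ × ℝ →L[ℝ] ℝ) :
    L = covector (L (1, 0, 0)) (L (0, 1, 0)) (L (0, 0, 1)) := by
  refine ContinuousLinearMap.ext fun h => ?_
  have : h = h.1 • ((1, 0, 0) : ℝ × ℝ × ℝ) + (h.2.1 • (0, 1, 0) + h.2.2 • (0, 0, 1)) := by
    ext <;> simp
  conv_lhs => rw [this]
  simp only [map_add, map_smul, covector_apply, smul_eq_mul]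
  ring

theorem hasFDerivAt_covector {f : ℝ × ℝ × ℝ → ℝ} {p : ℝ × ℝ × ℝ} (hf : DifferentiableAt ℝ f p) :
    HasFDerivAt f (covector (dx f p) (dy f p) (dz f p)) p := by
  rw [dx, dy, dz, ← eq_covector]
  exact hf.hasFDerivAt

/-- The Bernoulli function. -/
noncomputable def Fluid.head (F : Fluid) (ρ g : ℝ) (p : ℝ × ℝ × ℝ) : ℝ :=
  F.P p / ρ + g * p.2.2 + (F.u p ^ 2 + F.v p ^ 2 + F.w p ^ 2) / 2

/-- One layer of fluid with constant vorticity `(0, β, 0)`. -/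
structure Layer (F : Fluid) (lo hi : ℝ × ℝ → ℝ) (z₀ ρ g β M : ℝ) : Prop extends
    Separated lo hi z₀ where
  ρ_pos : 0 < ρ
  β_ne : β ≠ 0
  C1 : F.IsC1On (slab lo hi)
  euler : F.SolvesEuler ρ g (slab lo hi)
  vort : ∀ p ∈ slab lo hi, F.vorticity p = (0, β, 0)
  bound : ∀ p ∈ slab lo hi, |F.u p| ≤ M ∧ |F.v p| ≤ M ∧ |F.w p| ≤ M

namespace Layer

variable {F : Fluid} {lo hi : ℝ × ℝ → ℝ} {z₀ ρ g β M : ℝ}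

theorem mem_nhds (S : Separated lo hi z₀) {p : ℝ × ℝ × ℝ} (hp : p ∈ slab lo hi) :
    closure (slab lo hi) ∈ 𝓝 p :=
  mem_of_superset (S.isOpen.mem_nhds hp) subset_closure

theorem _root_.InternalWave.Separated.differentiableAt (S : Separated lo hi z₀)
    {f : ℝ × ℝ × ℝ → ℝ} (hf : ContDiffOn ℝ 1 f (closure (slab lo hi))) {p : ℝ × ℝ × ℝ}
    (hp : p ∈ slab lo hi) : DifferentiableAt ℝ f p :=
  ((hf p (subset_closure hp)).contDiffAt (mem_nhds S hp)).differentiableAt one_ne_zero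

theorem vort_x (S : Layer F lo hi z₀ ρ g β M) {p : ℝ × ℝ × ℝ} (hp : p ∈ slab lo hi) :
    dy F.w p = dz F.v p := by
  have := congrArg Prod.fst (S.vort p hp)
  exact sub_eq_zero.1 this

theorem vort_y (S : Layer F lo hi z₀ ρ g β M) {p : ℝ × ℝ × ℝ} (hp : p ∈ slab lo hi) :
    dz F.u p = β + dx F.w p := by
  have := congrArg (fun q => q.2.1) (S.vort p hp)
  exact sub_eq_iff_eq_add.1 this

theorem vort_z (S : Layer F lo hi z₀ ρ g β M) {p : ℝ × ℝ × ℝ} (hp : p ∈ slab lo hi) :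
    dx F.v p = dy F.u p := by
  have := congrArg (fun q => q.2.2) (S.vort p hp)
  exact sub_eq_zero.1 this

theorem contDiffOn_head (S : Layer F lo hi z₀ ρ g β M) :
    ContDiffOn ℝ 1 (F.head ρ g) (closure (slab lo hi)) := by
  have h1 := S.C1.u
  have h2 := S.C1.v
  have h3 := S.C1.w
  have h4 := S.C1.P
  unfold Fluid.head
  fun_prop

/-- Euler's equations in Lamb's form: ∇H = u × ω, with ω = (0, β, 0). -/
theorem hasFDerivAt_head (S : Layer F lo hi z₀ ρ g β M) {p : ℝ × ℝ × ℝ} (hp : p ∈ slab lo hi) :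
    HasFDerivAt (F.head ρ g) (covector (-β * F.w p) 0 (β * F.u p)) p := by
  have hu := hasFDerivAt_covector (S.differentiableAt S.C1.u hp)
  have hv := hasFDerivAt_covector (S.differentiableAt S.C1.v hp)
  have hw := hasFDerivAt_covector (S.differentiableAt S.C1.w hp)
  have hP := hasFDerivAt_covector (S.differentiableAt S.C1.P hp)
  have hz : HasFDerivAt (fun p : ℝ × ℝ × ℝ => p.2.2) (covector 0 0 1) p := by
    have : (covector 0 0 1 : ℝ × ℝ × ℝ → ℝ) = fun p => p.2.2 := by
      ext; simp [covector_apply]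
    rw [← this]
    exact (covector 0 0 1).hasFDerivAt
  have h := ((hP.mul_const ρ⁻¹).add (hz.const_mul g)).add
    ((((hu.pow 2).add (hv.pow 2)).add (hw.pow 2)).mul_const 2⁻¹)
  have hρ := S.ρ_pos.ne'
  refine (h.congr_fderiv ?_).congr_of_eventuallyEq (.of_forall fun q => ?_)
  · have e1 := S.euler.momentum_x p hp
    have e2 := S.euler.momentum_y p hp
    have e3 := S.euler.momentum_z p hp
    have w1 := S.vort_x hp
    have w2 := S.vort_y hp
    have w3 := S.vort_z hp
    have hP1 : dx F.P p = -(ρ * (F.u p * dx F.u p + F.v p * dy F.u p + F.w p * dz F.u p)) := by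
      linarith
    have hP2 : dy F.P p = -(ρ * (F.u p * dx F.v p + F.v p * dy F.v p + F.w p * dz F.v p)) := by
      linarith
    have hP3 : dz F.P p = -(ρ * (F.u p * dx F.w p + F.v p * dy F.w p + F.w p * dz F.w p))
      - ρ * g := by linarith
    refine (eq_covector _).trans ?_
    congr 1
    all_goals
      simp only [add_apply, smul_apply, covector_apply,
        smul_eq_mul, mul_one, mul_zero, add_zero, zero_add, hP1, hP2, hP3, w1, w2, w3]
      field_simp
      ring
  · simp only [Fluid.head, Pi.add_apply]
    ring

/-- The velocity is only C¹, so the curl of the Euler equations is not available classically. But ∇H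
is β times the differentiable field (-w, 0, u), and the second derivative of H is symmetric. -/
theorem fderiv_symm (S : Layer F lo hi z₀ ρ g β M) {p : ℝ × ℝ × ℝ} (hp : p ∈ slab lo hi)
    (h k : ℝ × ℝ × ℝ) :
    -fderiv ℝ F.w p h * k.1 + fderiv ℝ F.u p h * k.2.2
      = -fderiv ℝ F.w p k * h.1 + fderiv ℝ F.u p k * h.2.2 := by
  have hu := (S.differentiableAt S.C1.u hp).hasFDerivAt
  have hw := (S.differentiableAt S.C1.w hp).hasFDerivAt
  have hL : HasFDerivAt (fun q => covector (-β * F.w q) 0 (β * F.u q))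
      ((-β • fderiv ℝ F.w p).smulRight (covector 1 0 0)
        + (β • fderiv ℝ F.u p).smulRight (covector 0 0 1)) p := by
    have h1 := (hw.const_mul (-β)).smul_const (covector 1 0 0)
    have h2 := (hu.const_mul β).smul_const (covector 0 0 1)
    refine (h1.add h2).congr_of_eventuallyEq (.of_forall fun q => ?_)
    refine ContinuousLinearMap.ext fun v => ?_
    simp [covector_apply]
  have := second_derivative_symmetric_of_eventually_of_real (f := F.head ρ g)
    (f' := fun q => covector (-β * F.w q) 0 (β * F.u q)) (x := p)
    (by
      filter_upwards [S.isOpen.mem_nhds hp] with q hq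
      exact S.hasFDerivAt_head hq) hL h k
  simp only [add_apply, ContinuousLinearMap.smulRight_apply,
    smul_apply, covector_apply, smul_eq_mul] at this
  refine mul_left_cancel₀ S.β_ne ?_
  linear_combination this

theorem dy_u (S : Layer F lo hi z₀ ρ g β M) {p : ℝ × ℝ × ℝ} (hp : p ∈ slab lo hi) :
    dy F.u p = 0 := by
  have := S.fderiv_symm hp (0, 1, 0) (0, 0, 1)
  simpa [dy] using this

theorem dy_w (S : Layer F lo hi z₀ ρ g β M) {p : ℝ × ℝ × ℝ} (hp : p ∈ slab lo hi) :
    dy F.w p = 0 := by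
  have := S.fderiv_symm hp (0, 1, 0) (1, 0, 0)
  simpa [dy] using this

theorem dz_w (S : Layer F lo hi z₀ ρ g β M) {p : ℝ × ℝ × ℝ} (hp : p ∈ slab lo hi) :
    dz F.w p = -dx F.u p := by
  have := S.fderiv_symm hp (1, 0, 0) (0, 0, 1)
  simp only [mul_zero, mul_one, add_zero, zero_add] at this
  rw [dz, dx, this, neg_neg]

/-- Every partial derivative of v vanishes: two by irrotationality in x and z, the third because
incompressibility loses u_x + w_z = 0. -/
theorem v_eq (S : Layer F lo hi z₀ ρ g β M) {p : ℝ × ℝ × ℝ} (hp : p ∈ closure (slab lo hi)) :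
    F.v p = F.v (0, 0, z₀) := by
  have hin (q) (hq : q ∈ slab lo hi) : F.v q = F.v (0, 0, z₀) := by
    refine S.eq_of_fderiv_eq_zero (fun p hp => ?_) hq
    have hv := hasFDerivAt_covector (S.differentiableAt S.C1.v hp)
    have h1 : dx F.v p = 0 := by rw [S.vort_z hp, S.dy_u hp]
    have h2 : dz F.v p = 0 := by rw [← S.vort_x hp, S.dy_w hp]
    have h3 : dy F.v p = 0 := by
      have := S.euler.incompressible p hp
      rw [S.dz_w hp] at this
      linarith
    rw [h1, h2, h3] at hv
    refine hv.congr_fderiv ?_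
    ext <;> simp [covector_apply]
  exact ((S.C1.v.continuousOn p hp).mono subset_closure).eq_const_of_mem_closure hp hin

end Layer


/-! ### Reduction of a layer to a vertical plane. -/

/-- A plane set containing a horizontal line and, with each point, the vertical segment to that
line is preconnected. -/
theorem isPreconnected_of_segment_subset {S : Set ℂ} {z₀ : ℝ} (hline : ∀ ζ : ℂ, ζ.im = z₀ → ζ ∈ S)
    (hseg : ∀ ζ ∈ S, segment ℝ ⟨ζ.re, z₀⟩ ζ ⊆ S) : IsPreconnected S := by
  refine isPreconnected_of_forall (⟨0, z₀⟩ : ℂ) fun ζ hζ => ?_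
  refine ⟨{w | w.im = z₀} ∪ segment ℝ ⟨ζ.re, z₀⟩ ζ, union_subset hline (hseg ζ hζ),
    Or.inl rfl, Or.inr (right_mem_segment ℝ _ _), ?_⟩
  refine IsPreconnected.union (⟨ζ.re, z₀⟩ : ℂ) rfl (left_mem_segment ℝ _ _) ?_
    (convex_segment _ _).isPreconnected
  have : Convex ℝ {w : ℂ | w.im = z₀} := by
    intro a ha b hb s t _ _ hst
    have ha : a.im = z₀ := ha
    have hb : b.im = z₀ := hb
    show (s • a + t • b).im = z₀
    simp [ha, hb, ← add_mul, hst]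
  exact this.isPreconnected

/-- The point of the vertical plane with abscissa `y` over a complex number. -/
def lift (y : ℝ) (ζ : ℂ) : ℝ × ℝ × ℝ := (ζ.re, y, ζ.im)

/-- The derivative of `lift y`. -/
noncomputable def liftCLM : ℂ →L[ℝ] ℝ × ℝ × ℝ :=
  Complex.reCLM.prod ((0 : ℂ →L[ℝ] ℝ).prod Complex.imCLM)

theorem hasFDerivAt_lift (y : ℝ) (ζ : ℂ) : HasFDerivAt (lift y) liftCLM ζ :=
  Complex.reCLM.hasFDerivAt.prodMk ((hasFDerivAt_const y ζ).prodMk Complex.imCLM.hasFDerivAt)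

theorem continuous_lift (y : ℝ) : Continuous (lift y) :=
  continuous_iff_continuousAt.2 fun ζ => (hasFDerivAt_lift y ζ).continuousAt

/-- The projection of a slab to the vertical plane. -/
def proj (lo hi : ℝ × ℝ → ℝ) : Set ℂ := {ζ | ∃ y, lift y ζ ∈ slab lo hi}

open Classical in
/-- The function of `x + i z` given by a function of `(x, y, z)` on the closed slab which does not
depend on `y`. -/
noncomputable def flatten (lo hi : ℝ × ℝ → ℝ) (φ : ℝ × ℝ × ℝ → ℝ) (ζ : ℂ) : ℝ :=
  if h : ∃ y, lift y ζ ∈ closure (slab lo hi) then φ (lift h.choose ζ) else 0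

namespace Separated

variable {lo hi : ℝ × ℝ → ℝ} {z₀ : ℝ}

theorem lift_segment (S : Separated lo hi z₀) {y : ℝ} {ζ w : ℂ} (hζ : lift y ζ ∈ slab lo hi)
    (hw : w ∈ segment ℝ ⟨ζ.re, z₀⟩ ζ) : lift y w ∈ slab lo hi := by
  obtain ⟨s, t, hs, ht, hst, rfl⟩ := hw
  have : lift y (s • (⟨ζ.re, z₀⟩ : ℂ) + t • ζ) = (ζ.re, y, s * z₀ + t * ζ.im) := by
    simp [lift, ← add_mul, hst]
  rw [this]
  exact ⟨convex_Ioi (lo (ζ.re, y)) (S.lo_lt _) hζ.1 hs ht hst,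
    convex_Iio (hi (ζ.re, y)) (S.lt_hi _) hζ.2 hs ht hst⟩

theorem isOpen_preimage_lift (S : Separated lo hi z₀) (y : ℝ) : IsOpen (lift y ⁻¹' slab lo hi) :=
  S.isOpen.preimage (continuous_lift y)

theorem isOpen_proj (S : Separated lo hi z₀) : IsOpen (proj lo hi) := by
  have : proj lo hi = ⋃ y, lift y ⁻¹' slab lo hi := by
    ext ζ; simp [proj]
  rw [this]
  exact isOpen_iUnion fun y => S.isOpen_preimage_lift y

theorem lift_plane (S : Separated lo hi z₀) (y : ℝ) {ζ : ℂ} (h : ζ.im = z₀) :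
    lift y ζ ∈ slab lo hi := by
  rw [lift, h]
  exact S.mem_plane _ _

theorem isPreconnected_proj (S : Separated lo hi z₀) : IsPreconnected (proj lo hi) :=
  isPreconnected_of_segment_subset (fun _ h => ⟨0, S.lift_plane 0 h⟩)
    fun _ ⟨y, hy⟩ _ hw => ⟨y, S.lift_segment hy hw⟩

theorem eq_flatten (S : Separated lo hi z₀) {φ : ℝ × ℝ × ℝ → ℝ}
    (hφ : ContinuousOn φ (closure (slab lo hi)))
    (heq : ∀ y y' ζ, lift y ζ ∈ slab lo hi → lift y' ζ ∈ slab lo hi → φ (lift y ζ) = φ (lift y' ζ))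
    {y : ℝ} {ζ : ℂ} (h : lift y ζ ∈ closure (slab lo hi)) : φ (lift y ζ) = flatten lo hi φ ζ := by
  have hex : ∃ y, lift y ζ ∈ closure (slab lo hi) := ⟨y, h⟩
  rw [flatten, dif_pos hex]
  exact S.eq_of_eqOn_slab hφ (fun x y y' z h h' => heq y y' ⟨x, z⟩ h h') h hex.choose_spec

end Separated

/-- A function of class `C¹` up to the boundary whose gradient extends continuously to the boundary
has the extension as its one-sided gradient there. -/
theorem hasFDerivWithinAt_closure {E : Type*} [NormedAddCommGroup E] [NormedSpace ℝ E] {s : Set E}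
    {f : E → ℝ} {L : E → E →L[ℝ] ℝ} (hs : IsOpen s) (hf : ContDiffOn ℝ 1 f (closure s))
    (hL : ContinuousOn L (closure s)) (hd : ∀ x ∈ s, HasFDerivAt f (L x) x) {x : E}
    (hx : x ∈ closure s) : HasFDerivWithinAt f (L x) (closure s) x := by
  have h1 := hf x hx
  -- Being C¹ within the closure provides a one-sided derivative continuous at `x`. Inside `s` it is
  -- `L`, so the two agree at `x` as limits.
  rw [← zero_add (1 : WithTop ℕ∞), contDiffWithinAt_succ_iff_hasFDerivWithinAt' (by simp)] at h1
  obtain ⟨t, ht, -, -, f', hf', hc⟩ := h1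
  rw [insert_eq_of_mem hx] at ht
  have hxt : x ∈ t := mem_of_mem_nhdsWithin hx ht
  have hne : (𝓝[s] x).NeBot := mem_closure_iff_nhdsWithin_neBot.1 hx
  have hlim1 : Tendsto f' (𝓝[s] x) (𝓝 (f' x)) :=
    hc.continuousWithinAt.tendsto.mono_left (nhdsWithin_mono _ subset_closure)
  have hlim2 : Tendsto L (𝓝[s] x) (𝓝 (L x)) :=
    (hL x hx).tendsto.mono_left (nhdsWithin_mono _ subset_closure)
  have heq : L x = f' x := by
    refine tendsto_nhds_unique hlim2 (hlim1.congr' ?_)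
    filter_upwards [nhdsWithin_mono _ subset_closure ht, self_mem_nhdsWithin] with q hq hqs
    exact ((hf' q hq).hasFDerivAt (mem_of_superset (hs.mem_nhds hqs) subset_closure)).unique
      (hd q hqs)
  rw [heq]
  exact hf' x hxt

namespace Layer

variable {F : Fluid} {lo hi : ℝ × ℝ → ℝ} {z₀ ρ g β M : ℝ}

/-- The complex velocity on a vertical slice, with the mean shear removed. -/
noncomputable def slice (F : Fluid) (β y : ℝ) (ζ : ℂ) : ℂ :=
  ⟨F.u (lift y ζ) - β * ζ.im, -F.w (lift y ζ)⟩

/-- The relations u_z - β = w_x and u_x = -w_z are the Cauchy–Riemann equations. -/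
theorem differentiableAt_slice (S : Layer F lo hi z₀ ρ g β M) {y : ℝ} {ζ : ℂ}
    (h : lift y ζ ∈ slab lo hi) : DifferentiableAt ℂ (slice F β y) ζ := by
  have hu := (hasFDerivAt_covector (S.differentiableAt S.C1.u h)).comp ζ (hasFDerivAt_lift y ζ)
  have hw := (hasFDerivAt_covector (S.differentiableAt S.C1.w h)).comp ζ (hasFDerivAt_lift y ζ)
  have h1 := (Complex.ofRealCLM.hasFDerivAt.comp ζ
    (hu.sub (Complex.imCLM.hasFDerivAt.const_mul β))).sub
    ((Complex.ofRealCLM.hasFDerivAt.comp ζ hw).const_mul Complex.I)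
  have hs : slice F β y = (fun ζ => ((F.u (lift y ζ) - β * ζ.im : ℝ) : ℂ)
      - Complex.I * (F.w (lift y ζ) : ℂ)) := by
    funext w
    apply Complex.ext <;> simp [slice]
  have h2 : HasFDerivAt (slice F β y) _ ζ := h1.congr_of_eventuallyEq (.of_forall fun w => by
    rw [hs]; rfl)
  refine differentiableAt_complex_iff_differentiableAt_real.2 ⟨h2.differentiableAt, ?_⟩
  rw [h2.fderiv]
  apply Complex.ext
  · simp [liftCLM, covector_apply, S.vort_y h]
  · simp [liftCLM, covector_apply, S.dz_w h]

theorem analyticOnNhd_slice (S : Layer F lo hi z₀ ρ g β M) (y : ℝ) :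
    AnalyticOnNhd ℂ (slice F β y) (lift y ⁻¹' slab lo hi) :=
  DifferentiableOn.analyticOnNhd (fun _ hζ => (S.differentiableAt_slice hζ).differentiableWithinAt)
    (S.isOpen_preimage_lift y)

theorem eq_on_plane (S : Separated lo hi z₀) {f : ℝ × ℝ × ℝ → ℝ}
    (hd : ∀ p ∈ slab lo hi, DifferentiableAt ℝ f p) (hy : ∀ p ∈ slab lo hi, dy f p = 0)
    (x y y' : ℝ) : f (x, y, z₀) = f (x, y', z₀) := by
  have h1 (t : ℝ) : HasDerivAt (fun t => f (x, t, z₀)) 0 t := by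
    have hl : HasDerivAt (fun t : ℝ => ((x, t, z₀) : ℝ × ℝ × ℝ)) (0, 1, 0) t :=
      (hasDerivAt_const t x).prodMk ((hasDerivAt_id t).prodMk (hasDerivAt_const t z₀))
    have := (hd _ (S.mem_plane x t)).hasFDerivAt.comp_hasDerivAt t hl
    refine this.congr_deriv (hy _ (S.mem_plane x t))
  exact is_const_of_deriv_eq_zero (fun t => (h1 t).differentiableAt) (fun t => (h1 t).deriv) y y'

/-- A segment in the y-direction may leave the layer, so u_y = w_y = 0 does not suffice directly.
The slices agree on the line z = z₀, which always lies inside, and the identity theorem extends this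
to the connected common domain. -/
theorem slice_eq (S : Layer F lo hi z₀ ρ g β M) {y y' : ℝ} {ζ : ℂ} (h : lift y ζ ∈ slab lo hi)
    (h' : lift y' ζ ∈ slab lo hi) : slice F β y ζ = slice F β y' ζ := by
  have hpre : IsPreconnected (lift y ⁻¹' slab lo hi ∩ lift y' ⁻¹' slab lo hi) :=
    isPreconnected_of_segment_subset (fun _ h => ⟨S.lift_plane y h, S.lift_plane y' h⟩)
      fun _ hζ _ hw => ⟨S.lift_segment hζ.1 hw, S.lift_segment hζ.2 hw⟩
  refine AnalyticOnNhd.eqOn_of_preconnected_of_frequently_eq (z₀ := ⟨0, z₀⟩)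
    ((S.analyticOnNhd_slice y).mono inter_subset_left)
    ((S.analyticOnNhd_slice y').mono inter_subset_right) hpre
    ⟨S.lift_plane y rfl, S.lift_plane y' rfl⟩ ?_ ⟨h, h'⟩
  have hline (t : ℝ) : slice F β y ⟨t, z₀⟩ = slice F β y' ⟨t, z₀⟩ := by
    have h1 := eq_on_plane S.toSeparated (fun p hp => S.differentiableAt S.C1.u hp)
      (fun p hp => S.dy_u hp) t y y'
    have h2 := eq_on_plane S.toSeparated (fun p hp => S.differentiableAt S.C1.w hp)
      (fun p hp => S.dy_w hp) t y y'
    simp only [slice, lift, h1, h2]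
  have htend : Tendsto (fun t : ℝ => (⟨t, z₀⟩ : ℂ)) (𝓝[>] 0) (𝓝[≠] ⟨0, z₀⟩) := by
    refine tendsto_nhdsWithin_iff.2 ⟨?_, ?_⟩
    · have : Continuous fun t : ℝ => (⟨t, z₀⟩ : ℂ) := by
        have : (fun t : ℝ => (⟨t, z₀⟩ : ℂ)) = fun t : ℝ => (t : ℂ) + z₀ * Complex.I := by
          funext t; apply Complex.ext <;> simp
        rw [this]; fun_prop
      exact (this.tendsto 0).mono_left nhdsWithin_le_nhds
    · filter_upwards [self_mem_nhdsWithin] with t ht h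
      exact (ne_of_gt ht) (congrArg Complex.re h)
  exact htend.frequently (Eventually.frequently (.of_forall hline))

theorem u_lift_eq (S : Layer F lo hi z₀ ρ g β M) (y y' : ℝ) (ζ : ℂ) (h : lift y ζ ∈ slab lo hi)
    (h' : lift y' ζ ∈ slab lo hi) : F.u (lift y ζ) = F.u (lift y' ζ) := by
  simpa [slice] using congrArg Complex.re (S.slice_eq h h')

theorem w_lift_eq (S : Layer F lo hi z₀ ρ g β M) (y y' : ℝ) (ζ : ℂ) (h : lift y ζ ∈ slab lo hi)
    (h' : lift y' ζ ∈ slab lo hi) : F.w (lift y ζ) = F.w (lift y' ζ) := by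
  simpa [slice] using congrArg Complex.im (S.slice_eq h h')

theorem head_lift_eq (S : Layer F lo hi z₀ ρ g β M) (y y' : ℝ) (ζ : ℂ) (h : lift y ζ ∈ slab lo hi)
    (h' : lift y' ζ ∈ slab lo hi) : F.head ρ g (lift y ζ) = F.head ρ g (lift y' ζ) := by
  have hd (w : ℂ) (hw : w ∈ segment ℝ ⟨ζ.re, z₀⟩ ζ) :
      HasFDerivWithinAt (fun w => F.head ρ g (lift y w) - F.head ρ g (lift y' w)) (0 : ℂ →L[ℝ] ℝ)
        (segment ℝ ⟨ζ.re, z₀⟩ ζ) w := by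
    have m1 := S.lift_segment h hw
    have m2 := S.lift_segment h' hw
    have h1 := (S.hasFDerivAt_head m1).comp w (hasFDerivAt_lift y w)
    have h2 := (S.hasFDerivAt_head m2).comp w (hasFDerivAt_lift y' w)
    refine ((h1.sub h2).congr_fderiv ?_).hasFDerivWithinAt
    rw [S.u_lift_eq y y' w m1 m2, S.w_lift_eq y y' w m1 m2, sub_self]
  have := (convex_segment _ _).norm_image_sub_le_of_norm_hasFDerivWithin_le (C := 0) hd (by simp)
    (left_mem_segment ℝ _ _) (right_mem_segment ℝ _ _)
  rw [zero_mul, norm_le_zero_iff] at this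
  have h0 : F.head ρ g (lift y ⟨ζ.re, z₀⟩) = F.head ρ g (lift y' ⟨ζ.re, z₀⟩) :=
    eq_on_plane S.toSeparated (fun p hp => (S.hasFDerivAt_head hp).differentiableAt)
      (fun p hp => by rw [dy, (S.hasFDerivAt_head hp).fderiv, covector_apply]; simp) ζ.re y y'
  linarith

end Layer


/-- A layer whose motion is expressed through functions of `ζ = x + i z`: the complex velocity is
`f` up to the shear `β z`, the stream function is `Ψ`, and the transverse velocity is `V`. -/
structure PlanarLayer (F : Fluid) (lo hi : ℝ × ℝ → ℝ) (z₀ ρ g β M : ℝ) (f : ℂ → ℂ) (Ψ : ℂ → ℝ)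
    (V : ℝ) : Prop extends Layer F lo hi z₀ ρ g β M where
  u_eq : ∀ y ζ, lift y ζ ∈ closure (slab lo hi) → F.u (lift y ζ) = (f ζ).re + β * ζ.im
  w_eq : ∀ y ζ, lift y ζ ∈ closure (slab lo hi) → F.w (lift y ζ) = -(f ζ).im
  v_eq_const : ∀ p ∈ closure (slab lo hi), F.v p = V
  head_eq : ∀ y ζ, lift y ζ ∈ closure (slab lo hi) → F.head ρ g (lift y ζ) = β * Ψ ζ

theorem Layer.exists_planarLayer {F : Fluid} {lo hi : ℝ × ℝ → ℝ} {z₀ ρ g β M : ℝ}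
    (S : Layer F lo hi z₀ ρ g β M) : ∃ f Ψ V, PlanarLayer F lo hi z₀ ρ g β M f Ψ V := by
  refine ⟨fun ζ => ⟨flatten lo hi F.u ζ - β * ζ.im, -flatten lo hi F.w ζ⟩,
    fun ζ => flatten lo hi (F.head ρ g) ζ / β, F.v (0, 0, z₀), S, fun y ζ h => ?_, fun y ζ h => ?_,
    fun p hp => S.v_eq hp, fun y ζ h => ?_⟩
  · simp only [sub_add_cancel]
    exact S.eq_flatten S.C1.u.continuousOn S.u_lift_eq h
  · simp only [neg_neg]
    exact S.eq_flatten S.C1.w.continuousOn S.w_lift_eq h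
  · rw [mul_div_cancel₀ _ S.β_ne]
    exact S.eq_flatten S.contDiffOn_head.continuousOn S.head_lift_eq h

namespace PlanarLayer

variable {F : Fluid} {lo hi : ℝ × ℝ → ℝ} {z₀ ρ g β M : ℝ} {f : ℂ → ℂ} {Ψ : ℂ → ℝ} {V : ℝ}

theorem f_eq_slice (S : PlanarLayer F lo hi z₀ ρ g β M f Ψ V) {y : ℝ} {ζ : ℂ}
    (h : lift y ζ ∈ closure (slab lo hi)) : f ζ = Layer.slice F β y ζ := by
  apply Complex.ext
  · simp [Layer.slice, S.u_eq y ζ h]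
  · simp [Layer.slice, S.w_eq y ζ h]

theorem differentiableOn (S : PlanarLayer F lo hi z₀ ρ g β M f Ψ V) :
    DifferentiableOn ℂ f (proj lo hi) := by
  rintro ζ ⟨y, hy⟩
  refine ((S.differentiableAt_slice hy).congr_of_eventuallyEq ?_).differentiableWithinAt
  filter_upwards [(S.isOpen_preimage_lift y).mem_nhds hy] with w hw
  exact S.f_eq_slice (subset_closure hw)

theorem hasFDerivAt_stream (S : PlanarLayer F lo hi z₀ ρ g β M f Ψ V) {ζ : ℂ}
    (h : ζ ∈ proj lo hi) :
    HasFDerivAt Ψ ((f ζ).im • Complex.reCLM + ((f ζ).re + β * ζ.im) • Complex.imCLM) ζ := by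
  obtain ⟨y, hy⟩ := h
  have h1 := ((S.hasFDerivAt_head hy).comp ζ (hasFDerivAt_lift y ζ)).const_mul β⁻¹
  refine (h1.congr_fderiv ?_).congr_of_eventuallyEq ?_
  · rw [S.u_eq y ζ (subset_closure hy), S.w_eq y ζ (subset_closure hy)]
    refine ContinuousLinearMap.ext fun k => ?_
    have := S.β_ne
    simp [covector_apply, liftCLM]
    field_simp
  · filter_upwards [(S.isOpen_preimage_lift y).mem_nhds hy] with w hw
    rw [Function.comp_apply, S.head_eq y w (subset_closure hw), inv_mul_cancel_left₀ S.β_ne]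

theorem continuousOn (S : PlanarLayer F lo hi z₀ ρ g β M f Ψ V) (y : ℝ) :
    ContinuousOn f (lift y ⁻¹' closure (slab lo hi)) := by
  have hl := (continuous_lift y).continuousOn (s := lift y ⁻¹' closure (slab lo hi))
  have hu := S.C1.u.continuousOn.comp hl fun _ h => h
  have hw := S.C1.w.continuousOn.comp hl fun _ h => h
  have h1 : ContinuousOn (fun ζ : ℂ => ((F.u (lift y ζ) - β * ζ.im : ℝ) : ℂ)
      - Complex.I * (F.w (lift y ζ) : ℂ)) (lift y ⁻¹' closure (slab lo hi)) := by
    refine (Complex.continuous_ofReal.comp_continuousOn (hu.sub ?_)).sub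
      (continuousOn_const.mul (Complex.continuous_ofReal.comp_continuousOn hw))
    fun_prop
  refine h1.congr fun ζ hζ => ?_
  rw [S.f_eq_slice hζ]
  apply Complex.ext <;> simp [Layer.slice]

theorem bound_closure (S : PlanarLayer F lo hi z₀ ρ g β M f Ψ V) {p : ℝ × ℝ × ℝ}
    (hp : p ∈ closure (slab lo hi)) : |F.u p| ≤ M ∧ |F.v p| ≤ M ∧ |F.w p| ≤ M := by
  refine ⟨?_, ?_, ?_⟩
  · exact ContinuousWithinAt.closure_le hp
      ((S.C1.u.continuousOn p hp).mono subset_closure).abs continuousWithinAt_const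
      fun q hq => (S.bound q hq).1
  · exact ContinuousWithinAt.closure_le hp
      ((S.C1.v.continuousOn p hp).mono subset_closure).abs continuousWithinAt_const
      fun q hq => (S.bound q hq).2.1
  · exact ContinuousWithinAt.closure_le hp
      ((S.C1.w.continuousOn p hp).mono subset_closure).abs continuousWithinAt_const
      fun q hq => (S.bound q hq).2.2

/-- The pressure as a function on the vertical plane. -/
noncomputable def pressure (ρ g β V : ℝ) (f : ℂ → ℂ) (Ψ : ℂ → ℝ) (ζ : ℂ) : ℝ :=
  ρ * (β * Ψ ζ - g * ζ.im - (((f ζ).re + β * ζ.im) ^ 2 + V ^ 2 + (f ζ).im ^ 2) / 2)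

theorem P_eq (S : PlanarLayer F lo hi z₀ ρ g β M f Ψ V) {y : ℝ} {ζ : ℂ}
    (h : lift y ζ ∈ closure (slab lo hi)) : F.P (lift y ζ) = pressure ρ g β V f Ψ ζ := by
  have h1 := S.head_eq y ζ h
  have hρ := S.ρ_pos.ne'
  rw [Fluid.head, S.u_eq y ζ h, S.w_eq y ζ h, S.v_eq_const _ h] at h1
  rw [pressure, ← h1]
  simp only [lift]
  field_simp
  ring

theorem isPlanarOn (S : PlanarLayer F lo hi z₀ ρ g β M f Ψ V) :
    F.IsPlanarOn (closure (slab lo hi)) := by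
  refine ⟨fun q => (f ⟨q.1, q.2⟩).re + β * q.2, fun q => -(f ⟨q.1, q.2⟩).im,
    fun q => pressure ρ g β V f Ψ ⟨q.1, q.2⟩, V, fun p hp => ?_⟩
  obtain ⟨x, y, z⟩ := p
  exact ⟨S.u_eq y ⟨x, z⟩ hp, S.v_eq_const _ hp, S.w_eq y ⟨x, z⟩ hp, S.P_eq (y := y) (ζ := ⟨x, z⟩) hp⟩

theorem contDiff_trace {φ : ℝ × ℝ × ℝ → ℝ} {Ω : Set (ℝ × ℝ × ℝ)} {η : ℝ × ℝ → ℝ}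
    (hφ : ContDiffOn ℝ 1 φ Ω) (hη : ContDiff ℝ 1 η) (hmem : ∀ q : ℝ × ℝ, (q.1, q.2, η q) ∈ Ω) :
    ContDiff ℝ 1 fun q : ℝ × ℝ => φ (q.1, q.2, η q) := by
  have h1 : ContDiff ℝ 1 fun q : ℝ × ℝ => (q.1, q.2, η q) := by fun_prop
  exact contDiffOn_univ.1 (hφ.comp h1.contDiffOn fun q _ => hmem q)

/-- The gradient of the Bernoulli function along a graph contained in the closed layer. -/
theorem fderiv_head_trace (S : PlanarLayer F lo hi z₀ ρ g β M f Ψ V) {η : ℝ × ℝ → ℝ}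
    (hη : ContDiff ℝ 1 η) (hmem : ∀ q : ℝ × ℝ, (q.1, q.2, η q) ∈ closure (slab lo hi))
    (q k : ℝ × ℝ) :
    fderiv ℝ (fun q : ℝ × ℝ => F.head ρ g (q.1, q.2, η q)) q k
      = -β * F.w (q.1, q.2, η q) * k.1 + β * F.u (q.1, q.2, η q) * fderiv ℝ η q k := by
  have hcov : Continuous fun a : ℝ × ℝ × ℝ => covector a.1 a.2.1 a.2.2 := by
    unfold covector
    fun_prop
  have hL : ContinuousOn (fun p => covector (-β * F.w p) 0 (β * F.u p)) (closure (slab lo hi)) :=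
    hcov.comp_continuousOn ((continuousOn_const.mul S.C1.w.continuousOn).prodMk
      (continuousOn_const.prodMk (continuousOn_const.mul S.C1.u.continuousOn)))
  -- The graph may lie on the boundary of the layer, so the chain rule uses the one-sided gradient.
  have h1 := hasFDerivWithinAt_closure S.isOpen S.contDiffOn_head hL
    (fun p hp => S.hasFDerivAt_head hp) (hmem q)
  have h2 : HasFDerivAt (fun q : ℝ × ℝ => (q.1, q.2, η q))
      ((ContinuousLinearMap.fst ℝ ℝ ℝ).prod ((ContinuousLinearMap.snd ℝ ℝ ℝ).prod
        (fderiv ℝ η q))) q :=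
    hasFDerivAt_fst.prodMk (hasFDerivAt_snd.prodMk
      (hη.differentiable one_ne_zero q).hasFDerivAt)
  have h3 := (HasFDerivWithinAt.comp_hasFDerivAt q h1 h2 (.of_forall hmem)).fderiv
  simp only [Function.comp_def] at h3
  rw [h3]
  simp [covector_apply]

end PlanarLayer


/-! ### Two planar motions with the same pressure. -/

open Complex ComplexConjugate

theorem hasDerivAt_dir {f : ℂ → ℂ} {ζ : ℂ} (hf : DifferentiableAt ℂ f ζ) (h : ℂ) :
    HasDerivAt (fun t : ℝ => f (ζ + t * h)) (deriv f ζ * h) 0 := by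
  have h1 : HasDerivAt (fun t : ℂ => ζ + t * h) h ((0 : ℝ) : ℂ) := by
    simpa using (((hasDerivAt_id ((0 : ℝ) : ℂ)).mul_const h).const_add ζ)
  have h2 : HasDerivAt f (deriv f ζ) (ζ + ((0 : ℝ) : ℂ) * h) := by simpa using hf.hasDerivAt
  exact (h2.comp ((0 : ℝ) : ℂ) h1).comp_ofReal

theorem hasDerivAt_im_dir (ζ h : ℂ) : HasDerivAt (fun t : ℝ => (ζ + t * h).im) h.im 0 := by
  have : (fun t : ℝ => (ζ + t * h).im) = fun t : ℝ => ζ.im + t * h.im := by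
    funext t; simp
  rw [this]
  simpa using ((hasDerivAt_id (0 : ℝ)).mul_const h.im).const_add ζ.im

theorem HasDerivAt.re_comp {c : ℝ → ℂ} {c' : ℂ} {t : ℝ} (h : HasDerivAt c c' t) :
    HasDerivAt (fun t => (c t).re) c'.re t :=
  reCLM.hasFDerivAt.comp_hasDerivAt t h

theorem HasDerivAt.im_comp {c : ℝ → ℂ} {c' : ℂ} {t : ℝ} (h : HasDerivAt c c' t) :
    HasDerivAt (fun t => (c t).im) c'.im t :=
  imCLM.hasFDerivAt.comp_hasDerivAt t h

theorem HasDerivAt.conj_comp {c : ℝ → ℂ} {c' : ℂ} {t : ℝ} (h : HasDerivAt c c' t) :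
    HasDerivAt (fun t => conj (c t)) (conj c') t :=
  conjCLE.toContinuousLinearMap.hasFDerivAt.comp_hasDerivAt t h

theorem HasDerivAt.ofReal_comp_real {c : ℝ → ℝ} {c' : ℝ} {t : ℝ} (h : HasDerivAt c c' t) :
    HasDerivAt (fun t => (c t : ℂ)) (c' : ℂ) t :=
  ofRealCLM.hasFDerivAt.comp_hasDerivAt t h

/-- Functions which agree on an open set have the same directional derivatives there. -/
theorem dir_deriv_unique {E : Type*} [NormedAddCommGroup E] [NormedSpace ℝ E] {D : Set ℂ}
    (hD : IsOpen D) {φ ψ : ℂ → E} (heq : EqOn φ ψ D) {ζ h : ℂ} (hζ : ζ ∈ D) {a b : E}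
    (ha : HasDerivAt (fun t : ℝ => φ (ζ + t * h)) a 0)
    (hb : HasDerivAt (fun t : ℝ => ψ (ζ + t * h)) b 0) : a = b := by
  refine ha.unique (hb.congr_of_eventuallyEq ?_)
  have hc : Continuous fun t : ℝ => ζ + t * h := by fun_prop
  have : ∀ᶠ t : ℝ in 𝓝 0, ζ + t * h ∈ D :=
    hc.continuousAt.eventually (hD.mem_nhds (by simpa using hζ))
  filter_upwards [this] with t ht
  exact heq ht

/-- The conjugate complex velocity `U + i W`. -/
noncomputable def conjVel (β : ℝ) (f : ℂ → ℂ) (ζ : ℂ) : ℂ := conj (f ζ) + (β * ζ.im : ℝ)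

theorem hasDerivAt_conjVel {β : ℝ} {f : ℂ → ℂ} {ζ : ℂ} (hf : DifferentiableAt ℂ f ζ) (h : ℂ) :
    HasDerivAt (fun t : ℝ => conjVel β f (ζ + t * h)) (conj (deriv f ζ * h) + (β * h.im : ℝ)) 0 :=
  (HasDerivAt.conj_comp (hasDerivAt_dir hf h)).add
    (HasDerivAt.ofReal_comp_real ((hasDerivAt_im_dir ζ h).const_mul β))

/-- A complex velocity which vanishes on an open set has no vorticity. -/
theorem eq_zero_of_conjVel_eq_zero {D : Set ℂ} (hD : IsOpen D) {β : ℝ} {f : ℂ → ℂ}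
    (hf : DifferentiableOn ℂ f D) (h0 : ∀ ζ ∈ D, conjVel β f ζ = 0) (hne : D.Nonempty) : β = 0 := by
  obtain ⟨ζ, hζ⟩ := hne
  have hd := hf.differentiableAt (hD.mem_nhds hζ)
  have heq : EqOn (conjVel β f) (fun _ => 0) D := h0
  have h1 := dir_deriv_unique hD heq hζ (hasDerivAt_conjVel hd 1) (hasDerivAt_const _ _)
  have h2 := dir_deriv_unique hD heq hζ (hasDerivAt_conjVel hd I) (hasDerivAt_const _ _)
  simp only [mul_one, one_im, mul_zero, ofReal_zero, add_zero, map_mul, conj_I, I_im] at h1 h2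
  rw [h1, zero_mul, zero_add] at h2
  exact_mod_cast h2

/-- A holomorphic complex velocity with its stream function. -/
structure HasStream (D : Set ℂ) (β : ℝ) (f : ℂ → ℂ) (Ψ : ℂ → ℝ) : Prop where
  holo : DifferentiableOn ℂ f D
  stream : ∀ ζ ∈ D, HasFDerivAt Ψ ((f ζ).im • reCLM + ((f ζ).re + β * ζ.im) • imCLM) ζ

theorem HasStream.hasDerivAt_pressure {D : Set ℂ} (hD : IsOpen D) {β : ℝ} {f : ℂ → ℂ} {Ψ : ℂ → ℝ}
    (S : HasStream D β f Ψ) (ρ g V : ℝ) {ζ : ℂ} (hζ : ζ ∈ D) (h : ℂ) :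
    HasDerivAt (fun t : ℝ => PlanarLayer.pressure ρ g β V f Ψ (ζ + t * h))
      (ρ * (β * ((f ζ).im * h.re + ((f ζ).re + β * ζ.im) * h.im) - g * h.im
        - (((f ζ).re + β * ζ.im) * ((deriv f ζ * h).re + β * h.im)
          + (f ζ).im * (deriv f ζ * h).im))) 0 := by
  have hf := hasDerivAt_dir (S.holo.differentiableAt (hD.mem_nhds hζ)) h
  have hre := HasDerivAt.re_comp hf
  have him := HasDerivAt.im_comp hf
  have hz := hasDerivAt_im_dir ζ h
  have hpath : HasDerivAt (fun t : ℝ => ζ + t * h) h 0 := by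
    have := hasDerivAt_dir (f := fun w => w) (ζ := ζ) differentiableAt_id h
    simpa using this
  have hΨ : HasDerivAt (fun t : ℝ => Ψ (ζ + t * h))
      ((f ζ).im * h.re + ((f ζ).re + β * ζ.im) * h.im) 0 := by
    have h0 : HasFDerivAt Ψ ((f ζ).im • reCLM + ((f ζ).re + β * ζ.im) • imCLM)
      (ζ + ((0 : ℝ) : ℂ) * h) := by simpa using S.stream ζ hζ
    exact (h0.comp_hasDerivAt 0 hpath).congr_deriv (by simp)
  have := (((hΨ.const_mul β).sub (hz.const_mul g)).sub
    (((((hre.add (hz.const_mul β)).pow 2).add_const (V ^ 2)).add (him.pow 2)).div_const 2)).const_mul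
    ρ
  refine this.congr_deriv ?_
  simp only [ofReal_zero, zero_mul, add_zero, Pi.add_apply, Nat.add_one_sub_one, pow_one,
    Nat.cast_ofNat]
  ring

/-- The complex pressure gradient, up to sign and gravity. -/
noncomputable def momentum (β : ℝ) (f : ℂ → ℂ) (ζ : ℂ) : ℂ :=
  conjVel β f ζ * deriv f ζ - (β * (f ζ).im : ℝ)

theorem hasDerivAt_momentum {D : Set ℂ} (hD : IsOpen D) {β : ℝ} {f : ℂ → ℂ}
    (hf : DifferentiableOn ℂ f D) {ζ : ℂ} (hζ : ζ ∈ D) (h : ℂ) :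
    HasDerivAt (fun t : ℝ => momentum β f (ζ + t * h))
      ((conj (deriv f ζ * h) + (β * h.im : ℝ)) * deriv f ζ
        + conjVel β f ζ * (deriv (deriv f) ζ * h) - (β * (deriv f ζ * h).im : ℝ)) 0 := by
  have hd := hf.differentiableAt (hD.mem_nhds hζ)
  have hd2 := (hf.deriv hD).differentiableAt (hD.mem_nhds hζ)
  have h1 := ((hasDerivAt_conjVel (β := β) hd h).mul (hasDerivAt_dir hd2 h)).sub
    (HasDerivAt.ofReal_comp_real ((HasDerivAt.im_comp (hasDerivAt_dir hd h)).const_mul β))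
  refine h1.congr_deriv ?_
  simp

section Overlap

variable {D : Set ℂ} {ρ₁ ρ₂ g β₁ β₂ V₁ V₂ : ℝ} {f₁ f₂ : ℂ → ℂ} {Ψ₁ Ψ₂ : ℂ → ℝ}

theorem momentum_eq (hD : IsOpen D) (S₁ : HasStream D β₁ f₁ Ψ₁) (S₂ : HasStream D β₂ f₂ Ψ₂)
    (hP : EqOn (PlanarLayer.pressure ρ₁ g β₁ V₁ f₁ Ψ₁) (PlanarLayer.pressure ρ₂ g β₂ V₂ f₂ Ψ₂) D)
    {ζ : ℂ} (hζ : ζ ∈ D) :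
    (ρ₁ : ℂ) * (momentum β₁ f₁ ζ - g * I) = ρ₂ * (momentum β₂ f₂ ζ - g * I) := by
  have h1 := dir_deriv_unique hD hP hζ (S₁.hasDerivAt_pressure hD ρ₁ g V₁ hζ 1)
    (S₂.hasDerivAt_pressure hD ρ₂ g V₂ hζ 1)
  have h2 := dir_deriv_unique hD hP hζ (S₁.hasDerivAt_pressure hD ρ₁ g V₁ hζ I)
    (S₂.hasDerivAt_pressure hD ρ₂ g V₂ hζ I)
  simp only [one_re, one_im, I_re, I_im, mul_one, mul_zero, add_zero, zero_add, sub_zero, mul_re,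
    mul_im, zero_sub] at h1 h2
  apply Complex.ext
  · simp only [momentum, conjVel, mul_re, mul_im, sub_re, sub_im, add_re, add_im, conj_re, conj_im,
      ofReal_re, ofReal_im, I_re, I_im]
    linear_combination -h1
  · simp only [momentum, conjVel, mul_re, mul_im, sub_re, sub_im, add_re, add_im, conj_re, conj_im,
      ofReal_re, ofReal_im, I_re, I_im]
    linear_combination h2

/-- Apply the Wirtinger derivative (∂_x - i∂_z)/2 to `momentum_eq`. Since conj f is antiholomorphic,
the terms in β cancel and only u + iw times f'' remains on each side. -/
theorem conjVel_mul_deriv2_eq (hD : IsOpen D) (S₁ : HasStream D β₁ f₁ Ψ₁)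
    (S₂ : HasStream D β₂ f₂ Ψ₂)
    (hP : EqOn (PlanarLayer.pressure ρ₁ g β₁ V₁ f₁ Ψ₁) (PlanarLayer.pressure ρ₂ g β₂ V₂ f₂ Ψ₂) D)
    {ζ : ℂ} (hζ : ζ ∈ D) :
    (ρ₁ : ℂ) * (conjVel β₁ f₁ ζ * deriv (deriv f₁) ζ)
      = ρ₂ * (conjVel β₂ f₂ ζ * deriv (deriv f₂) ζ) := by
  have heq : EqOn (fun ζ => (ρ₁ : ℂ) * (momentum β₁ f₁ ζ - g * I))
      (fun ζ => (ρ₂ : ℂ) * (momentum β₂ f₂ ζ - g * I)) D := fun w hw =>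
    momentum_eq hD S₁ S₂ hP hw
  have hdir (h : ℂ) := dir_deriv_unique hD heq hζ (h := h)
    (((hasDerivAt_momentum hD S₁.holo hζ h).sub_const _).const_mul _)
    (((hasDerivAt_momentum hD S₂.holo hζ h).sub_const _).const_mul _)
  have h1 := hdir 1
  have h2 := hdir I
  have e1 (a : ℂ) : (((a * I).im : ℝ) : ℂ) = (a.re : ℂ) := by simp
  have e2 (a : ℂ) : (a.re : ℂ) = a - a.im * I := by
    rw [eq_sub_iff_add_eq, re_add_im]
  simp only [mul_one, one_im, mul_zero, ofReal_zero, add_zero, map_mul, conj_I, I_im, ofReal_mul,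
    e1, e2] at h1 h2
  linear_combination (1 / 2) * h1 - (I / 2) * h2 +
    (1 / 2 * (ρ₁ * (conjVel β₁ f₁ ζ * deriv (deriv f₁) ζ - conj (deriv f₁ ζ) * deriv f₁ ζ
        + β₁ * (deriv f₁ ζ).im)
      - ρ₂ * (conjVel β₂ f₂ ζ * deriv (deriv f₂) ζ - conj (deriv f₂ ζ) * deriv f₂ ζ
        + β₂ * (deriv f₂ ζ).im))) * I_mul_I

theorem deriv_congr_of_eqOn {D : Set ℂ} (hD : IsOpen D) {φ ψ : ℂ → ℂ} (h : EqOn φ ψ D) :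
    EqOn (deriv φ) (deriv ψ) D := fun _ hζ =>
  Filter.EventuallyEq.deriv_eq (h.eventuallyEq_of_mem (hD.mem_nhds hζ))

/-- Two sheared complex velocities which differ by a holomorphic factor are proportional. -/
theorem factor_eq_const (hD : IsOpen D) (hβ₂ : β₂ ≠ 0) (h₁ : DifferentiableOn ℂ f₁ D)
    (h₂ : DifferentiableOn ℂ f₂ D) {m : ℂ → ℂ} (hm : DifferentiableOn ℂ m D)
    (hconj : ∀ ζ ∈ D, conjVel β₁ f₁ ζ = m ζ * conjVel β₂ f₂ ζ)
    (hzero : ∀ ζ ∈ D, deriv (deriv f₂) ζ = 0 → m ζ = 0) {ζ : ℂ} (hζ : ζ ∈ D) :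
    m ζ = (β₁ / β₂ : ℝ) := by
  -- This is the Wirtinger derivative ∂/∂ζ of `hconj`, where conj f₁ and conj f₂ contribute nothing.
  have hX (w : ℂ) (hw : w ∈ D) :
      deriv m w * conjVel β₂ f₂ w = -(I / 2) * (β₁ - m w * β₂) := by
    have hd1 := h₁.differentiableAt (hD.mem_nhds hw)
    have hd2 := h₂.differentiableAt (hD.mem_nhds hw)
    have hdm := hm.differentiableAt (hD.mem_nhds hw)
    have hdir (h : ℂ) := dir_deriv_unique hD (φ := conjVel β₁ f₁)
      (ψ := fun ζ => m ζ * conjVel β₂ f₂ ζ) hconj hw (h := h) (hasDerivAt_conjVel hd1 h)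
      ((hasDerivAt_dir hdm h).mul (hasDerivAt_conjVel hd2 h))
    have e1 := hdir 1
    have e2 := hdir I
    simp only [mul_one, one_im, mul_zero, ofReal_zero, add_zero, map_mul, conj_I, I_im,
      zero_mul] at e1 e2
    linear_combination (-1 / 2) * e1 + (I / 2) * e2 + (1 / 2 * (conj (deriv f₁ w)
      + deriv m w * conjVel β₂ f₂ w - m w * conj (deriv f₂ w))) * I_mul_I
  -- The right side of `hX` is holomorphic, so twice its ∂/∂ζ̄ derivative vanishes, and only that of
  -- the conjugate velocity survives on the left.
  have hY (w : ℂ) (hw : w ∈ D) : deriv m w * (2 * conj (deriv f₂ w) + I * β₂) = 0 := by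
    have hd2 := h₂.differentiableAt (hD.mem_nhds hw)
    have hdm := hm.differentiableAt (hD.mem_nhds hw)
    have hdm2 := (hm.deriv hD).differentiableAt (hD.mem_nhds hw)
    have hdir (h : ℂ) := dir_deriv_unique hD (φ := fun w => deriv m w * conjVel β₂ f₂ w)
      (ψ := fun w => -(I / 2) * (β₁ - m w * β₂)) hX hw (h := h)
      ((hasDerivAt_dir hdm2 h).mul (hasDerivAt_conjVel hd2 h))
      ((((hasDerivAt_dir hdm h).mul_const (β₂ : ℂ)).const_sub (β₁ : ℂ)).const_mul _)
    have e1 := hdir 1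
    have e2 := hdir I
    simp only [mul_one, one_im, mul_zero, ofReal_zero, add_zero, map_mul, conj_I, I_im,
      zero_mul] at e1 e2
    linear_combination e1 + I * e2 + (-(deriv (deriv m) w * conjVel β₂ f₂ w)
      + deriv m w * conj (deriv f₂ w) + I / 2 * deriv m w * β₂) * I_mul_I
  -- Where m' ≠ 0, `hY` forces f₂' to be constant nearby; then f₂'' = 0 and m = 0 nearby, a
  -- contradiction.
  have hm0 (w : ℂ) (hw : w ∈ D) : deriv m w = 0 := by
    by_contra hne
    have hcont := ((hm.deriv hD).continuousOn.continuousAt (hD.mem_nhds hw))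
    have hev : ∀ᶠ v in 𝓝 w, v ∈ D ∧ deriv m v ≠ 0 :=
      (hD.eventually_mem hw).and (hcont.eventually_ne hne)
    have hf' : deriv f₂ =ᶠ[𝓝 w] fun _ => I * β₂ / 2 := by
      filter_upwards [hev] with v hv
      have := (mul_eq_zero.1 (hY v hv.1)).resolve_left hv.2
      have := congrArg conj this
      simp only [map_add, map_mul, conj_conj, conj_I, conj_ofReal, map_zero, map_ofNat] at this
      linear_combination this / 2
    have hmz : m =ᶠ[𝓝 w] fun _ => 0 := by
      filter_upwards [hD.eventually_mem hw, hf'.eventuallyEq_nhds] with v hv hv'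
      refine hzero v hv ?_
      rw [hv'.deriv_eq, deriv_const]
    exact hne (by rw [hmz.deriv_eq, deriv_const])
  have := hX ζ hζ
  rw [hm0 ζ hζ, zero_mul] at this
  have h3 := (mul_eq_zero.1 this.symm).resolve_left (by simp [I_ne_zero])
  have hβ : (β₂ : ℂ) ≠ 0 := by exact_mod_cast hβ₂
  rw [ofReal_div, eq_div_iff hβ]
  linear_combination -h3

/-- Where f₁'' ≠ 0 the ratio of the two velocities is holomorphic, hence equal to k = β₁/β₂. The
second derivatives then give ρ₂ = k²ρ₁, and the gravity term, which does not scale with k², forces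
ρ₁ = ρ₂. -/
theorem proportional_of_deriv2_ne (hD : IsOpen D) (hρ₁ : 0 < ρ₁) (hρ₂ : 0 < ρ₂) (hg : 0 < g)
    (hβ₂ : β₂ ≠ 0) (S₁ : HasStream D β₁ f₁ Ψ₁) (S₂ : HasStream D β₂ f₂ Ψ₂)
    (hP : EqOn (PlanarLayer.pressure ρ₁ g β₁ V₁ f₁ Ψ₁) (PlanarLayer.pressure ρ₂ g β₂ V₂ f₂ Ψ₂) D)
    {ζ : ℂ} (hζ : ζ ∈ D) (hne : deriv (deriv f₁) ζ ≠ 0) :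
    ρ₁ = ρ₂ ∧ (β₁ / β₂) ^ 2 = 1 ∧ f₁ ζ = (β₁ / β₂ : ℝ) * f₂ ζ := by
  have hd1 := (S₁.holo.deriv hD).deriv hD
  have hd2 := (S₂.holo.deriv hD).deriv hD
  have hρc : (ρ₁ : ℂ) ≠ 0 := by exact_mod_cast hρ₁.ne'
  have hρc2 : (ρ₂ : ℂ) ≠ 0 := by exact_mod_cast hρ₂.ne'
  set D' := D ∩ deriv (deriv f₁) ⁻¹' {0}ᶜ with hD'
  have hD'o : IsOpen D' := hd1.continuousOn.isOpen_inter_preimage hD isOpen_compl_singleton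
  have hsub : D' ⊆ D := inter_subset_left
  set k : ℝ := β₁ / β₂ with hk
  have hkβ : β₁ = k * β₂ := by rw [hk, div_mul_cancel₀ _ hβ₂]
  set m : ℂ → ℂ := fun w => (ρ₂ * deriv (deriv f₂) w) / (ρ₁ * deriv (deriv f₁) w) with hm
  have hmd : DifferentiableOn ℂ m D' :=
    ((hd2.mono hsub).const_mul _).div ((hd1.mono hsub).const_mul _)
      fun w hw => mul_ne_zero hρc hw.2
  have hmk {w : ℂ} (hw : w ∈ D') : m w = (k : ℂ) := by
    refine factor_eq_const hD'o hβ₂ (S₁.holo.mono hsub) (S₂.holo.mono hsub) hmd (fun v hv => ?_)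
      (fun v hv h0 => by simp [hm, h0]) hw
    have := conjVel_mul_deriv2_eq hD S₁ S₂ hP hv.1
    have hv2 : deriv (deriv f₁) v ≠ 0 := hv.2
    simp only [hm]
    field_simp
    linear_combination this
  have hf {w : ℂ} (hw : w ∈ D') : f₁ w = k * f₂ w := by
    have h1 := conjVel_mul_deriv2_eq hD S₁ S₂ hP hw.1
    have hw2 : deriv (deriv f₁) w ≠ 0 := hw.2
    have h2 := hmk hw
    simp only [hm] at h2
    rw [div_eq_iff (mul_ne_zero hρc hw2)] at h2
    have h3 : conjVel β₁ f₁ w = k * conjVel β₂ f₂ w := by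
      refine mul_left_cancel₀ (mul_ne_zero hρc hw2) ?_
      linear_combination h1 + conjVel β₂ f₂ w * h2
    have h4 := congrArg conj h3
    rw [hkβ] at h4
    simp only [conjVel, map_add, map_mul, conj_conj, conj_ofReal, ofReal_mul] at h4
    linear_combination h4
  have hζ' : ζ ∈ D' := ⟨hζ, hne⟩
  have hf' : EqOn (deriv f₁) (fun w => k * deriv f₂ w) D' := fun w hw => by
    rw [deriv_congr_of_eqOn hD'o (ψ := fun w => k * f₂ w) (fun v hv => hf hv) hw,
      deriv_const_mul _ (S₂.holo.differentiableAt (hD.mem_nhds hw.1))]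
  have hf'' : deriv (deriv f₁) ζ = k * deriv (deriv f₂) ζ := by
    rw [deriv_congr_of_eqOn hD'o hf' hζ',
      deriv_const_mul _ ((S₂.holo.deriv hD).differentiableAt (hD.mem_nhds hζ))]
  have hρk : ρ₂ = k ^ 2 * ρ₁ := by
    have h2 := hmk hζ'
    simp only [hm] at h2
    rw [div_eq_iff (mul_ne_zero hρc hne)] at h2
    have hne2 : deriv (deriv f₂) ζ ≠ 0 := fun h => hne (by rw [hf'', h, mul_zero])
    have : (ρ₂ : ℂ) = k ^ 2 * ρ₁ := by
      refine mul_right_cancel₀ hne2 ?_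
      rw [h2, hf'']; ring
    exact_mod_cast this
  have hmom := momentum_eq hD S₁ S₂ hP hζ
  have hN : momentum β₁ f₁ ζ = k ^ 2 * momentum β₂ f₂ ζ := by
    simp only [momentum, conjVel, hf hζ', hf' hζ', hkβ, map_mul, conj_ofReal, ofReal_mul,
      im_ofReal_mul]
    ring
  have hρ : ρ₁ = ρ₂ := by
    have hgI : (g : ℂ) * I ≠ 0 := mul_ne_zero (by exact_mod_cast hg.ne') I_ne_zero
    have : (ρ₁ : ℂ) = ρ₂ := by
      refine mul_right_cancel₀ hgI ?_
      have hρk' : (ρ₂ : ℂ) = k ^ 2 * ρ₁ := by exact_mod_cast hρk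
      rw [hN] at hmom
      linear_combination -hmom - momentum β₂ f₂ ζ * hρk'
    exact_mod_cast this
  refine ⟨hρ, ?_, hf hζ'⟩
  refine mul_right_cancel₀ hρ₁.ne' ?_
  rw [← hρk, one_mul, hρ]

/-- Two layers with the same pressure on a common open set are either both locally affine somewhere
or proportional to each other. -/
theorem affine_or_proportional (hD : IsOpen D) (hDne : D.Nonempty) (hρ₁ : 0 < ρ₁) (hρ₂ : 0 < ρ₂)
    (hg : 0 < g) (hβ₂ : β₂ ≠ 0) (S₁ : HasStream D β₁ f₁ Ψ₁) (S₂ : HasStream D β₂ f₂ Ψ₂)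
    (hP : EqOn (PlanarLayer.pressure ρ₁ g β₁ V₁ f₁ Ψ₁)
      (PlanarLayer.pressure ρ₂ g β₂ V₂ f₂ Ψ₂) D) :
    (∃ ζ ∈ D, deriv (deriv f₁) =ᶠ[𝓝 ζ] 0 ∧ deriv (deriv f₂) =ᶠ[𝓝 ζ] 0) ∨
      (ρ₁ = ρ₂ ∧ (β₁ / β₂) ^ 2 = 1 ∧ ∀ ζ ∈ D, f₁ ζ = (β₁ / β₂ : ℝ) * f₂ ζ) := by
  by_cases h : ∃ ζ ∈ D, deriv (deriv f₁) =ᶠ[𝓝 ζ] 0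
  · left
    obtain ⟨ζ, hζ, h0⟩ := h
    refine ⟨ζ, hζ, h0, ?_⟩
    filter_upwards [h0.eventuallyEq_nhds, hD.eventually_mem hζ] with w hw hwD
    by_contra hne
    -- With f₁'' = 0 nearby, f₂'' ≠ 0 would make the second velocity vanish on an open set, against
    -- β₂ ≠ 0.
    have hcont := ((S₂.holo.deriv hD).deriv hD).continuousOn.continuousAt (hD.mem_nhds hwD)
    have hev : ∀ᶠ v in 𝓝 w, v ∈ D ∧ conjVel β₂ f₂ v = 0 := by
      filter_upwards [hw, hD.eventually_mem hwD, hcont.eventually_ne hne] with v hv hvD hvne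
      refine ⟨hvD, ?_⟩
      have := conjVel_mul_deriv2_eq hD S₁ S₂ hP hvD
      rw [hv, Pi.zero_apply, mul_zero, mul_zero] at this
      have hρc2 : (ρ₂ : ℂ) ≠ 0 := by exact_mod_cast hρ₂.ne'
      exact (mul_eq_zero.1 ((mul_eq_zero.1 this.symm).resolve_left hρc2)).resolve_right hvne
    obtain ⟨t, ht, hto, hwt⟩ := eventually_nhds_iff.1 hev
    exact hβ₂ (eq_zero_of_conjVel_eq_zero hto (S₂.holo.mono fun v hv => (ht v hv).1)
      (fun v hv => (ht v hv).2) ⟨w, hwt⟩)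
  · right
    -- Now f₁'' ≠ 0 on a dense subset, and the proportionality extends to `D` by continuity.
    have hfreq (ζ : ℂ) (hζ : ζ ∈ D) : ∃ᶠ w in 𝓝 ζ, w ∈ D ∧ deriv (deriv f₁) w ≠ 0 := by
      intro hev
      refine h ⟨ζ, hζ, ?_⟩
      filter_upwards [hev, hD.eventually_mem hζ] with w hw hwD
      by_contra hne
      exact hw ⟨hwD, hne⟩
    obtain ⟨ζ₀, hζ₀⟩ := hDne
    obtain ⟨w, hwD, hw⟩ := (hfreq ζ₀ hζ₀).exists
    obtain ⟨e1, e2, -⟩ := proportional_of_deriv2_ne hD hρ₁ hρ₂ hg hβ₂ S₁ S₂ hP hwD hw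
    refine ⟨e1, e2, fun ζ hζ => ?_⟩
    by_contra hne
    have hc : ContinuousAt (fun ζ => f₁ ζ - (β₁ / β₂ : ℝ) * f₂ ζ) ζ :=
      (S₁.holo.continuousOn.continuousAt (hD.mem_nhds hζ)).sub
        (continuousAt_const.mul (S₂.holo.continuousOn.continuousAt (hD.mem_nhds hζ)))
    obtain ⟨v, ⟨hvD, hv⟩, hv'⟩ := ((hfreq ζ hζ).and_eventually
      (hc.eventually_ne (sub_ne_zero.2 hne))).exists
    exact hv' (sub_eq_zero.2 (proportional_of_deriv2_ne hD hρ₁ hρ₂ hg hβ₂ S₁ S₂ hP hvD hv).2.2)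

end Overlap


/-! ### Fronts with a merely continuous velocity, and transport equations. -/

namespace Front

variable {V M lo hi : ℝ} {η b g U : ℝ × ℝ → ℝ}

/-- The primitive of the horizontal velocity in the vertical direction, normalized on the curve. -/
theorem exists_stream (F : Front V M lo hi η b g) (hU : Continuous U) {I : Set ℝ}
    (hb : ∀ x ∈ I, ∀ y, b (x, y) = U (x, η (x, y))) :
    ∃ Ψ : ℝ × ℝ → ℝ, Continuous Ψ ∧ (∀ x z, HasDerivAt (fun z => Ψ (x, z)) (U (x, z)) z) ∧
      ∀ x ∈ I, ∀ y, g (x, y) = Ψ (x, η (x, y)) := by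
  have hη := F.η_C1.continuous
  have hg := F.g_C1.continuous
  have hUx (x : ℝ) : Continuous fun z => U (x, z) := by fun_prop
  -- Ψ(x, z) is g(x, 0) plus the integral of U(x, ·) from η(x, 0) to z. Only continuity of Ψ and Ψ_z
  -- = U are needed; no differentiability of U is required.
  refine ⟨fun q => g (q.1, 0) + ((∫ z in (0 : ℝ)..q.2, U (q.1, z))
    - ∫ z in (0 : ℝ)..η (q.1, 0), U (q.1, z)), ?_, fun x z => ?_, fun x hx y => ?_⟩
  · have h1 : Continuous (Function.uncurry fun (q : ℝ × ℝ) (z : ℝ) => U (q.1, z)) := by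
      unfold Function.uncurry
      fun_prop
    have h2 := intervalIntegral.continuous_parametric_intervalIntegral_of_continuous
      (μ := volume) (a₀ := 0) h1 (s := fun q => q.2) (by fun_prop)
    have h3 := intervalIntegral.continuous_parametric_intervalIntegral_of_continuous
      (μ := volume) (a₀ := 0) h1 (s := fun q => η (q.1, 0)) (by fun_prop)
    exact Continuous.add (by fun_prop) (h2.sub h3)
  · exact (((hUx x).integral_hasStrictDerivAt 0 z).hasDerivAt.sub_const
      (∫ z in (0 : ℝ)..η (x, 0), U (x, z))).const_add (g (x, 0))
  · have hd (t : ℝ) : HasDerivAt (fun t => g (x, t) - (∫ z in (0 : ℝ)..η (x, t), U (x, z))) 0 t := by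
      have h1 := (hasDerivAt_snd F.g_C1 x t).fun_sub
        (((hUx x).integral_hasStrictDerivAt 0 (η (x, t))).hasDerivAt.comp t
          (hasDerivAt_snd F.η_C1 x t))
      refine h1.congr_deriv ?_
      rw [F.g_y, hb x hx, sub_self]
    have := is_const_of_deriv_eq_zero (fun t => (hd t).differentiableAt) (fun t => (hd t).deriv) y 0
    simp only at this ⊢
    linarith

/-- A curve on which the stream function is constant at the ends of a bounded interval. -/
theorem eq_zero_of_Icc (F : Front V M lo hi η b g) (hU : Continuous U) {x₁ x₂ c₂ : ℝ}
    (hb : ∀ x ∈ Icc x₁ x₂, ∀ y, b (x, y) = U (x, η (x, y))) (hg₁ : ∀ y, g (x₁, y) = 0)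
    (hg₂ : ∀ y, g (x₂, y) = c₂) {x : ℝ} (hx : x ∈ Icc x₁ x₂) (y : ℝ) : g (x, y) = 0 := by
  obtain ⟨Ψ, hΨ, -, hgΨ⟩ := F.exists_stream hU hb
  exact F.g_eq_zero_of_Icc hU.continuousOn hΨ.continuousOn hb hgΨ hg₁ hg₂ hx y

/-- A curve over a half-line on which the stream function is constant at the end, in a flow which
is close to a uniform shear far away. -/
theorem eq_zero_of_Ici (F : Front V M lo hi η b g) (hU : Continuous U) {x₁ X β : ℝ} (hβ : β ≠ 0)
    (hX : x₁ < X) (hb : ∀ x ∈ Ici x₁, ∀ y, b (x, y) = U (x, η (x, y))) (hg₁ : ∀ y, g (x₁, y) = 0)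
    (hshear : ∀ x, X ≤ x → ∀ z ∈ Icc lo hi, ∀ z' ∈ Icc lo hi, z ≤ z' →
      |U (x, z') - U (x, z) - β * (z' - z)| ≤ |β| / 2 * (z' - z)) {x : ℝ} (hx : x₁ ≤ x) (y : ℝ) :
    g (x, y) = 0 := by
  obtain ⟨Ψ, hΨ, hΨd, hgΨ⟩ := F.exists_stream hU hb
  rcases lt_or_gt_of_ne hβ with hneg | hpos
  · have S : ShearedFront x₁ X (-β / 2) (-V) M lo hi η (fun q => -b q) (fun q => -g q)
        (fun q => -U q) (fun q => -Ψ q) :=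
      { toFront := F.negate
        U_cont := hU.neg.continuousOn
        Ψ_cont := hΨ.neg.continuousOn
        b_eq := fun x hx y => by rw [hb x hx]
        g_eq := fun x hx y => by rw [hgΨ x hx]
        g_zero := fun y => by rw [hg₁, neg_zero]
        κ_pos := by linarith
        X_gt := hX
        Ψ_deriv := fun x _ z _ => (hΨd x z).neg
        shear := fun x hx z hz z' hz' hzz' => by
          have := (abs_le.1 (hshear x hx z hz z' hz' hzz')).2
          rw [abs_of_neg hneg] at this
          linarith }
    exact neg_eq_zero.1 (S.g_eq_zero hx y)
  · have S : ShearedFront x₁ X (β / 2) V M lo hi η b g U Ψ :=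
      { toFront := F
        U_cont := hU.continuousOn
        Ψ_cont := hΨ.continuousOn
        b_eq := hb
        g_eq := hgΨ
        g_zero := hg₁
        κ_pos := by linarith
        X_gt := hX
        Ψ_deriv := fun x _ z _ => hΨd x z
        shear := fun x hx z hz z' hz' hzz' => by
          have := (abs_le.1 (hshear x hx z hz z' hz' hzz')).1
          rw [abs_of_pos hpos] at this
          linarith }
    exact S.g_eq_zero hx y

end Front

/-- Solutions of `(β η + k) η_x + V η_y = 0` with `β, V ≠ 0` are constant. -/
theorem eq_of_transport {η : ℝ × ℝ → ℝ} (hη : ContDiff ℝ 1 η) {β k V : ℝ} (hβ : β ≠ 0) (hV : V ≠ 0)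
    (h : ∀ q, (β * η q + k) * fderiv ℝ η q (1, 0) + V * fderiv ℝ η q (0, 1) = 0) (p q : ℝ × ℝ) :
    η p = η q := by
  -- η is constant on the straight characteristic through `p` with slope fixed by η(p): the
  -- deviation from η(p) solves a linear homogeneous equation with initial value 0, and exp(E) is
  -- the integrating factor.
  have key (p : ℝ × ℝ) (t : ℝ) : η (p.1 + (β * η p + k) / V * t, p.2 + t) = η p := by
    set s := (β * η p + k) / V with hs
    set A : ℝ → ℝ := fun t => β / V * fderiv ℝ η (p.1 + s * t, p.2 + t) (1, 0) with hA
    have hAc : Continuous A := by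
      have := continuous_fderiv_apply hη (1, 0)
      fun_prop
    set E : ℝ → ℝ := fun t => ∫ r in (0 : ℝ)..t, A r with hE
    have hEd (t : ℝ) : HasDerivAt E (A t) t := (hAc.integral_hasStrictDerivAt 0 t).hasDerivAt
    have hφ (t : ℝ) : HasDerivAt (fun t => η (p.1 + s * t, p.2 + t) - η p)
        (-(A t) * (η (p.1 + s * t, p.2 + t) - η p)) t := by
      have hl : HasDerivAt (fun t : ℝ => ((p.1 + s * t, p.2 + t) : ℝ × ℝ)) (s, 1) t := by
        have h1 : HasDerivAt (fun t => p.1 + s * t) s t := by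
          simpa using ((hasDerivAt_id t).const_mul s).const_add p.1
        exact h1.prodMk ((hasDerivAt_id t).const_add p.2)
      have h1 := ((hη.differentiable one_ne_zero
        (p.1 + s * t, p.2 + t)).hasFDerivAt.comp_hasDerivAt t hl).sub_const (η p)
      refine h1.congr_deriv ?_
      have h2 : ((s, 1) : ℝ × ℝ) = s • ((1, 0) : ℝ × ℝ) + (0, 1) := by ext <;> simp
      have h3 := h (p.1 + s * t, p.2 + t)
      have hsV : s * V = β * η p + k := div_mul_cancel₀ _ hV
      have hβV : V * (β / V) = β := mul_div_cancel₀ _ hV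
      rw [h2, map_add, map_smul, smul_eq_mul]
      simp only [hA]
      refine mul_left_cancel₀ hV ?_
      linear_combination h3 + fderiv ℝ η (p.1 + s * t, p.2 + t) (1, 0) * hsV
        + fderiv ℝ η (p.1 + s * t, p.2 + t) (1, 0) * (η (p.1 + s * t, p.2 + t) - η p) * hβV
    have hconst (t : ℝ) : HasDerivAt
        (fun t => (η (p.1 + s * t, p.2 + t) - η p) * Real.exp (E t)) 0 t := by
      refine ((hφ t).mul (hEd t).exp).congr_deriv ?_
      ring
    have := is_const_of_deriv_eq_zero (fun t => (hconst t).differentiableAt)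
      (fun t => (hconst t).deriv) t 0
    simp only [mul_zero, add_zero, Prod.mk.eta, sub_self, zero_mul, mul_eq_zero,
      Real.exp_ne_zero, or_false] at this
    linarith
  by_contra hne
  set s := (β * η p + k) / V with hs
  set r := (β * η q + k) / V with hr
  have hsr : s - r ≠ 0 := by
    rw [hs, hr, ← sub_div]
    refine div_ne_zero ?_ hV
    have : β * (η p - η q) ≠ 0 := mul_ne_zero hβ (sub_ne_zero.2 hne)
    intro h0
    apply this
    linarith
  -- Different values of η would give different slopes; the two characteristics meet at this
  -- ordinate.
  set y := ((q.1 - r * q.2) - (p.1 - s * p.2)) / (s - r) with hy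
  have hyeq : y * (s - r) = (q.1 - r * q.2) - (p.1 - s * p.2) := div_mul_cancel₀ _ hsr
  have h1 := key p (y - p.2)
  have h2 := key q (y - q.2)
  rw [← hs] at h1
  rw [← hr] at h2
  have hpt : p.1 + s * (y - p.2) = q.1 + r * (y - q.2) := by linear_combination hyeq
  rw [hpt, add_sub_cancel] at h1
  rw [add_sub_cancel] at h2
  exact hne (h1.symm.trans h2)

/-- Solutions of `(β η + k) η_x = 0` do not depend on `x`. -/
theorem eq_of_degenerate_transport {η : ℝ × ℝ → ℝ} (hη : ContDiff ℝ 1 η) {β k : ℝ} (hβ : β ≠ 0)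
    (h : ∀ q, (β * η q + k) * fderiv ℝ η q (1, 0) = 0) (x x' y : ℝ) : η (x, y) = η (x', y) := by
  have h0 (x : ℝ) : fderiv ℝ η (x, y) (1, 0) = 0 := by
    by_contra hne
    have hc : Continuous fun x => fderiv ℝ η (x, y) (1, 0) :=
      (continuous_fderiv_apply hη (1, 0)).comp (by fun_prop)
    have hev : (fun x => η (x, y)) =ᶠ[𝓝 x] fun _ => -k / β := by
      filter_upwards [hc.continuousAt.eventually_ne hne] with t ht
      have := (mul_eq_zero.1 (h (t, y))).resolve_right ht
      rw [eq_div_iff hβ]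
      linarith
    refine hne ?_
    rw [← (hasDerivAt_fst hη x y).deriv, hev.deriv_eq, deriv_const]
  exact is_const_of_deriv_eq_zero (fun t => (hasDerivAt_fst hη t y).differentiableAt)
    (fun t => (hasDerivAt_fst hη t y).deriv.trans (h0 t)) x x'


/-! ### Planar waves and the overlap of the two layers. -/

namespace PlanarLayer

variable {F : Fluid} {lo hi : ℝ × ℝ → ℝ} {z₀ ρ g β M : ℝ} {f : ℂ → ℂ} {Ψ : ℂ → ℝ} {V : ℝ}

/-- A bounded layer whose complex velocity is affine somewhere is a uniform shear. -/
theorem exists_eq_const (S : PlanarLayer F lo hi z₀ ρ g β M f Ψ V) {ζ : ℂ} (hζ : ζ ∈ proj lo hi)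
    (h : deriv (deriv f) =ᶠ[𝓝 ζ] 0) : ∃ c, ∀ ζ ∈ proj lo hi, f ζ = c := by
  have hD := S.isOpen_proj
  have hpre := S.isPreconnected_proj
  have hd := S.differentiableOn
  have h2 : EqOn (deriv (deriv f)) 0 (proj lo hi) :=
    (((hd.deriv hD).deriv hD).analyticOnNhd hD).eqOn_zero_of_preconnected_of_eventuallyEq_zero
      hpre hζ h
  obtain ⟨a, ha⟩ := hD.exists_is_const_of_deriv_eq_zero hpre (hd.deriv hD) h2
  have hd' : DifferentiableOn ℂ (fun ζ => f ζ - a * ζ) (proj lo hi) :=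
    hd.sub (by fun_prop)
  obtain ⟨c, hc⟩ := hD.exists_is_const_of_deriv_eq_zero hpre hd' (fun w hw => by
    have := ((hd.differentiableAt (hD.mem_nhds hw)).hasDerivAt).sub
      ((hasDerivAt_id w).const_mul a)
    have h3 := this.deriv
    rw [ha w hw, mul_one, sub_self] at h3
    exact h3)
  have hval (t : ℝ) : ‖f (t + z₀ * Complex.I)‖ ≤ 2 * M + |β * z₀| := by
    have hmem : lift 0 (t + z₀ * Complex.I) ∈ closure (slab lo hi) :=
      subset_closure (S.lift_plane 0 (by simp))
    have hb := S.bound_closure hmem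
    rw [S.u_eq _ _ hmem, S.w_eq _ _ hmem, abs_neg] at hb
    have him : ((t : ℂ) + z₀ * Complex.I).im = z₀ := by simp
    rw [him] at hb
    refine (Complex.norm_le_abs_re_add_abs_im _).trans ?_
    have h4 : |(f (t + z₀ * Complex.I)).re| ≤ M + |β * z₀| := by
      have := abs_sub (((f (t + z₀ * Complex.I)).re + β * z₀)) (β * z₀)
      rw [add_sub_cancel_right] at this
      linarith [hb.1]
    linarith [hb.2.2]
  have ha0 : a = 0 := by
    by_contra hne
    have hpos : 0 < ‖a‖ := norm_pos_iff.2 hne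
    set K := 2 * M + |β * z₀| with hK
    have hline (t : ℝ) : f (t + z₀ * Complex.I) = a * (t + z₀ * Complex.I) + c := by
      have := hc (t + z₀ * Complex.I) ⟨0, S.lift_plane 0 (by simp)⟩
      linear_combination this
    -- On the line z = z₀ the affine function would vary by ‖a‖T = 2K + 1, more than the bound 2K
    -- allows.
    set T := (2 * K + 1) / ‖a‖ with hT
    have e1 : f ((T : ℝ) + z₀ * Complex.I) - f ((0 : ℝ) + z₀ * Complex.I) = a * T := by
      rw [hline, hline]; push_cast; ring
    have e2 := (norm_sub_le (f ((T : ℝ) + z₀ * Complex.I)) (f ((0 : ℝ) + z₀ * Complex.I))).trans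
      (add_le_add (hval T) (hval 0))
    have hK0 : 0 ≤ K := (norm_nonneg _).trans (hval 0)
    rw [e1, norm_mul, Complex.norm_real, Real.norm_of_nonneg (by positivity), hT,
      mul_div_cancel₀ _ hpos.ne'] at e2
    linarith
  refine ⟨c, fun w hw => ?_⟩
  have := hc w hw
  simpa [ha0] using this

theorem exists_shear (S : PlanarLayer F lo hi z₀ ρ g β M f Ψ V) {c : ℂ}
    (hc : ∀ ζ ∈ proj lo hi, f ζ = c) {p₀ : ℝ × ℝ × ℝ} (hp₀ : p₀ ∈ closure (slab lo hi))
    (hw : F.w p₀ = 0) : ∃ k : ℝ, ∀ p ∈ closure (slab lo hi),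
      F.u p = β * p.2.2 + k ∧ F.w p = 0 := by
  have hwc (p : ℝ × ℝ × ℝ) (hp : p ∈ closure (slab lo hi)) : F.w p = -c.im := by
    refine ((S.C1.w.continuousOn p hp).mono subset_closure).eq_const_of_mem_closure hp
      fun q hq => ?_
    have := S.w_eq q.2.1 ⟨q.1, q.2.2⟩ (subset_closure hq)
    rw [hc ⟨q.1, q.2.2⟩ ⟨q.2.1, hq⟩] at this
    exact this
  refine ⟨c.re, fun p hp => ⟨?_, by rw [hwc p hp, ← hwc p₀ hp₀, hw]⟩⟩
  have h1 : ContinuousOn (fun p => F.u p - β * p.2.2) (closure (slab lo hi)) :=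
    S.C1.u.continuousOn.sub (by fun_prop)
  have : F.u p - β * p.2.2 = c.re := by
    refine ((h1 p hp).mono subset_closure).eq_const_of_mem_closure hp fun q hq => ?_
    have := S.u_eq q.2.1 ⟨q.1, q.2.2⟩ (subset_closure hq)
    rw [hc ⟨q.1, q.2.2⟩ ⟨q.2.1, hq⟩] at this
    have h2 : F.u q = c.re + β * q.2.2 := this
    linarith
  linarith

theorem hasStream (S : PlanarLayer F lo hi z₀ ρ g β M f Ψ V) {D : Set ℂ} (hD : D ⊆ proj lo hi) :
    HasStream D β f Ψ :=
  ⟨S.differentiableOn.mono hD, fun _ hζ => S.hasFDerivAt_stream (hD hζ)⟩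

end PlanarLayer

/-- A steady wave both of whose layers are planar. -/
structure PlanarWave (C : Config) (z₁ z₂ β₁ β₂ M : ℝ) (f₁ f₂ : ℂ → ℂ) (Ψ₁ Ψ₂ : ℂ → ℝ)
    (V₁ V₂ : ℝ) : Prop where
  steady : C.IsSteadyWave
  lower : PlanarLayer C.F₁ (fun _ => -C.h₁) C.η z₁ C.ρ₁ C.g β₁ M f₁ Ψ₁ V₁
  upper : PlanarLayer C.F₂ C.η (fun _ => C.h₂) z₂ C.ρ₂ C.g β₂ M f₂ Ψ₂ V₂

/-- The points of the vertical plane which lie in either layer, depending on `y`. -/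
def overlap (η : ℝ × ℝ → ℝ) : Set ℂ :=
  {ζ | ∃ y y', η (ζ.re, y) < ζ.im ∧ ζ.im < η (ζ.re, y')}

theorem isOpen_overlap {η : ℝ × ℝ → ℝ} (hη : Continuous η) : IsOpen (overlap η) := by
  have h1 : overlap η = ⋃ y, ⋃ y', {ζ : ℂ | η (ζ.re, y) < ζ.im} ∩ {ζ : ℂ | ζ.im < η (ζ.re, y')} := by
    ext ζ; simp [overlap]
  have hre := Complex.continuous_re
  have him := Complex.continuous_im
  rw [h1]
  exact isOpen_iUnion fun y => isOpen_iUnion fun y' =>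
    (isOpen_lt (by fun_prop) (by fun_prop)).inter (isOpen_lt (by fun_prop) (by fun_prop))

namespace PlanarWave

variable {C : Config} {z₁ z₂ β₁ β₂ M : ℝ} {f₁ f₂ : ℂ → ℂ} {Ψ₁ Ψ₂ : ℂ → ℝ} {V₁ V₂ : ℝ}

theorem lt_η (S : PlanarWave C z₁ z₂ β₁ β₂ M f₁ f₂ Ψ₁ Ψ₂ V₁ V₂) (q : ℝ × ℝ) : -C.h₁ < C.η q :=
  (S.lower.lo_lt q).trans (S.lower.lt_hi q)

theorem η_lt (S : PlanarWave C z₁ z₂ β₁ β₂ M f₁ f₂ Ψ₁ Ψ₂ V₁ V₂) (q : ℝ × ℝ) : C.η q < C.h₂ :=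
  (S.upper.lo_lt q).trans (S.upper.lt_hi q)

theorem overlap_subset_lower (S : PlanarWave C z₁ z₂ β₁ β₂ M f₁ f₂ Ψ₁ Ψ₂ V₁ V₂) :
    overlap C.η ⊆ proj (fun _ => -C.h₁) C.η := fun ζ ⟨y, y', h, h'⟩ =>
  ⟨y', (S.lt_η (ζ.re, y)).trans h, h'⟩

theorem overlap_subset_upper (S : PlanarWave C z₁ z₂ β₁ β₂ M f₁ f₂ Ψ₁ Ψ₂ V₁ V₂) :
    overlap C.η ⊆ proj C.η (fun _ => C.h₂) := fun ζ ⟨y, y', h, h'⟩ =>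
  ⟨y, h, h'.trans (S.η_lt (ζ.re, y'))⟩

theorem surface_mem_lower (S : PlanarWave C z₁ z₂ β₁ β₂ M f₁ f₂ Ψ₁ Ψ₂ V₁ V₂) (q : ℝ × ℝ) :
    (q.1, q.2, C.η q) ∈ closure (slab (fun _ => -C.h₁) C.η) :=
  S.lower.mem_closure_iff.2 ⟨(S.lt_η q).le, le_rfl⟩

theorem surface_mem_upper (S : PlanarWave C z₁ z₂ β₁ β₂ M f₁ f₂ Ψ₁ Ψ₂ V₁ V₂) (q : ℝ × ℝ) :
    (q.1, q.2, C.η q) ∈ closure (slab C.η (fun _ => C.h₂)) :=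
  S.upper.mem_closure_iff.2 ⟨le_rfl, (S.η_lt q).le⟩

theorem exists_surface (S : PlanarWave C z₁ z₂ β₁ β₂ M f₁ f₂ Ψ₁ Ψ₂ V₁ V₂) {ζ : ℂ}
    (hζ : ζ ∈ overlap C.η) : ∃ y, C.η (ζ.re, y) = ζ.im := by
  obtain ⟨y, y', h, h'⟩ := hζ
  have hc : Continuous fun y => C.η (ζ.re, y) :=
    S.steady.η_C1.continuous.comp (by fun_prop)
  exact mem_range_of_exists_le_of_exists_ge hc ⟨y, h.le⟩ ⟨y', h'.le⟩

/-- By the intermediate value theorem each overlap point lies on the interface for some y. The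
pressures agree there, and they do not depend on y. -/
theorem pressure_eq (S : PlanarWave C z₁ z₂ β₁ β₂ M f₁ f₂ Ψ₁ Ψ₂ V₁ V₂) :
    EqOn (PlanarLayer.pressure C.ρ₁ C.g β₁ V₁ f₁ Ψ₁) (PlanarLayer.pressure C.ρ₂ C.g β₂ V₂ f₂ Ψ₂)
      (overlap C.η) := by
  intro ζ hζ
  obtain ⟨y, hy⟩ := S.exists_surface hζ
  have hl : lift y ζ = (ζ.re, y, C.η (ζ.re, y)) := by rw [lift, hy]
  have h1 : lift y ζ ∈ closure (slab (fun _ => -C.h₁) C.η) := by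
    rw [hl]; exact S.surface_mem_lower (ζ.re, y)
  have h2 : lift y ζ ∈ closure (slab C.η (fun _ => C.h₂)) := by
    rw [hl]; exact S.surface_mem_upper (ζ.re, y)
  rw [← S.lower.P_eq h1, ← S.upper.P_eq h2, hl]
  exact S.steady.dynamic _ _

theorem affine_or_proportional (S : PlanarWave C z₁ z₂ β₁ β₂ M f₁ f₂ Ψ₁ Ψ₂ V₁ V₂)
    (hne : (overlap C.η).Nonempty) :
    (∃ ζ ∈ overlap C.η, deriv (deriv f₁) =ᶠ[𝓝 ζ] 0 ∧ deriv (deriv f₂) =ᶠ[𝓝 ζ] 0) ∨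
      (C.ρ₁ = C.ρ₂ ∧ (β₁ / β₂) ^ 2 = 1 ∧ ∀ ζ ∈ overlap C.η, f₁ ζ = (β₁ / β₂ : ℝ) * f₂ ζ) :=
  InternalWave.affine_or_proportional (isOpen_overlap S.steady.η_C1.continuous) hne
    S.steady.ρ₁_pos S.steady.ρ₂_pos S.steady.g_pos S.upper.β_ne
    (S.lower.hasStream S.overlap_subset_lower) (S.upper.hasStream S.overlap_subset_upper)
    S.pressure_eq

theorem overlap_nonempty {η : ℝ × ℝ → ℝ} {x y y' : ℝ} (h : η (x, y) ≠ η (x, y')) :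
    ∃ ζ ∈ overlap η, ζ.re = x := by
  rcases lt_or_gt_of_ne h with h | h
  · exact ⟨⟨x, (η (x, y) + η (x, y')) / 2⟩, ⟨y, y', by simp only; linarith, by simp only; linarith⟩,
      rfl⟩
  · exact ⟨⟨x, (η (x, y) + η (x, y')) / 2⟩, ⟨y', y, by simp only; linarith, by simp only; linarith⟩,
      rfl⟩

/-- If both complex velocities are affine somewhere, the wave is a trivial shear flow. -/
theorem trivialShear_of_affine (S : PlanarWave C z₁ z₂ β₁ β₂ M f₁ f₂ Ψ₁ Ψ₂ V₁ V₂) {ζ : ℂ}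
    (hζ : ζ ∈ overlap C.η) (h₁ : deriv (deriv f₁) =ᶠ[𝓝 ζ] 0)
    (h₂ : deriv (deriv f₂) =ᶠ[𝓝 ζ] 0) : C.ρ₁ = C.ρ₂ ∧ C.IsTrivialShear β₁ β₂ := by
  have hD := isOpen_overlap S.steady.η_C1.continuous
  obtain ⟨c₁, hc₁⟩ := S.lower.exists_eq_const (S.overlap_subset_lower hζ) h₁
  obtain ⟨c₂, hc₂⟩ := S.upper.exists_eq_const (S.overlap_subset_upper hζ) h₂
  have hbed : ((0 : ℝ), (0 : ℝ), -C.h₁) ∈ closure (slab (fun _ => -C.h₁) C.η) :=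
    S.lower.mem_closure_iff.2 ⟨le_rfl, (S.lt_η _).le⟩
  have hlid : ((0 : ℝ), (0 : ℝ), C.h₂) ∈ closure (slab C.η (fun _ => C.h₂)) :=
    S.upper.mem_closure_iff.2 ⟨(S.η_lt _).le, le_rfl⟩
  obtain ⟨k₁, hk₁⟩ := S.lower.exists_shear hc₁ hbed (S.steady.bed 0 0)
  obtain ⟨k₂, hk₂⟩ := S.upper.exists_shear hc₂ hlid (S.steady.lid 0 0)
  have hnc : ¬ ∀ p q, C.η p = C.η q := fun h => by
    obtain ⟨y, y', h1, h2⟩ := hζ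
    exact absurd (h (ζ.re, y) (ζ.re, y')) (h1.trans h2).ne
  have hkin₁ (q : ℝ × ℝ) : (β₁ * C.η q + k₁) * fderiv ℝ C.η q (1, 0)
      + V₁ * fderiv ℝ C.η q (0, 1) = 0 := by
    have := S.steady.kinematic_lower q.1 q.2
    have hm := S.surface_mem_lower q
    rw [(hk₁ _ hm).1, (hk₁ _ hm).2, S.lower.v_eq_const _ hm] at this
    exact this
  have hkin₂ (q : ℝ × ℝ) : (β₂ * C.η q + k₂) * fderiv ℝ C.η q (1, 0)
      + V₂ * fderiv ℝ C.η q (0, 1) = 0 := by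
    have := S.steady.kinematic_upper q.1 q.2
    have hm := S.surface_mem_upper q
    rw [(hk₂ _ hm).1, (hk₂ _ hm).2, S.upper.v_eq_const _ hm] at this
    exact this
  -- A nonzero transverse velocity would make η constant and the overlap empty.
  have hV₁ : V₁ = 0 := by
    by_contra hV
    exact hnc (eq_of_transport S.steady.η_C1 S.lower.β_ne hV hkin₁)
  have hV₂ : V₂ = 0 := by
    by_contra hV
    exact hnc (eq_of_transport S.steady.η_C1 S.upper.β_ne hV hkin₂)
  refine ⟨?_, ⟨k₁, fun p hp => ⟨(hk₁ p hp).1, (S.lower.v_eq_const p hp).trans hV₁, (hk₁ p hp).2⟩⟩,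
    ⟨k₂, fun p hp => ⟨(hk₂ p hp).1, (S.upper.v_eq_const p hp).trans hV₂, (hk₂ p hp).2⟩⟩,
    fun y => C.η (0, y), S.steady.η_C1.comp (by fun_prop), fun y => ⟨S.lt_η _, S.η_lt _⟩,
    fun x y => ?_⟩
  -- For horizontal shear flows both pressure gradients are hydrostatic, so their equality reads ρ₁g
  -- = ρ₂g.
  · have hmom := momentum_eq hD (S.lower.hasStream S.overlap_subset_lower)
      (S.upper.hasStream S.overlap_subset_upper) S.pressure_eq hζ
    have hc₁0 : c₁.im = 0 := by
      obtain ⟨y, hy⟩ := S.overlap_subset_lower hζ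
      have := S.lower.w_eq y ζ (subset_closure hy)
      rw [(hk₁ _ (subset_closure hy)).2, hc₁ ζ ⟨y, hy⟩] at this
      linarith
    have hc₂0 : c₂.im = 0 := by
      obtain ⟨y, hy⟩ := S.overlap_subset_upper hζ
      have := S.upper.w_eq y ζ (subset_closure hy)
      rw [(hk₂ _ (subset_closure hy)).2, hc₂ ζ ⟨y, hy⟩] at this
      linarith
    have hd₁ : deriv f₁ ζ = 0 := by
      rw [deriv_congr_of_eqOn hD (ψ := fun _ => c₁)
        (fun w hw => hc₁ w (S.overlap_subset_lower hw)) hζ, deriv_const]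
    have hd₂ : deriv f₂ ζ = 0 := by
      rw [deriv_congr_of_eqOn hD (ψ := fun _ => c₂)
        (fun w hw => hc₂ w (S.overlap_subset_upper hw)) hζ, deriv_const]
    simp only [momentum, hd₁, hd₂, hc₁ ζ (S.overlap_subset_lower hζ),
      hc₂ ζ (S.overlap_subset_upper hζ), hc₁0, hc₂0, mul_zero, Complex.ofReal_zero, sub_zero,
      zero_sub] at hmom
    have hg : (C.g : ℂ) * Complex.I ≠ 0 :=
      mul_ne_zero (by exact_mod_cast S.steady.g_pos.ne') Complex.I_ne_zero
    exact_mod_cast mul_right_cancel₀ (neg_ne_zero.2 hg) hmom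
  · refine eq_of_degenerate_transport S.steady.η_C1 S.lower.β_ne (k := k₁) (fun q => ?_) x 0 y
    have := hkin₁ q
    rwa [hV₁, zero_mul, add_zero] at this

end PlanarWave


/-! ### Gluing the two complex velocities over the non-flat columns. -/

/-- The abscissae at which the interface does not depend on `y`. -/
def flat (η : ℝ × ℝ → ℝ) : Set ℝ := {x | ∀ y, η (x, y) = η (x, 0)}

theorem isClosed_flat {η : ℝ × ℝ → ℝ} (hη : Continuous η) : IsClosed (flat η) := by
  have : flat η = ⋂ y, {x | η (x, y) = η (x, 0)} := by ext x; simp [flat]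
  rw [this]
  exact isClosed_iInter fun y => isClosed_eq (by fun_prop) (by fun_prop)

theorem notMem_flat_of_ne {η : ℝ × ℝ → ℝ} {x y y' : ℝ} (h : η (x, y) ≠ η (x, y')) :
    x ∉ flat η := fun hx => h ((hx y).trans (hx y').symm)

theorem exists_ne_of_notMem_flat {η : ℝ × ℝ → ℝ} {x : ℝ} (h : x ∉ flat η) (c : ℝ) :
    ∃ y, η (x, y) ≠ c := by
  by_contra! hc
  exact h fun y => (hc y).trans (hc 0).symm

theorem continuous_complex_mk {X : Type*} [TopologicalSpace X] {a b : X → ℝ} (ha : Continuous a)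
    (hb : Continuous b) : Continuous fun t => (⟨a t, b t⟩ : ℂ) := by
  have : (fun t => (⟨a t, b t⟩ : ℂ)) = fun t => (a t : ℂ) + b t * Complex.I := by
    funext t; apply Complex.ext <;> simp
  rw [this]; fun_prop

theorem tendsto_comp_of_continuousOn {f : ℂ → ℂ} {A : Set ℂ} (hf : ContinuousOn f A) {c : ℝ → ℂ}
    (hc : Continuous c) (h0 : c 0 ∈ A) (hA : ∀ᶠ s in 𝓝[>] (0 : ℝ), c s ∈ A) :
    Tendsto (fun s => f (c s)) (𝓝[>] 0) (𝓝 (f (c 0))) :=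
  (hf (c 0) h0).tendsto.comp (tendsto_nhdsWithin_iff.2
    ⟨(hc.tendsto 0).mono_left nhdsWithin_le_nhds, hA⟩)

open Classical in
/-- The complex velocity of both layers in the slice `y = 0`, the upper one multiplied by `m`. -/
noncomputable def glue (η : ℝ × ℝ → ℝ) (m : ℝ) (f₁ f₂ : ℂ → ℂ) (ζ : ℂ) : ℂ :=
  if ζ.im ≤ η (ζ.re, 0) then f₁ ζ else m * f₂ ζ

/-- Two layers with proportional complex velocities. -/
structure GluedWave (C : Config) (z₁ z₂ β₁ β₂ M : ℝ) (f₁ f₂ : ℂ → ℂ) (Ψ₁ Ψ₂ : ℂ → ℝ)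
    (V₁ V₂ m : ℝ) : Prop extends PlanarWave C z₁ z₂ β₁ β₂ M f₁ f₂ Ψ₁ Ψ₂ V₁ V₂ where
  m_sq : m ^ 2 = 1
  eq_of_overlap : ∀ ζ ∈ overlap C.η, f₁ ζ = m * f₂ ζ

namespace GluedWave

variable {C : Config} {z₁ z₂ β₁ β₂ M : ℝ} {f₁ f₂ : ℂ → ℂ} {Ψ₁ Ψ₂ : ℂ → ℝ} {V₁ V₂ m : ℝ}

theorem lift_mem_lower (S : GluedWave C z₁ z₂ β₁ β₂ M f₁ f₂ Ψ₁ Ψ₂ V₁ V₂ m) {y : ℝ} {ζ : ℂ}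
    (h1 : -C.h₁ ≤ ζ.im) (h2 : ζ.im ≤ C.η (ζ.re, y)) :
    lift y ζ ∈ closure (slab (fun _ => -C.h₁) C.η) :=
  S.lower.mem_closure_iff.2 ⟨h1, h2⟩

theorem lift_mem_upper (S : GluedWave C z₁ z₂ β₁ β₂ M f₁ f₂ Ψ₁ Ψ₂ V₁ V₂ m) {y : ℝ} {ζ : ℂ}
    (h1 : C.η (ζ.re, y) ≤ ζ.im) (h2 : ζ.im ≤ C.h₂) :
    lift y ζ ∈ closure (slab C.η (fun _ => C.h₂)) :=
  S.upper.mem_closure_iff.2 ⟨h1, h2⟩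

/-- Some other height of the interface occurs in the column. Points moving from the surface point
towards it lie in the overlap, and both sides are continuous along them. -/
theorem eq_of_surface (S : GluedWave C z₁ z₂ β₁ β₂ M f₁ f₂ Ψ₁ Ψ₂ V₁ V₂ m) {x : ℝ}
    (hx : x ∉ flat C.η) (y : ℝ) : f₁ ⟨x, C.η (x, y)⟩ = m * f₂ ⟨x, C.η (x, y)⟩ := by
  obtain ⟨y', hy'⟩ := exists_ne_of_notMem_flat hx (C.η (x, y))
  have hl := S.lt_η (x, y)
  have hl' := S.lt_η (x, y')
  have hu := S.η_lt (x, y)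
  have hu' := S.η_lt (x, y')
  rcases lt_or_gt_of_ne hy' with h | h
  · have hc : Continuous fun s : ℝ => (⟨x, C.η (x, y) - s⟩ : ℂ) :=
      continuous_complex_mk (by fun_prop) (by fun_prop)
    have hev : ∀ᶠ s in 𝓝[>] (0 : ℝ), 0 < s ∧ s < C.η (x, y) - C.η (x, y') :=
      Ioo_mem_nhdsGT (by linarith)
    have t1 := tendsto_comp_of_continuousOn (S.lower.continuousOn y) hc
      (S.lift_mem_lower (by simpa using hl.le) (by simp)) (by
        filter_upwards [hev] with s hs
        exact S.lift_mem_lower (by simp only; linarith) (by simp only; linarith))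
    have t2 := (tendsto_comp_of_continuousOn (S.upper.continuousOn y') hc
      (S.lift_mem_upper (by simpa using h.le) (by simpa using hu.le)) (by
        filter_upwards [hev] with s hs
        exact S.lift_mem_upper (by simp only; linarith) (by simp only; linarith))).const_mul (m : ℂ)
    have := tendsto_nhds_unique t1 (t2.congr' (by
      filter_upwards [hev] with s hs
      exact (S.eq_of_overlap _ ⟨y', y, by simp only; linarith, by simp only; linarith⟩).symm))
    simpa using this
  · have hc : Continuous fun s : ℝ => (⟨x, C.η (x, y) + s⟩ : ℂ) :=
      continuous_complex_mk (by fun_prop) (by fun_prop)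
    have hev : ∀ᶠ s in 𝓝[>] (0 : ℝ), 0 < s ∧ s < C.η (x, y') - C.η (x, y) :=
      Ioo_mem_nhdsGT (by linarith)
    have t1 := tendsto_comp_of_continuousOn (S.lower.continuousOn y') hc
      (S.lift_mem_lower (by simpa using hl.le) (by simpa using h.le)) (by
        filter_upwards [hev] with s hs
        exact S.lift_mem_lower (by simp only; linarith) (by simp only; linarith))
    have t2 := (tendsto_comp_of_continuousOn (S.upper.continuousOn y) hc
      (S.lift_mem_upper (by simp) (by simpa using hu.le)) (by
        filter_upwards [hev] with s hs
        exact S.lift_mem_upper (by simp only; linarith) (by simp only; linarith))).const_mul (m : ℂ)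
    have := tendsto_nhds_unique t1 (t2.congr' (by
      filter_upwards [hev] with s hs
      exact (S.eq_of_overlap _ ⟨y, y', by simp only; linarith, by simp only; linarith⟩).symm))
    simpa using this

theorem eq_of_surface_closure (S : GluedWave C z₁ z₂ β₁ β₂ M f₁ f₂ Ψ₁ Ψ₂ V₁ V₂ m) {x : ℝ}
    (hx : x ∈ closure (flat C.η)ᶜ) (y : ℝ) :
    f₁ ⟨x, C.η (x, y)⟩ = m * f₂ ⟨x, C.η (x, y)⟩ := by
  have hη := S.steady.η_C1.continuous
  have hc : Continuous fun t : ℝ => (⟨t, C.η (t, y)⟩ : ℂ) :=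
    continuous_complex_mk (by fun_prop) (by fun_prop)
  have h1 : Continuous fun t : ℝ => f₁ ⟨t, C.η (t, y)⟩ :=
    (S.lower.continuousOn y).comp_continuous hc fun t =>
      S.lift_mem_lower (S.lt_η _).le le_rfl
  have h2 : Continuous fun t : ℝ => f₂ ⟨t, C.η (t, y)⟩ :=
    (S.upper.continuousOn y).comp_continuous hc fun t =>
      S.lift_mem_upper le_rfl (S.η_lt _).le
  exact closure_minimal (fun t ht => S.eq_of_surface ht y)
    (isClosed_eq h1 (continuous_const.mul h2)) hx

theorem glue_surface (S : GluedWave C z₁ z₂ β₁ β₂ M f₁ f₂ Ψ₁ Ψ₂ V₁ V₂ m) {x : ℝ}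
    (hx : x ∈ closure (flat C.η)ᶜ) (y : ℝ) :
    glue C.η m f₁ f₂ ⟨x, C.η (x, y)⟩ = f₁ ⟨x, C.η (x, y)⟩ := by
  unfold glue
  split_ifs with h
  · rfl
  · exact (S.eq_of_surface_closure hx y).symm

theorem continuousOn_glue (S : GluedWave C z₁ z₂ β₁ β₂ M f₁ f₂ Ψ₁ Ψ₂ V₁ V₂ m) :
    ContinuousOn (glue C.η m f₁ f₂) (closure (flat C.η)ᶜ ×ℂ Icc (-C.h₁) C.h₂) := by
  have hη := S.steady.η_C1.continuous
  have hre := Complex.continuous_re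
  have him := Complex.continuous_im
  set K := closure (flat C.η)ᶜ ×ℂ Icc (-C.h₁) C.h₂ with hK
  have hKc : IsClosed K := isClosed_closure.reProdIm isClosed_Icc
  have hA : IsClosed {ζ : ℂ | ζ.im ≤ C.η (ζ.re, 0)} := isClosed_le (by fun_prop) (by fun_prop)
  have hB : IsClosed {ζ : ℂ | C.η (ζ.re, 0) ≤ ζ.im} := isClosed_le (by fun_prop) (by fun_prop)
  have h1 : ContinuousOn (glue C.η m f₁ f₂) (K ∩ {ζ : ℂ | ζ.im ≤ C.η (ζ.re, 0)}) :=
    ((S.lower.continuousOn 0).mono fun ζ hζ => S.lift_mem_lower hζ.1.2.1 hζ.2).congr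
      fun ζ hζ => if_pos hζ.2
  have h2 : ContinuousOn (glue C.η m f₁ f₂) (K ∩ {ζ : ℂ | C.η (ζ.re, 0) ≤ ζ.im}) := by
    refine (((S.upper.continuousOn 0).mono fun ζ hζ =>
      S.lift_mem_upper hζ.2 hζ.1.2.2).const_smul (m : ℂ)).congr fun ζ hζ => ?_
    have hle' : C.η (ζ.re, 0) ≤ ζ.im := hζ.2
    rcases lt_or_eq_of_le hle' with h | h
    · exact if_neg (not_le.2 h)
    · have hζe : ζ = ⟨ζ.re, C.η (ζ.re, 0)⟩ := Complex.ext rfl h.symm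
      have hle : ζ.im ≤ C.η (ζ.re, 0) := h.symm.le
      have e1 := S.eq_of_surface_closure hζ.1.1 0
      rw [← hζe] at e1
      rw [glue, if_pos hle, e1]
      rfl
  refine (h1.union_of_isClosed h2 (hKc.inter hA) (hKc.inter hB)).mono fun ζ hζ => ?_
  rcases le_total ζ.im (C.η (ζ.re, 0)) with h | h
  · exact Or.inl ⟨hζ, h⟩
  · exact Or.inr ⟨hζ, h⟩

theorem glue_eq_lower (S : GluedWave C z₁ z₂ β₁ β₂ M f₁ f₂ Ψ₁ Ψ₂ V₁ V₂ m) {ζ : ℂ} {y : ℝ}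
    (h : ζ.im < C.η (ζ.re, y)) : glue C.η m f₁ f₂ ζ = f₁ ζ := by
  unfold glue
  split_ifs with h0
  · rfl
  · exact (S.eq_of_overlap ζ ⟨0, y, not_le.1 h0, h⟩).symm

theorem glue_eq_upper (S : GluedWave C z₁ z₂ β₁ β₂ M f₁ f₂ Ψ₁ Ψ₂ V₁ V₂ m) {ζ : ℂ} {y : ℝ}
    (h : C.η (ζ.re, y) < ζ.im) : glue C.η m f₁ f₂ ζ = m * f₂ ζ := by
  unfold glue
  split_ifs with h0
  · rcases lt_or_eq_of_le h0 with h1 | h1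
    · exact S.eq_of_overlap ζ ⟨y, 0, h, h1⟩
    · have hne : ζ.re ∉ flat C.η := notMem_flat_of_ne (y := y) (y' := 0) (by
        rw [← h1]; exact h.ne)
      have e1 := S.eq_of_surface hne 0
      rwa [← h1] at e1
  · rfl

/-- In a non-flat column every point is off the interface for some y. A neighbourhood in that slice
lies in one layer, and there the glued function is f₁ or m f₂ throughout. -/
theorem differentiableAt_glue (S : GluedWave C z₁ z₂ β₁ β₂ M f₁ f₂ Ψ₁ Ψ₂ V₁ V₂ m) {ζ : ℂ}
    (hre : ζ.re ∉ flat C.η) (h1 : -C.h₁ < ζ.im) (h2 : ζ.im < C.h₂) :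
    DifferentiableAt ℂ (glue C.η m f₁ f₂) ζ := by
  obtain ⟨y, hy⟩ := exists_ne_of_notMem_flat hre ζ.im
  rcases lt_or_gt_of_ne hy with h | h
  · have hmem : lift y ζ ∈ slab C.η (fun _ => C.h₂) := ⟨h, h2⟩
    have hd := (S.upper.differentiableOn.differentiableAt
      (S.upper.isOpen_proj.mem_nhds ⟨y, hmem⟩)).const_mul (m : ℂ)
    refine hd.congr_of_eventuallyEq ?_
    filter_upwards [(S.upper.isOpen_preimage_lift y).mem_nhds hmem] with w hw
    exact S.glue_eq_upper hw.1
  · have hmem : lift y ζ ∈ slab (fun _ => -C.h₁) C.η := ⟨h1, h⟩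
    have hd := S.lower.differentiableOn.differentiableAt
      (S.lower.isOpen_proj.mem_nhds ⟨y, hmem⟩)
    refine hd.congr_of_eventuallyEq ?_
    filter_upwards [(S.lower.isOpen_preimage_lift y).mem_nhds hmem] with w hw
    exact S.glue_eq_lower hw.2

theorem abs_m (S : GluedWave C z₁ z₂ β₁ β₂ M f₁ f₂ Ψ₁ Ψ₂ V₁ V₂ m) : |m| = 1 :=
  (pow_eq_one_iff_of_nonneg (abs_nonneg m) two_ne_zero).1 (by rw [sq_abs, S.m_sq])

theorem abs_im_glue_le (S : GluedWave C z₁ z₂ β₁ β₂ M f₁ f₂ Ψ₁ Ψ₂ V₁ V₂ m) {ζ : ℂ}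
    (h1 : -C.h₁ ≤ ζ.im) (h2 : ζ.im ≤ C.h₂) : |(glue C.η m f₁ f₂ ζ).im| ≤ M := by
  unfold glue
  split_ifs with h
  · have hmem := S.lift_mem_lower h1 h
    have := (S.lower.bound_closure hmem).2.2
    rwa [S.lower.w_eq _ _ hmem, abs_neg] at this
  · have hmem := S.lift_mem_upper (not_le.1 h).le h2
    have := (S.upper.bound_closure hmem).2.2
    rw [S.upper.w_eq _ _ hmem, abs_neg] at this
    rwa [Complex.im_ofReal_mul, abs_mul, S.abs_m, one_mul]

theorem im_glue_wall (S : GluedWave C z₁ z₂ β₁ β₂ M f₁ f₂ Ψ₁ Ψ₂ V₁ V₂ m) {ζ : ℂ}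
    (h : ζ.im ∈ ({-C.h₁, C.h₂} : Set ℝ)) : (glue C.η m f₁ f₂ ζ).im = 0 := by
  rcases h with h | h
  · have hle : ζ.im ≤ C.η (ζ.re, 0) := by rw [h]; exact (S.lt_η _).le
    have hmem := S.lift_mem_lower h.symm.le hle
    have := S.lower.w_eq _ _ hmem
    rw [glue, if_pos hle]
    rw [lift, h, S.steady.bed] at this
    linarith
  · have h : ζ.im = C.h₂ := h
    have hlt : C.η (ζ.re, 0) < ζ.im := by rw [h]; exact S.η_lt _
    have hmem := S.lift_mem_upper hlt.le h.le
    have := S.upper.w_eq _ _ hmem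
    rw [lift, h, S.steady.lid] at this
    rw [glue, if_neg (not_le.2 hlt), Complex.im_ofReal_mul, neg_eq_zero.1 this.symm, mul_zero]

/-- If the interface is nowhere flat in `y`, both complex velocities are affine on the overlap. -/
theorem deriv2_eq_zero_of_flat_eq_empty (S : GluedWave C z₁ z₂ β₁ β₂ M f₁ f₂ Ψ₁ Ψ₂ V₁ V₂ m)
    (hflat : flat C.η = ∅) {ζ : ℂ} (hζ : ζ ∈ overlap C.η) :
    deriv (deriv f₁) =ᶠ[𝓝 ζ] 0 ∧ deriv (deriv f₂) =ᶠ[𝓝 ζ] 0 := by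
  have hD := isOpen_overlap S.steady.η_C1.continuous
  have hcl : closure (flat C.η)ᶜ = univ := by rw [hflat]; simp
  -- With no flat column the glued function is holomorphic on the whole strip between the walls, and
  -- the Liouville argument applies.
  have h0 {w : ℂ} (hw : w.im ∈ Ioo (-C.h₁) C.h₂) : deriv (glue C.η m f₁ f₂) w = 0 := by
    refine deriv_eq_zero_of_strip (M := M) (a := -C.h₁) (b := C.h₂) ?_ ?_ ?_ ?_ hw
    · exact fun v hv => (S.differentiableAt_glue (by rw [hflat]; exact notMem_empty _) hv.2.1
        hv.2.2).differentiableWithinAt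
    · rw [← hcl]; exact S.continuousOn_glue
    · exact fun v hv => S.abs_im_glue_le hv.2.1 hv.2.2
    · exact fun v hv => S.im_glue_wall hv.2
  have hm : (m : ℂ) ^ 2 = 1 := by exact_mod_cast S.m_sq
  have hd₁ : EqOn (deriv f₁) (fun _ => 0) (overlap C.η) := fun w hw => by
    obtain ⟨y, y', h, h'⟩ := id hw
    rw [← h0 ⟨(S.lt_η _).trans h, h'.trans (S.η_lt _)⟩]
    refine deriv_congr_of_eqOn hD (fun v hv => ?_) hw
    obtain ⟨-, y', -, h'⟩ := hv
    exact (S.glue_eq_lower h').symm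
  have hd₂ : EqOn (deriv f₂) (fun _ => 0) (overlap C.η) := fun w hw => by
    rw [deriv_congr_of_eqOn hD (ψ := fun v => m * f₁ v) (fun v hv => by
      simp only; rw [S.eq_of_overlap v hv, ← mul_assoc, ← sq, hm, one_mul]) hw,
      deriv_const_mul _ (S.lower.differentiableOn.differentiableAt
        (S.lower.isOpen_proj.mem_nhds (S.overlap_subset_lower hw))), hd₁ hw, mul_zero]
  constructor
  · filter_upwards [hD.mem_nhds hζ] with w hw
    rw [deriv_congr_of_eqOn hD hd₁ hw, deriv_const, Pi.zero_apply]
  · filter_upwards [hD.mem_nhds hζ] with w hw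
    rw [deriv_congr_of_eqOn hD hd₂ hw, deriv_const, Pi.zero_apply]

end GluedWave


/-! ### The interface as a front, and the propagation of flatness. -/

namespace PlanarWave

variable {C : Config} {z₁ z₂ β₁ β₂ M : ℝ} {f₁ f₂ : ℂ → ℂ} {Ψ₁ Ψ₂ : ℂ → ℝ} {V₁ V₂ : ℝ}

/-- The horizontal velocity of the lower fluid on the interface. -/
def surfaceVelocity (C : Config) (q : ℝ × ℝ) : ℝ := C.F₁.u (q.1, q.2, C.η q)

/-- The stream function of the lower fluid on the interface, normalized at `(x₁, 0)`. -/
noncomputable def surfaceStream (C : Config) (β₁ x₁ : ℝ) (q : ℝ × ℝ) : ℝ :=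
  (C.F₁.head C.ρ₁ C.g (q.1, q.2, C.η q) - C.F₁.head C.ρ₁ C.g (x₁, 0, C.η (x₁, 0))) * β₁⁻¹

theorem contDiff_surfaceStream (S : PlanarWave C z₁ z₂ β₁ β₂ M f₁ f₂ Ψ₁ Ψ₂ V₁ V₂) (x₁ : ℝ) :
    ContDiff ℝ 1 (surfaceStream C β₁ x₁) :=
  ((PlanarLayer.contDiff_trace S.lower.contDiffOn_head S.steady.η_C1
    S.surface_mem_lower).sub contDiff_const).mul contDiff_const

theorem fderiv_surfaceStream (S : PlanarWave C z₁ z₂ β₁ β₂ M f₁ f₂ Ψ₁ Ψ₂ V₁ V₂) (x₁ : ℝ)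
    (q k : ℝ × ℝ) : fderiv ℝ (surfaceStream C β₁ x₁) q k
      = -C.F₁.w (q.1, q.2, C.η q) * k.1 + surfaceVelocity C q * fderiv ℝ C.η q k := by
  have h1 := (PlanarLayer.contDiff_trace S.lower.contDiffOn_head S.steady.η_C1
    S.surface_mem_lower).differentiable one_ne_zero q
  have h2 := S.lower.fderiv_head_trace S.steady.η_C1 S.surface_mem_lower q k
  have hβ := S.lower.β_ne
  unfold surfaceStream
  rw [fderiv_mul_const (h1.sub_const _), fderiv_sub_const, smul_apply, h2, surfaceVelocity,
    smul_eq_mul]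
  field_simp

theorem climb_eq (S : PlanarWave C z₁ z₂ β₁ β₂ M f₁ f₂ Ψ₁ Ψ₂ V₁ V₂) (q : ℝ × ℝ) :
    surfaceVelocity C q * fderiv ℝ C.η q (1, 0) + V₁ * fderiv ℝ C.η q (0, 1)
      = C.F₁.w (q.1, q.2, C.η q) := by
  rw [← S.lower.v_eq_const _ (S.surface_mem_lower q)]
  exact S.steady.kinematic_lower q.1 q.2

/-- On the interface ∂_x gives -w + uη_x, and the kinematic condition turns this into -Vη_y. -/
theorem surfaceStream_x (S : PlanarWave C z₁ z₂ β₁ β₂ M f₁ f₂ Ψ₁ Ψ₂ V₁ V₂) (x₁ : ℝ) (q : ℝ × ℝ) :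
    fderiv ℝ (surfaceStream C β₁ x₁) q (1, 0) = -V₁ * fderiv ℝ C.η q (0, 1) := by
  rw [S.fderiv_surfaceStream]
  linear_combination S.climb_eq q

theorem surfaceStream_eq (S : PlanarWave C z₁ z₂ β₁ β₂ M f₁ f₂ Ψ₁ Ψ₂ V₁ V₂) {x : ℝ}
    (hx : x ∈ flat C.η) (x₁ y : ℝ) :
    surfaceStream C β₁ x₁ (x, y) = surfaceStream C β₁ x₁ (x, 0) := by
  have h1 := S.lower.head_eq y ⟨x, C.η (x, y)⟩ (S.surface_mem_lower (x, y))
  have h2 := S.lower.head_eq 0 ⟨x, C.η (x, 0)⟩ (S.surface_mem_lower (x, 0))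
  simp only [lift] at h1 h2
  simp only [surfaceStream]
  rw [h1, h2, hx y]

theorem surfaceStream_zero (S : PlanarWave C z₁ z₂ β₁ β₂ M f₁ f₂ Ψ₁ Ψ₂ V₁ V₂) {x₁ : ℝ}
    (hx : x₁ ∈ flat C.η) (y : ℝ) : surfaceStream C β₁ x₁ (x₁, y) = 0 := by
  rw [S.surfaceStream_eq hx]
  simp [surfaceStream]

theorem front (S : PlanarWave C z₁ z₂ β₁ β₂ M f₁ f₂ Ψ₁ Ψ₂ V₁ V₂) (hV : V₁ ≠ 0) {lo hi : ℝ}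
    (hη : ∀ q, C.η q ∈ Icc lo hi) (x₁ : ℝ) :
    Front V₁ M lo hi C.η (surfaceVelocity C) (surfaceStream C β₁ x₁) where
  V_ne := hV
  η_C1 := S.steady.η_C1
  b_C1 := PlanarLayer.contDiff_trace S.lower.C1.u S.steady.η_C1 S.surface_mem_lower
  g_C1 := S.contDiff_surfaceStream x₁
  η_mem := hη
  b_le q := (S.lower.bound_closure (S.surface_mem_lower q)).1
  climb_le q := by
    rw [S.climb_eq]
    exact (S.lower.bound_closure (S.surface_mem_lower q)).2.2
  g_x := S.surfaceStream_x x₁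
  g_y q := by
    rw [S.fderiv_surfaceStream]
    ring

/-- The stream function cannot be constant on a piece of the interface which depends on `y`. -/
theorem mem_flat_of_surfaceStream_eq_zero
    (S : PlanarWave C z₁ z₂ β₁ β₂ M f₁ f₂ Ψ₁ Ψ₂ V₁ V₂) {x₁ : ℝ} {J : Set ℝ} (hJ : IsOpen J)
    (h0 : ∀ x ∈ J, ∀ y, surfaceStream C β₁ x₁ (x, y) = 0) {x : ℝ} (hx : x ∈ J) :
    x ∈ flat C.η := by
  by_contra hflat
  obtain ⟨y, hy⟩ := exists_ne_of_notMem_flat hflat (C.η (x, 0))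
  obtain ⟨ζ, hζ, hre⟩ := overlap_nonempty hy
  set D := overlap C.η ∩ Complex.re ⁻¹' J with hD
  have hDo : IsOpen D := (isOpen_overlap S.steady.η_C1.continuous).inter
    (hJ.preimage Complex.continuous_re)
  set c := C.F₁.head C.ρ₁ C.g (x₁, 0, C.η (x₁, 0)) / β₁ with hc
  have hβ := S.lower.β_ne
  -- Each point of `D` lies on the interface for some y, so Ψ₁ is constant on the open set `D`. The
  -- planar velocity then vanishes there, against β₁ ≠ 0.
  have hΨ (w : ℂ) (hw : w ∈ D) : Ψ₁ w = c := by
    obtain ⟨y', hy'⟩ := S.exists_surface hw.1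
    have hl : lift y' w = (w.re, y', C.η (w.re, y')) := by rw [lift, hy']
    have h1 := S.lower.head_eq y' w (by rw [hl]; exact S.surface_mem_lower (w.re, y'))
    have h2 := h0 w.re hw.2 y'
    rw [surfaceStream, mul_eq_zero, or_iff_left (inv_ne_zero hβ), sub_eq_zero] at h2
    rw [hl] at h1
    simp only at h2
    rw [hc, eq_div_iff hβ, ← h2, h1, mul_comm]
  refine hβ (eq_zero_of_conjVel_eq_zero hDo (S.lower.differentiableOn.mono fun w hw =>
    S.overlap_subset_lower hw.1) (fun w hw => ?_) ⟨ζ, hζ, by rw [mem_preimage, hre]; exact hx⟩)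
  have hd := S.lower.hasFDerivAt_stream (S.overlap_subset_lower hw.1)
  have hconst : HasFDerivAt Ψ₁ (0 : ℂ →L[ℝ] ℝ) w :=
    (hasFDerivAt_const c w).congr_of_eventuallyEq (by
      filter_upwards [hDo.mem_nhds hw] with v hv
      exact hΨ v hv)
  have heq := hd.unique hconst
  have e1 := DFunLike.congr_fun heq 1
  have e2 := DFunLike.congr_fun heq Complex.I
  simp at e1 e2
  apply Complex.ext
  · simpa [conjVel] using e2
  · simp [conjVel, e1]

end PlanarWave

namespace GluedWave

open PlanarWave

variable {C : Config} {z₁ z₂ β₁ β₂ M : ℝ} {f₁ f₂ : ℂ → ℂ} {Ψ₁ Ψ₂ : ℂ → ℝ} {V₁ V₂ m : ℝ}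

/-- The glued horizontal velocity, extended continuously by means of retractions. -/
noncomputable def extVel (C : Config) (β m : ℝ) (f₁ f₂ : ℂ → ℂ) (lo hi : ℝ) (r : ℝ → ℝ)
    (q : ℝ × ℝ) : ℝ :=
  (glue C.η m f₁ f₂ ⟨r q.1, max lo (min hi q.2)⟩).re + β * max lo (min hi q.2)

theorem extVel_apply {lo hi : ℝ} {r : ℝ → ℝ} {x z : ℝ} (hr : r x = x) (hz : z ∈ Icc lo hi) :
    extVel C β₁ m f₁ f₂ lo hi r (x, z) = (glue C.η m f₁ f₂ ⟨x, z⟩).re + β₁ * z := by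
  simp only [extVel, hr]
  rw [min_eq_right hz.2, max_eq_right hz.1]

theorem continuous_extVel (S : GluedWave C z₁ z₂ β₁ β₂ M f₁ f₂ Ψ₁ Ψ₂ V₁ V₂ m) {lo hi : ℝ}
    (hlo : -C.h₁ ≤ lo) (hlohi : lo ≤ hi) (hhi : hi ≤ C.h₂) {r : ℝ → ℝ} (hr : Continuous r)
    (hrm : ∀ x, r x ∈ closure (flat C.η)ᶜ) : Continuous (extVel C β₁ m f₁ f₂ lo hi r) := by
  refine Continuous.add ?_ (by fun_prop)
  refine Complex.continuous_re.comp (S.continuousOn_glue.comp_continuous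
    (continuous_complex_mk (by fun_prop) (by fun_prop)) fun q => ⟨hrm _, ?_, ?_⟩)
  · exact hlo.trans (le_max_left _ _)
  · exact max_le (hlohi.trans hhi) ((min_le_left _ _).trans hhi)

theorem surfaceVelocity_eq (S : GluedWave C z₁ z₂ β₁ β₂ M f₁ f₂ Ψ₁ Ψ₂ V₁ V₂ m) {lo hi : ℝ}
    (hη : ∀ q, C.η q ∈ Icc lo hi) {r : ℝ → ℝ} {x : ℝ} (hr : r x = x)
    (hx : x ∈ closure (flat C.η)ᶜ) (y : ℝ) :
    surfaceVelocity C (x, y) = extVel C β₁ m f₁ f₂ lo hi r (x, C.η (x, y)) := by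
  rw [extVel_apply hr (hη _), S.glue_surface hx]
  exact S.lower.u_eq y ⟨x, C.η (x, y)⟩ (S.surface_mem_lower (x, y))

/-- The set where the interface is flat in `y` does not end on the right. -/
theorem mem_flat_of_lt (S : GluedWave C z₁ z₂ β₁ β₂ M f₁ f₂ Ψ₁ Ψ₂ V₁ V₂ m) {x₀ x : ℝ}
    (hx₀ : x₀ ∈ flat C.η) (hlt : x₀ < x) : x ∈ flat C.η := by
  by_contra hx
  have hcl := isClosed_flat S.steady.η_C1.continuous
  obtain ⟨lo, hlo, hηlo⟩ := S.steady.separated_below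
  obtain ⟨hi, hhi, hηhi⟩ := S.steady.separated_above
  have hη (q : ℝ × ℝ) : C.η q ∈ Icc lo hi := ⟨hηlo q, hηhi q⟩
  have hlohi : lo ≤ hi := (hηlo 0).trans (hηhi 0)
  set A := flat C.η ∩ Iic x with hA
  have hAne : A.Nonempty := ⟨x₀, hx₀, hlt.le⟩
  have hAb : BddAbove A := ⟨x, fun t ht => ht.2⟩
  -- `x₁` is the last flat column before x. On it the level is constant in y, because η is, and is
  -- normalized to 0.
  set x₁ := sSup A with hx₁
  have hx₁A : x₁ ∈ A := (hcl.inter isClosed_Iic).csSup_mem hAne hAb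
  have hx₁x : x₁ < x := lt_of_le_of_ne hx₁A.2 fun h => hx (h ▸ hx₁A.1)
  have hgap (t : ℝ) (ht : x₁ < t) (htx : t ≤ x) : t ∉ flat C.η := fun h =>
    absurd (le_csSup hAb ⟨h, htx⟩) (not_le.2 ht)
  have hzero := S.surfaceStream_zero hx₁A.1
  -- Without transverse velocity the surface stream function does not depend on x, so it vanishes
  -- everywhere.
  by_cases hV : V₁ = 0
  · refine hx (S.mem_flat_of_surfaceStream_eq_zero (x₁ := x₁) isOpen_univ (fun t _ y => ?_)
      (mem_univ x))
    have hd (s : ℝ) : HasDerivAt (fun s => surfaceStream C β₁ x₁ (s, y)) 0 s := by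
      refine (hasDerivAt_fst (S.contDiff_surfaceStream x₁) s y).congr_deriv ?_
      rw [S.surfaceStream_x, hV, neg_zero, zero_mul]
    rw [← hzero y]
    exact is_const_of_deriv_eq_zero (fun t => (hd t).differentiableAt) (fun t => (hd t).deriv) t x₁
  have F := S.front hV hη x₁
  -- The gap of non-flat columns either ends at a next flat column `x₂` or is a half-line. The
  -- retraction onto the closed gap makes the glued velocity continuous on the whole plane.
  by_cases hB : (flat C.η ∩ Ici x).Nonempty
  · set x₂ := sInf (flat C.η ∩ Ici x) with hx₂
    have hBb : BddBelow (flat C.η ∩ Ici x) := ⟨x, fun t ht => ht.2⟩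
    have hx₂B : x₂ ∈ flat C.η ∩ Ici x := (hcl.inter isClosed_Ici).csInf_mem hB hBb
    have hxx₂ : x < x₂ := lt_of_le_of_ne hx₂B.2 fun h => hx (h ▸ hx₂B.1)
    have hsub : Icc x₁ x₂ ⊆ closure (flat C.η)ᶜ := by
      rw [← closure_Ioo (hx₁x.trans hxx₂).ne]
      refine closure_mono fun t ht => ?_
      rcases le_total t x with h | h
      · exact hgap t ht.1 h
      · exact fun h' => absurd (csInf_le hBb ⟨h', h⟩) (not_le.2 ht.2)
    set r : ℝ → ℝ := fun t => max x₁ (min x₂ t) with hr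
    have hle : x₁ ≤ x₂ := (hx₁x.trans hxx₂).le
    have hrx {t : ℝ} (ht : t ∈ Icc x₁ x₂) : r t = t := by
      simp only [hr]
      rw [min_eq_right ht.2, max_eq_right ht.1]
    have hU := S.continuous_extVel hlo.le hlohi hhi.le (r := r) (by fun_prop)
      fun t => hsub ⟨le_max_left _ _, max_le hle (min_le_left _ _)⟩
    refine hx (S.mem_flat_of_surfaceStream_eq_zero (x₁ := x₁) isOpen_Ioo (fun t ht y => ?_)
      ⟨hx₁x, hxx₂⟩)
    exact F.eq_zero_of_Icc hU (fun t ht y => S.surfaceVelocity_eq hη (hrx ht) (hsub ht) y) hzero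
      (fun y => S.surfaceStream_eq hx₂B.1 x₁ y) (Ioo_subset_Icc_self ht) y
  · have hIoi (t : ℝ) (ht : x₁ < t) : t ∉ flat C.η := by
      rcases le_total t x with h | h
      · exact hgap t ht h
      · exact fun h' => hB ⟨t, h', h⟩
    have hsub : Ici x₁ ⊆ closure (flat C.η)ᶜ := by
      rw [← closure_Ioi]
      exact closure_mono hIoi
    set r : ℝ → ℝ := fun t => max x₁ t with hr
    have hrx {t : ℝ} (ht : x₁ ≤ t) : r t = t := max_eq_right ht
    have hU := S.continuous_extVel hlo.le hlohi hhi.le (r := r) (by fun_prop)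
      fun t => hsub (show x₁ ≤ max x₁ t from le_max_left _ _)
    have hβ := S.lower.β_ne
    have hM : 0 ≤ M := (abs_nonneg _).trans (S.abs_im_glue_le (ζ := ⟨0, -C.h₁⟩) le_rfl
      (by simp only; linarith))
    -- Far away, at all heights reached by the interface, the glued function has derivative at most
    -- |β₁|/2, so the shear keeps the sign of β₁.
    obtain ⟨L, hL, hfar⟩ := exists_norm_deriv_le_of_half_strip hlo hlohi hhi
      (half_pos (abs_pos.2 hβ)) hM
    have hfar' := hfar (glue C.η m f₁ f₂) x₁
      (fun w hw => (S.differentiableAt_glue (hIoi _ hw.1) hw.2.1 hw.2.2).differentiableWithinAt)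
      (S.continuousOn_glue.mono fun w hw => ⟨hsub (mem_Ici_of_Ioi hw.1), hw.2⟩)
      (fun w hw => S.abs_im_glue_le hw.2.1 hw.2.2) (fun w hw => S.im_glue_wall hw.2)
    refine hx (S.mem_flat_of_surfaceStream_eq_zero (x₁ := x₁) isOpen_Ioi (fun t ht y => ?_) hx₁x)
    refine F.eq_zero_of_Ici hU hβ (show x₁ < x₁ + L by linarith)
      (fun t ht y => S.surfaceVelocity_eq hη (hrx ht) (hsub ht) y) hzero
      (fun t ht z hz z' hz' hzz' => ?_) (le_of_lt ht) y
    have htx : x₁ < t := by linarith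
    rw [extVel_apply (hrx htx.le) hz, extVel_apply (hrx htx.le) hz']
    have hconv : Convex ℝ ({t} ×ℂ Icc lo hi) := by
      intro a ha b hb s s' hs hs' hss
      have ha1 : a.re = t := ha.1
      have hb1 : b.re = t := hb.1
      refine ⟨?_, ?_⟩
      · simp [ha1, hb1, ← add_mul, hss]
      · have := convex_Icc lo hi ha.2 hb.2 hs hs' hss
        simpa using this
    have hmv := Convex.norm_image_sub_le_of_norm_deriv_le (f := glue C.η m f₁ f₂)
      (s := {t} ×ℂ Icc lo hi) (C := |β₁| / 2) (x := ⟨t, z⟩) (y := ⟨t, z'⟩)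
      (fun w hw => S.differentiableAt_glue
        (hIoi _ (by rw [show w.re = t from hw.1]; exact htx)) (hlo.trans_le hw.2.1)
        (hw.2.2.trans_lt hhi))
      (fun w hw => by
        have := hfar' t ht w.im hw.2
        rwa [← show w.re = t from hw.1, Complex.re_add_im] at this)
      hconv ⟨rfl, hz⟩ ⟨rfl, hz'⟩
    have hn : ‖(⟨t, z'⟩ : ℂ) - ⟨t, z⟩‖ = z' - z := by
      have : (⟨t, z'⟩ : ℂ) - ⟨t, z⟩ = ((z' - z : ℝ) : ℂ) * Complex.I := by
        apply Complex.ext <;> simp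
      rw [this, norm_mul, Complex.norm_I, mul_one, Complex.norm_real,
        Real.norm_of_nonneg (by linarith)]
    rw [hn] at hmv
    refine le_trans ?_ ((Complex.abs_re_le_norm _).trans hmv)
    rw [Complex.sub_re]
    refine le_of_eq (congrArg _ ?_)
    ring

end GluedWave


/-! ### Vertical vorticity and rotation of the axes. -/

/-- A bounded velocity field has no constant vertical vorticity. -/
theorem Separated.vertical_vorticity_eq_zero {lo hi : ℝ × ℝ → ℝ} {z₀ M c : ℝ}
    (S : Separated lo hi z₀) {u v : ℝ × ℝ × ℝ → ℝ} (hu : ContDiffOn ℝ 1 u (closure (slab lo hi)))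
    (hv : ContDiffOn ℝ 1 v (closure (slab lo hi))) (hbu : ∀ p ∈ slab lo hi, |u p| ≤ M)
    (hbv : ∀ p ∈ slab lo hi, |v p| ≤ M) (hc : ∀ p ∈ slab lo hi, dx v p - dy u p = c) : c = 0 := by
  set j : ℝ × ℝ → ℝ × ℝ × ℝ := fun q => (q.1, q.2, z₀) with hj
  set j' : ℝ × ℝ →L[ℝ] ℝ × ℝ × ℝ := (ContinuousLinearMap.fst ℝ ℝ ℝ).prod
    ((ContinuousLinearMap.snd ℝ ℝ ℝ).prod 0) with hj'
  have hjd (q : ℝ × ℝ) : HasFDerivAt j j' q :=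
    hasFDerivAt_fst.prodMk (hasFDerivAt_snd.prodMk (hasFDerivAt_const z₀ q))
  have hjm (q : ℝ × ℝ) : j q ∈ slab lo hi := S.mem_plane _ _
  have hvd (q : ℝ × ℝ) : HasFDerivAt (fun q => v (j q)) ((fderiv ℝ v (j q)).comp j') q :=
    (S.differentiableAt hv (hjm q)).hasFDerivAt.comp q (hjd q)
  have hud (q : ℝ × ℝ) : HasFDerivAt (fun q => -u (j q)) (-((fderiv ℝ u (j q)).comp j')) q :=
    ((S.differentiableAt hu (hjm q)).hasFDerivAt.comp q (hjd q)).neg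
  have hdiv (q : ℝ × ℝ) : ((fderiv ℝ v (j q)).comp j') (1, 0)
      + (-((fderiv ℝ u (j q)).comp j')) (0, 1) = c := by
    rw [← hc _ (hjm q)]
    simp [dx, dy, hj', sub_eq_add_neg]
  have hcv : Continuous fun q => v (j q) :=
    continuous_iff_continuousAt.2 fun q => (hvd q).continuousAt
  have hcu : Continuous fun q => -u (j q) :=
    continuous_iff_continuousAt.2 fun q => (hud q).continuousAt
  have hbd {φ : ℝ → ℝ} (hφ : ∀ t, |φ t| ≤ M) {R : ℝ} (hR : 0 ≤ R) :
      |∫ t in (0 : ℝ)..R, φ t| ≤ M * R := by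
    have := intervalIntegral.norm_integral_le_of_norm_le_const (a := 0) (b := R) (f := φ) (C := M)
      (fun t _ => hφ t)
    rwa [sub_zero, abs_of_nonneg hR] at this
  -- Green's theorem on a square of side `R` in the plane z = z₀: the flux cR² equals a circulation
  -- of size at most 4MR.
  have key (R : ℝ) (hR : 0 ≤ R) : |c * R * R| ≤ 4 * M * R := by
    have h := integral2_divergence_prod_of_hasFDerivAt (fun q => v (j q)) (fun q => -u (j q))
      _ _ 0 0 R R hcv.continuousOn hcu.continuousOn (fun q _ => hvd q) (fun q _ => hud q)
      (by
        simp only [hdiv]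
        exact (continuous_const.continuousOn).integrableOn_compact
          (isCompact_uIcc.prod isCompact_uIcc))
    simp only [hdiv, intervalIntegral.integral_const, sub_zero, smul_eq_mul] at h
    have e1 := hbd (φ := fun x => -u (j (x, R))) (fun t => by
      rw [abs_neg]; exact hbu _ (hjm _)) hR
    have e2 := hbd (φ := fun x => -u (j (x, 0))) (fun t => by
      rw [abs_neg]; exact hbu _ (hjm _)) hR
    have e3 := hbd (φ := fun y => v (j (R, y))) (fun t => hbv _ (hjm _)) hR
    have e4 := hbd (φ := fun y => v (j (0, y))) (fun t => hbv _ (hjm _)) hR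
    rw [show c * R * R = R * (R * c) by ring, h]
    rw [abs_le] at e1 e2 e3 e4 ⊢
    constructor <;> linarith [e1.1, e1.2, e2.1, e2.2, e3.1, e3.2, e4.1, e4.2]
  by_contra hne
  have hpos := abs_pos.2 hne
  have hM : 0 ≤ M := (abs_nonneg _).trans (hbu _ (hjm (0, 0)))
  set R := 4 * M / |c| + 1 with hR
  have hR0 : 0 < R := by positivity
  have h1 := key R hR0.le
  rw [abs_mul, abs_mul, abs_of_pos hR0] at h1
  have h2 : |c| * R ≤ 4 * M := le_of_mul_le_mul_right h1 hR0
  have h3 : |c| * R = 4 * M + |c| := by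
    rw [hR]; field_simp
  linarith

section Rotation

/-- Rotation about the vertical axis as a linear map. -/
noncomputable def rotCLM (θ : ℝ) : ℝ × ℝ × ℝ →L[ℝ] ℝ × ℝ × ℝ :=
  (covector (Real.cos θ) (-Real.sin θ) 0).prod
    ((covector (Real.sin θ) (Real.cos θ) 0).prod (covector 0 0 1))

theorem rotCLM_apply (θ : ℝ) (p : ℝ × ℝ × ℝ) : rotCLM θ p = rotZ θ p := by
  simp [rotCLM, rotZ, covector_apply, sub_eq_add_neg]

theorem hasFDerivAt_rotZ (θ : ℝ) (p : ℝ × ℝ × ℝ) : HasFDerivAt (rotZ θ) (rotCLM θ) p := by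
  have : rotZ θ = rotCLM θ := funext fun p => (rotCLM_apply θ p).symm
  rw [this]
  exact (rotCLM θ).hasFDerivAt

theorem contDiff_rotZ (θ : ℝ) : ContDiff ℝ 1 (rotZ θ) := by
  unfold rotZ
  fun_prop

theorem hasFDerivAt_comp_rotZ {f : ℝ × ℝ × ℝ → ℝ} {θ : ℝ} {p : ℝ × ℝ × ℝ}
    (hf : DifferentiableAt ℝ f (rotZ θ p)) :
    HasFDerivAt (fun p => f (rotZ θ p)) (covector
      (Real.cos θ * dx f (rotZ θ p) + Real.sin θ * dy f (rotZ θ p))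
      (-Real.sin θ * dx f (rotZ θ p) + Real.cos θ * dy f (rotZ θ p)) (dz f (rotZ θ p))) p := by
  have h := (hasFDerivAt_covector hf).comp p (hasFDerivAt_rotZ θ p)
  refine h.congr_fderiv ?_
  refine ContinuousLinearMap.ext fun k => ?_
  simp only [ContinuousLinearMap.comp_apply, rotCLM_apply, covector_apply, rotZ]
  ring

theorem HasFDerivAt.partials {f : ℝ × ℝ × ℝ → ℝ} {a b c : ℝ} {p : ℝ × ℝ × ℝ}
    (h : HasFDerivAt f (covector a b c) p) : dx f p = a ∧ dy f p = b ∧ dz f p = c := by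
  simp [dx, dy, dz, h.fderiv, covector_apply]

theorem hasFDerivAt_comb_rotZ {f h : ℝ × ℝ × ℝ → ℝ} {θ : ℝ} {p : ℝ × ℝ × ℝ}
    (hf : DifferentiableAt ℝ f (rotZ θ p)) (hh : DifferentiableAt ℝ h (rotZ θ p)) (a b : ℝ) :
    HasFDerivAt (fun p => a * f (rotZ θ p) + b * h (rotZ θ p)) (covector
      (a * (Real.cos θ * dx f (rotZ θ p) + Real.sin θ * dy f (rotZ θ p))
        + b * (Real.cos θ * dx h (rotZ θ p) + Real.sin θ * dy h (rotZ θ p)))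
      (a * (-Real.sin θ * dx f (rotZ θ p) + Real.cos θ * dy f (rotZ θ p))
        + b * (-Real.sin θ * dx h (rotZ θ p) + Real.cos θ * dy h (rotZ θ p)))
      (a * dz f (rotZ θ p) + b * dz h (rotZ θ p))) p := by
  refine (((hasFDerivAt_comp_rotZ hf).const_mul a).add
    ((hasFDerivAt_comp_rotZ hh).const_mul b)).congr_fderiv ?_
  refine ContinuousLinearMap.ext fun k => ?_
  simp only [add_apply, smul_apply, covector_apply, smul_eq_mul]
  ring

theorem rotZ_neg (θ : ℝ) (a : ℝ × ℝ × ℝ) : rotZ (-θ) a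
    = (Real.cos θ * a.1 + Real.sin θ * a.2.1, -Real.sin θ * a.1 + Real.cos θ * a.2.1, a.2.2) := by
  simp [rotZ]

namespace Fluid

variable {F : Fluid} {Ω : Set (ℝ × ℝ × ℝ)} {θ : ℝ}

theorem inAxes_u : (F.inAxes θ).u
    = fun p => Real.cos θ * F.u (rotZ θ p) + Real.sin θ * F.v (rotZ θ p) := by
  simp [Fluid.inAxes, rotZ_neg]

theorem inAxes_v : (F.inAxes θ).v
    = fun p => -Real.sin θ * F.u (rotZ θ p) + Real.cos θ * F.v (rotZ θ p) := by
  simp [Fluid.inAxes, rotZ_neg]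

theorem inAxes_w : (F.inAxes θ).w = fun p => F.w (rotZ θ p) := rfl

theorem inAxes_P : (F.inAxes θ).P = fun p => F.P (rotZ θ p) := rfl

theorem IsC1On.inAxes (h : F.IsC1On Ω) (θ : ℝ) : (F.inAxes θ).IsC1On (rotZ θ ⁻¹' Ω) := by
  have hm : MapsTo (rotZ θ) (closure (rotZ θ ⁻¹' Ω)) (closure Ω) := fun p hp =>
    (contDiff_rotZ θ).continuous.closure_preimage_subset Ω hp
  have hr := (contDiff_rotZ θ).contDiffOn (s := closure (rotZ θ ⁻¹' Ω))
  have hu := h.u.comp hr hm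
  have hv := h.v.comp hr hm
  refine ⟨?_, ?_, h.w.comp hr hm, h.P.comp hr hm⟩
  · exact ((contDiffOn_const.mul hu).add (contDiffOn_const.mul hv)).congr fun p _ => congrFun inAxes_u p
  · exact ((contDiffOn_const.mul hu).add (contDiffOn_const.mul hv)).congr fun p _ => congrFun inAxes_v p

theorem BoundedVelocityOn.inAxes (h : F.BoundedVelocityOn Ω) (θ : ℝ) :
    (F.inAxes θ).BoundedVelocityOn (rotZ θ ⁻¹' Ω) := by
  obtain ⟨M, hM⟩ := h
  refine ⟨2 * M, fun p hp => ?_⟩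
  obtain ⟨h1, h2, h3⟩ := hM _ hp
  have hc := Real.abs_cos_le_one θ
  have hs := Real.abs_sin_le_one θ
  have key {a b x y : ℝ} (ha : |a| ≤ 1) (hb : |b| ≤ 1) (hx : |x| ≤ M) (hy : |y| ≤ M) :
      |a * x + b * y| ≤ 2 * M := by
    refine (abs_add_le _ _).trans ?_
    rw [abs_mul, abs_mul]
    nlinarith [abs_nonneg x, abs_nonneg y, abs_nonneg a, abs_nonneg b]
  refine ⟨?_, ?_, ?_⟩
  · rw [inAxes_u]; exact key hc hs h1 h2
  · rw [inAxes_v]; exact key (by rwa [abs_neg]) hc h1 h2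
  · rw [inAxes_w]; linarith [abs_nonneg (F.w (rotZ θ p))]

/-- All fields are differentiable at a point. -/
structure DiffAt (F : Fluid) (p : ℝ × ℝ × ℝ) : Prop where
  u : DifferentiableAt ℝ F.u p
  v : DifferentiableAt ℝ F.v p
  w : DifferentiableAt ℝ F.w p
  P : DifferentiableAt ℝ F.P p

theorem IsC1On.diffAt (h : F.IsC1On Ω) (hΩ : IsOpen Ω) {p : ℝ × ℝ × ℝ} (hp : p ∈ Ω) :
    F.DiffAt p := by
  have hn : closure Ω ∈ 𝓝 p := mem_of_superset (hΩ.mem_nhds hp) subset_closure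
  exact ⟨(h.u.contDiffAt hn).differentiableAt one_ne_zero,
    (h.v.contDiffAt hn).differentiableAt one_ne_zero,
    (h.w.contDiffAt hn).differentiableAt one_ne_zero,
    (h.P.contDiffAt hn).differentiableAt one_ne_zero⟩

theorem vorticity_inAxes {p : ℝ × ℝ × ℝ} (h : F.DiffAt (rotZ θ p)) :
    (F.inAxes θ).vorticity p = rotZ (-θ) (F.vorticity (rotZ θ p)) := by
  obtain ⟨u1, u2, u3⟩ := HasFDerivAt.partials (hasFDerivAt_comb_rotZ h.u h.v (Real.cos θ) (Real.sin θ))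
  obtain ⟨v1, v2, v3⟩ := HasFDerivAt.partials (hasFDerivAt_comb_rotZ h.u h.v (-Real.sin θ) (Real.cos θ))
  obtain ⟨w1, w2, -⟩ := HasFDerivAt.partials (hasFDerivAt_comp_rotZ h.w)
  have hcs := Real.sin_sq_add_cos_sq θ
  simp only [vorticity, inAxes_u, inAxes_v, inAxes_w, u2, u3, v1, v3, w1, w2, rotZ_neg,
    Prod.mk.injEq]
  refine ⟨by ring, by ring, ?_⟩
  linear_combination (dx F.v (rotZ θ p) - dy F.u (rotZ θ p)) * hcs

theorem SolvesEuler.inAxes {ρ g : ℝ} (h : F.SolvesEuler ρ g Ω) (hF : ∀ p ∈ Ω, F.DiffAt p)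
    (θ : ℝ) : (F.inAxes θ).SolvesEuler ρ g (rotZ θ ⁻¹' Ω) := by
  have hcs := Real.sin_sq_add_cos_sq θ
  refine ⟨fun p hp => ?_, fun p hp => ?_, fun p hp => ?_, fun p hp => ?_⟩
  all_goals
    have hd := hF _ hp
    obtain ⟨u1, u2, u3⟩ := HasFDerivAt.partials
      (hasFDerivAt_comb_rotZ hd.u hd.v (Real.cos θ) (Real.sin θ))
    obtain ⟨v1, v2, v3⟩ := HasFDerivAt.partials
      (hasFDerivAt_comb_rotZ hd.u hd.v (-Real.sin θ) (Real.cos θ))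
    obtain ⟨w1, w2, w3⟩ := HasFDerivAt.partials (hasFDerivAt_comp_rotZ hd.w)
    obtain ⟨P1, P2, P3⟩ := HasFDerivAt.partials (hasFDerivAt_comp_rotZ hd.P)
    have e1 := h.momentum_x _ hp
    have e2 := h.momentum_y _ hp
    have e3 := h.momentum_z _ hp
    have e4 := h.incompressible _ hp
    simp only [inAxes_u, inAxes_v, inAxes_w, inAxes_P, u1, u2, u3, v1, v2, v3, w1, w2, w3, P1, P2,
      P3]
    clear u1 u2 u3 v1 v2 v3 w1 w2 w3 P1 P2 P3 hd
    generalize rotZ θ p = q at *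
    generalize Real.cos θ = c at *
    generalize Real.sin θ = s at *
  · linear_combination c * e1 + s * e2 + ρ * (F.u q * (c * dx F.u q + s * dx F.v q)
      + F.v q * (c * dy F.u q + s * dy F.v q)) * hcs
  · linear_combination -s * e1 + c * e2 + ρ * (F.u q * (-s * dx F.u q + c * dx F.v q)
      + F.v q * (-s * dy F.u q + c * dy F.v q)) * hcs
  · linear_combination e3 + ρ * (F.u q * dx F.w q + F.v q * dy F.w q) * hcs
  · linear_combination e4 + (dx F.u q + dy F.v q) * hcs

end Fluid

end Rotation

namespace Config

theorem isOpen_lower {C : Config} (hη : Continuous C.η) : IsOpen C.lower := by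
  have e1 : IsOpen {p : ℝ × ℝ × ℝ | -C.h₁ < p.2.2} := isOpen_lt (by fun_prop) (by fun_prop)
  have e2 : IsOpen {p : ℝ × ℝ × ℝ | p.2.2 < C.η (p.1, p.2.1)} :=
    isOpen_lt (by fun_prop) (by fun_prop)
  exact e1.inter e2

theorem isOpen_upper {C : Config} (hη : Continuous C.η) : IsOpen C.upper := by
  have e1 : IsOpen {p : ℝ × ℝ × ℝ | C.η (p.1, p.2.1) < p.2.2} :=
    isOpen_lt (by fun_prop) (by fun_prop)
  have e2 : IsOpen {p : ℝ × ℝ × ℝ | p.2.2 < C.h₂} := isOpen_lt (by fun_prop) (by fun_prop)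
  exact e1.inter e2

/-- Rotation of the horizontal plane as a linear map. -/
noncomputable def rotPlane (θ : ℝ) : ℝ × ℝ →L[ℝ] ℝ × ℝ :=
  (Real.cos θ • ContinuousLinearMap.fst ℝ ℝ ℝ - Real.sin θ • ContinuousLinearMap.snd ℝ ℝ ℝ).prod
    (Real.sin θ • ContinuousLinearMap.fst ℝ ℝ ℝ + Real.cos θ • ContinuousLinearMap.snd ℝ ℝ ℝ)

theorem fderiv_apply_eq (L : ℝ × ℝ →L[ℝ] ℝ) (a b : ℝ) : L (a, b) = a * L (1, 0) + b * L (0, 1) := by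
  have : ((a, b) : ℝ × ℝ) = a • ((1, 0) : ℝ × ℝ) + b • (0, 1) := by ext <;> simp
  rw [this]
  simp only [map_add, map_smul, smul_eq_mul]

theorem IsSteadyWave.inAxes {C : Config} (h : C.IsSteadyWave) (θ : ℝ) :
    (C.inAxes θ).IsSteadyWave := by
  have hη := h.η_C1.continuous
  have hcs := Real.sin_sq_add_cos_sq θ
  have hfd (x y : ℝ) (k : ℝ × ℝ) : fderiv ℝ (C.inAxes θ).η (x, y) k
      = fderiv ℝ C.η (rotPlane θ (x, y)) (rotPlane θ k) :=
    fderiv_comp_linear h.η_C1 (rotPlane θ) (x, y) k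
  have hx (q : ℝ × ℝ) : fderiv ℝ C.η q (rotPlane θ (1, 0))
      = Real.cos θ * fderiv ℝ C.η q (1, 0) + Real.sin θ * fderiv ℝ C.η q (0, 1) := by
    rw [← fderiv_apply_eq]; simp [rotPlane]
  have hy (q : ℝ × ℝ) : fderiv ℝ C.η q (rotPlane θ (0, 1))
      = -Real.sin θ * fderiv ℝ C.η q (1, 0) + Real.cos θ * fderiv ℝ C.η q (0, 1) := by
    rw [← fderiv_apply_eq]; simp [rotPlane]
  refine ⟨h.h₁_pos, h.h₂_pos, h.ρ₁_pos, h.ρ₂_pos, h.g_pos, h.η_C1.comp (rotPlane θ).contDiff,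
    ?_, ?_, h.C1_lower.inAxes θ, h.C1_upper.inAxes θ,
    h.euler_lower.inAxes (fun p hp => h.C1_lower.diffAt (isOpen_lower hη) hp) θ,
    h.euler_upper.inAxes (fun p hp => h.C1_upper.diffAt (isOpen_upper hη) hp) θ,
    fun x y => ?_, fun x y => ?_, fun x y => h.dynamic _ _, fun x y => h.bed _ _,
    fun x y => h.lid _ _⟩
  · obtain ⟨a, ha, hb⟩ := h.separated_below
    exact ⟨a, ha, fun q => hb _⟩
  · obtain ⟨a, ha, hb⟩ := h.separated_above
    exact ⟨a, ha, fun q => hb _⟩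
  · have hk := h.kinematic_lower (Real.cos θ * x - Real.sin θ * y) (Real.sin θ * x + Real.cos θ * y)
    rw [hfd, hfd, hx, hy]
    show (C.F₁.inAxes θ).u _ * _ + (C.F₁.inAxes θ).v _ * _ = (C.F₁.inAxes θ).w _
    simp only [Fluid.inAxes_u, Fluid.inAxes_v, Fluid.inAxes_w]
    set p := rotZ θ (x, y, (C.inAxes θ).η (x, y))
    set q := rotPlane θ (x, y)
    have hk' : C.F₁.u p * fderiv ℝ C.η q (1, 0) + C.F₁.v p * fderiv ℝ C.η q (0, 1)
      = C.F₁.w p := hk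
    linear_combination hk' + (C.F₁.u p * fderiv ℝ C.η q (1, 0)
      + C.F₁.v p * fderiv ℝ C.η q (0, 1)) * hcs
  · have hk := h.kinematic_upper (Real.cos θ * x - Real.sin θ * y) (Real.sin θ * x + Real.cos θ * y)
    rw [hfd, hfd, hx, hy]
    show (C.F₂.inAxes θ).u _ * _ + (C.F₂.inAxes θ).v _ * _ = (C.F₂.inAxes θ).w _
    simp only [Fluid.inAxes_u, Fluid.inAxes_v, Fluid.inAxes_w]
    set p := rotZ θ (x, y, (C.inAxes θ).η (x, y))
    set q := rotPlane θ (x, y)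
    have hk' : C.F₂.u p * fderiv ℝ C.η q (1, 0) + C.F₂.v p * fderiv ℝ C.η q (0, 1)
      = C.F₂.w p := hk
    linear_combination hk' + (C.F₂.u p * fderiv ℝ C.η q (1, 0)
      + C.F₂.v p * fderiv ℝ C.η q (0, 1)) * hcs

end Config


/-! ### Conclusion for waves with transverse vorticity, and the theorem. -/

namespace Config.IsSteadyWave

theorem exists_separated_lower {C : Config} (h : C.IsSteadyWave) :
    ∃ z₁, Separated (fun _ => -C.h₁) C.η z₁ := by
  obtain ⟨a, ha, hη⟩ := h.separated_below
  exact ⟨(-C.h₁ + a) / 2, continuous_const, h.η_C1.continuous, fun q => by linarith,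
    fun q => by linarith [hη q]⟩

theorem exists_separated_upper {C : Config} (h : C.IsSteadyWave) :
    ∃ z₂, Separated C.η (fun _ => C.h₂) z₂ := by
  obtain ⟨b, hb, hη⟩ := h.separated_above
  exact ⟨(C.h₂ + b) / 2, h.η_C1.continuous, continuous_const, fun q => by linarith [hη q],
    fun q => by linarith⟩

end Config.IsSteadyWave

/-- A steady wave with bounded velocity and constant nonzero vorticity in the `y`-direction. -/
structure ShearWave (C : Config) (β₁ β₂ : ℝ) : Prop where
  steady : C.IsSteadyWave
  vort₁ : ∀ p ∈ C.lower, C.F₁.vorticity p = (0, β₁, 0)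
  vort₂ : ∀ p ∈ C.upper, C.F₂.vorticity p = (0, β₂, 0)
  β₁_ne : β₁ ≠ 0
  β₂_ne : β₂ ≠ 0
  bdd₁ : C.F₁.BoundedVelocityOn C.lower
  bdd₂ : C.F₂.BoundedVelocityOn C.upper

namespace ShearWave

variable {C : Config} {β₁ β₂ : ℝ}

theorem exists_planarWave (W : ShearWave C β₁ β₂) :
    ∃ z₁ z₂ M f₁ f₂ Ψ₁ Ψ₂ V₁ V₂, PlanarWave C z₁ z₂ β₁ β₂ M f₁ f₂ Ψ₁ Ψ₂ V₁ V₂ := by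
  obtain ⟨z₁, s₁⟩ := W.steady.exists_separated_lower
  obtain ⟨z₂, s₂⟩ := W.steady.exists_separated_upper
  obtain ⟨M₁, hM₁⟩ := W.bdd₁
  obtain ⟨M₂, hM₂⟩ := W.bdd₂
  have L₁ : Layer C.F₁ (fun _ => -C.h₁) C.η z₁ C.ρ₁ C.g β₁ (max M₁ M₂) :=
    { toSeparated := s₁
      ρ_pos := W.steady.ρ₁_pos
      β_ne := W.β₁_ne
      C1 := W.steady.C1_lower
      euler := W.steady.euler_lower
      vort := W.vort₁
      bound := fun p hp => ⟨(hM₁ p hp).1.trans (le_max_left _ _),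
        (hM₁ p hp).2.1.trans (le_max_left _ _), (hM₁ p hp).2.2.trans (le_max_left _ _)⟩ }
  have L₂ : Layer C.F₂ C.η (fun _ => C.h₂) z₂ C.ρ₂ C.g β₂ (max M₁ M₂) :=
    { toSeparated := s₂
      ρ_pos := W.steady.ρ₂_pos
      β_ne := W.β₂_ne
      C1 := W.steady.C1_upper
      euler := W.steady.euler_upper
      vort := W.vort₂
      bound := fun p hp => ⟨(hM₂ p hp).1.trans (le_max_right _ _),
        (hM₂ p hp).2.1.trans (le_max_right _ _), (hM₂ p hp).2.2.trans (le_max_right _ _)⟩ }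
  obtain ⟨f₁, Ψ₁, V₁, S₁⟩ := L₁.exists_planarLayer
  obtain ⟨f₂, Ψ₂, V₂, S₂⟩ := L₂.exists_planarLayer
  exact ⟨z₁, z₂, max M₁ M₂, f₁, f₂, Ψ₁, Ψ₂, V₁, V₂, W.steady, S₁, S₂⟩

theorem mem_flat_of_lt (W : ShearWave C β₁ β₂) {x₀ x : ℝ} (hx₀ : x₀ ∈ flat C.η) (hlt : x₀ < x) :
    x ∈ flat C.η := by
  obtain ⟨z₁, z₂, M, f₁, f₂, Ψ₁, Ψ₂, V₁, V₂, S⟩ := W.exists_planarWave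
  by_contra hx
  obtain ⟨y, hy⟩ := exists_ne_of_notMem_flat hx (C.η (x, 0))
  obtain ⟨ζ, hζ, -⟩ := PlanarWave.overlap_nonempty hy
  -- In the affine case η depends on y alone, so one flat column makes all columns flat.
  rcases S.affine_or_proportional ⟨ζ, hζ⟩ with ⟨w, hw, h₁, h₂⟩ | ⟨-, hm, heq⟩
  · obtain ⟨-, -, -, H, -, -, hH⟩ := S.trivialShear_of_affine hw h₁ h₂
    refine hx fun y => ?_
    rw [hH, hH, ← hH x₀, ← hH x₀, hx₀ y]
  · exact hx (GluedWave.mem_flat_of_lt ⟨S, hm, heq⟩ hx₀ hlt)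

/-- A half turn exchanges left and right, so propagation of flatness to the right also gives
propagation to the left. -/
theorem inAxes_pi (W : ShearWave C β₁ β₂) : ShearWave (C.inAxes Real.pi) (-β₁) (-β₂) where
  steady := W.steady.inAxes _
  vort₁ p hp := by
    have h := Fluid.vorticity_inAxes (F := C.F₁) (θ := Real.pi) (p := p)
      (W.steady.C1_lower.diffAt (Config.isOpen_lower W.steady.η_C1.continuous) hp)
    rw [W.vort₁ _ hp] at h
    exact h.trans (by simp [rotZ_neg])
  vort₂ p hp := by
    have h := Fluid.vorticity_inAxes (F := C.F₂) (θ := Real.pi) (p := p)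
      (W.steady.C1_upper.diffAt (Config.isOpen_upper W.steady.η_C1.continuous) hp)
    rw [W.vort₂ _ hp] at h
    exact h.trans (by simp [rotZ_neg])
  β₁_ne := neg_ne_zero.2 W.β₁_ne
  β₂_ne := neg_ne_zero.2 W.β₂_ne
  bdd₁ := W.bdd₁.inAxes _
  bdd₂ := W.bdd₂.inAxes _

theorem mem_flat_of_gt (W : ShearWave C β₁ β₂) {x₀ x : ℝ} (hx₀ : x₀ ∈ flat C.η) (hlt : x < x₀) :
    x ∈ flat C.η := by
  have hη (x y : ℝ) : (C.inAxes Real.pi).η (x, y) = C.η (-x, -y) := by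
    simp [Config.inAxes]
  have h₀ : -x₀ ∈ flat (C.inAxes Real.pi).η := fun y => by
    rw [hη, hη, neg_neg, hx₀, neg_zero]
  have h := W.inAxes_pi.mem_flat_of_lt h₀ (neg_lt_neg hlt)
  intro y
  have := h (-y)
  rwa [hη, hη, neg_neg, neg_neg, neg_zero] at this

/-- Steady waves with constant transverse vorticity are two-dimensional or trivial shear flows. -/
theorem isTwoDimensional_or_isTrivialShear (W : ShearWave C β₁ β₂) :
    C.IsTwoDimensional ∨ C.ρ₁ = C.ρ₂ ∧ C.IsTrivialShear β₁ β₂ := by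
  obtain ⟨z₁, z₂, M, f₁, f₂, Ψ₁, Ψ₂, V₁, V₂, S⟩ := W.exists_planarWave
  by_cases hall : ∀ x, x ∈ flat C.η
  · exact Or.inl ⟨S.lower.isPlanarOn, S.upper.isPlanarOn, fun x => C.η (x, 0), fun x y => hall x y⟩
  right
  push Not at hall
  obtain ⟨x, hx⟩ := hall
  have hflat : flat C.η = ∅ := by
    refine eq_empty_of_forall_notMem fun x₀ hx₀ => ?_
    rcases lt_trichotomy x₀ x with h | h | h
    · exact hx (W.mem_flat_of_lt hx₀ h)
    · exact hx (h ▸ hx₀)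
    · exact hx (W.mem_flat_of_gt hx₀ h)
  obtain ⟨y, hy⟩ := exists_ne_of_notMem_flat hx (C.η (x, 0))
  obtain ⟨ζ, hζ, -⟩ := PlanarWave.overlap_nonempty hy
  rcases S.affine_or_proportional ⟨ζ, hζ⟩ with ⟨w, hw, h₁, h₂⟩ | ⟨-, hm, heq⟩
  · exact S.trivialShear_of_affine hw h₁ h₂
  · obtain ⟨h₁, h₂⟩ := GluedWave.deriv2_eq_zero_of_flat_eq_empty ⟨S, hm, heq⟩ hflat hζ
    exact S.trivialShear_of_affine hζ h₁ h₂

end ShearWave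

theorem rotZ_neg_rotZ (θ β : ℝ) : rotZ (-θ) (rotZ θ (0, β, 0)) = (0, β, 0) := by
  have hcs := Real.sin_sq_add_cos_sq θ
  rw [rotZ_neg]
  simp only [rotZ, Prod.mk.injEq, mul_zero, zero_sub, zero_add, and_true]
  exact ⟨by ring, by linear_combination β * hcs⟩

theorem exists_rotZ_eq (a b : ℝ) : ∃ θ β : ℝ, ((a, b, 0) : ℝ × ℝ × ℝ) = rotZ θ (0, β, 0) := by
  -- The rotated vector is (-β sin θ, β cos θ, 0), so β exp(iθ) must equal b - ia.
  refine ⟨Complex.arg ⟨b, -a⟩, ‖(⟨b, -a⟩ : ℂ)‖, ?_⟩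
  have h1 := Complex.norm_mul_cos_arg ⟨b, -a⟩
  have h2 := Complex.norm_mul_sin_arg ⟨b, -a⟩
  simp only [rotZ, mul_zero, zero_sub, zero_add, Prod.mk.injEq, and_true]
  exact ⟨by linarith, by linarith⟩

end InternalWave

theorem theorem2 (C : InternalWave.Config) (hC : C.IsSteadyWave)
    (ω₁ ω₂ : ℝ × ℝ × ℝ)
    (hω₁ : ∀ p ∈ C.lower, C.F₁.vorticity p = ω₁)
    (hω₂ : ∀ p ∈ C.upper, C.F₂.vorticity p = ω₂)
    (hω₁0 : ω₁ ≠ 0) (hω₂0 : ω₂ ≠ 0)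
    (hpar : ∃ c : ℝ, ω₁ = c • ω₂)
    (hb₁ : C.F₁.BoundedVelocityOn C.lower)
    (hb₂ : C.F₂.BoundedVelocityOn C.upper) :
    ∃ θ β₁ β₂ : ℝ,
      ω₁ = InternalWave.rotZ θ (0, β₁, 0) ∧ ω₂ = InternalWave.rotZ θ (0, β₂, 0) ∧
      ((C.inAxes θ).IsTwoDimensional ∨ (C.inAxes θ).IsTrivialShear β₁ β₂) ∧
      (C.ρ₁ ≠ C.ρ₂ → (C.inAxes θ).IsTwoDimensional) := by
  open InternalWave in
  obtain ⟨c, hc⟩ := hpar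
  -- One layer suffices here, since ω₁ is a multiple of ω₂.
  have hvert : ω₂.2.2 = 0 := by
    obtain ⟨z₂, s₂⟩ := hC.exists_separated_upper
    obtain ⟨M, hM⟩ := id hb₂
    exact s₂.vertical_vorticity_eq_zero hC.C1_upper.u hC.C1_upper.v (fun p hp => (hM p hp).1)
      (fun p hp => (hM p hp).2.1) fun p hp => congrArg (fun q => q.2.2) (hω₂ p hp)
  obtain ⟨θ, β₂, hβ₂⟩ := exists_rotZ_eq ω₂.1 ω₂.2.1
  have e₂ : ω₂ = rotZ θ (0, β₂, 0) := by rw [← hβ₂, ← hvert]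
  have e₁ : ω₁ = rotZ θ (0, c * β₂, 0) := by
    rw [hc, e₂]
    simp only [rotZ, Prod.smul_mk, smul_eq_mul, Prod.mk.injEq]
    exact ⟨by ring, by ring, by ring⟩
  have hzero : rotZ θ (0, 0, 0) = 0 := by simp [rotZ]
  have W : ShearWave (C.inAxes θ) (c * β₂) β₂ :=
    { steady := hC.inAxes θ
      vort₁ := fun p hp => by
        have h := Fluid.vorticity_inAxes (F := C.F₁) (θ := θ) (p := p)
          (hC.C1_lower.diffAt (Config.isOpen_lower hC.η_C1.continuous) hp)
        rw [hω₁ _ hp, e₁, rotZ_neg_rotZ] at h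
        exact h
      vort₂ := fun p hp => by
        have h := Fluid.vorticity_inAxes (F := C.F₂) (θ := θ) (p := p)
          (hC.C1_upper.diffAt (Config.isOpen_upper hC.η_C1.continuous) hp)
        rw [hω₂ _ hp, e₂, rotZ_neg_rotZ] at h
        exact h
      β₁_ne := fun h => hω₁0 (by rw [e₁, h, hzero])
      β₂_ne := fun h => hω₂0 (by rw [e₂, h, hzero])
      bdd₁ := hb₁.inAxes θ
      bdd₂ := hb₂.inAxes θ }
  refine ⟨θ, c * β₂, β₂, e₁, e₂, ?_, fun hρ => ?_⟩
  · exact W.isTwoDimensional_or_isTrivialShear.imp_right And.right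
  · exact W.isTwoDimensional_or_isTrivialShear.resolve_right fun h => hρ h.1
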